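/- For every $n\in\mathbb N$ let $d=d_n\ge 2$, $r=r_n\ge1$, $m=m_n\ge1$ be integers (dependence on $n$ is mostly suppressed below), let $(\Omega,\mathcal F,(\mathcal F_t)_{t\in[0,1]},P)$ be a filtered probability space, and consider the factor model $Y=\beta X+Z$, where $X$, $Y$, $Z$ are semimartingales on $[0,1]$ of dimension $r$, $d$, $d$, $\beta$ is a non-random $d\times r$ matrix and $[Z,X]_1=0$. Write $\Sigma_X=[X,X]_1$, $\Sigma_Y=[Y,Y]_1$, $\Sigma_Z=[Z,Z]_1$ for the quadratic covariation matrices, assume that $\Sigma_X$ and $\Sigma_Z$ are a.s. invertible, and put $\Theta_Z=\Sigma_Z^{-1}$. **Notation.** $\|A\|_{\ell_\infty}=\max_{i,j}|A^{ij}|$; $|\!|\!|A|\!|\!|_w$ is the $\ell_w$-operator norm; $\Lambda_{\max},\Lambda_{\min}$ are the largest and smallest eigenvalues of a symmetric matrix; $s(A)=\#\{(i,j):i\ne j,\ A^{ij}\neq0\}$ and $\mathfrak d(A)=\max_j\#\{i\neq j:A^{ij}\ne0\}$; inequalities between vectors are componentwise; $\mathrm{vec}$ stacks columns; $C^{1/2}$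 is the positive semidefinite square root. All limits and the symbols $O$, $O_p$, $\to^p$ refer to $n\to\infty$. **Estimators.** Let $\hat\Sigma_{Y,n}$, $\hat\Sigma_{X,n}$, $\hat\Sigma_{YX,n}$ be random matrices with values in the symmetric $d\times d$, the positive semidefinite $r\times r$, and all $d\times r$ matrices. Let $\hat\Sigma_{X,n}^\dagger$ be a positive definite $r\times r$ random matrix equal to $\hat\Sigma_{X,n}^{-1}$ wherever $\hat\Sigma_{X,n}$ is invertible. Put $\hat\beta_n=\hat\Sigma_{YX,n}\hat\Sigma_{X,n}^\dagger$, $\hat\Sigma_{Z,n}=\hat\Sigma_{Y,n}-\hat\beta_n\hat\Sigma_{X,n}\hat\beta_n^\top$ and $\breve\Sigma_{Z,n}=\hat\Sigma_{Y,n}-\hat\Sigma_{YX,n}\beta^\top-\beta\hat\Sigma_{YX,n}^\top+\beta\hat\Sigma_{X,n}\beta^\top$. Let $\lambda_n$ be a positive-valued random variable, and let $\hat\Theta_{Z,\lambda_n}$ be a positive definite $d\times d$ random matrix which equals the minimizer over positive definite $\Theta$ of $$\mathrm{tr}(\Theta\hat\Sigma_{Z,n})-\log\det\Theta+\lambda_n\sum_{i\ne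 j}\sqrt{\hat\Sigma_{Z,n}^{ii}\hat\Sigma_{Z,n}^{jj}}\,|\Theta^{ij}|$$ whenever this problem (is well defined and) has a unique solution. Finally put $\hat\Sigma_{Y,\lambda_n}=\hat\beta_n\hat\Sigma_{X,n}\hat\beta_n^\top+\hat\Theta_{Z,\lambda_n}^{-1}$ and $\Gamma_{Z,n}=-(\hat\Theta_{Z,\lambda_n}-\hat\Theta_{Z,\lambda_n}\hat\Sigma_{Z,n}\hat\Theta_{Z,\lambda_n})$. **Assumptions.** 1. $\|\Sigma_Y\|_{\ell_\infty}=O_p(1)$ and $\|\beta\|_{\ell_\infty}=O(1)$. 2. $\Lambda_{\max}(\Sigma_Z)+1/\Lambda_{\min}(\Sigma_Z)=O_p(1)$ and $\|\Sigma_X\|_{\ell_\infty}+1/\Lambda_{\min}(\Sigma_X)=O_p(1)$. 3. $s(\Theta_Z)=O_p(s_n)$ and $\mathfrak d(\Theta_Z)=O_p(\mathfrak d_n)$ for deterministic sequences $s_n,\mathfrak d_n\in[1,\infty)$. 4. (Pervasive loadings) There are positive definite $r\times r$ matrices $\boldsymbol B=\boldsymbol B_n$ with $|\!|\!|d^{-1}\beta^\top\beta-\boldsymbol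 B|\!|\!|_2\to0$ and $\Lambda_{\min}(\boldsymbol B)^{-1}=O(1)$. 5. $\lambda_n^{-1}\|\hat\Sigma_{X,n}-\Sigma_X\|_{\ell_\infty}\to^p0$, $\lambda_n^{-1}\|\hat\Sigma_{YX,n}-\beta\hat\Sigma_{X,n}\|_{\ell_\infty}\to^p0$, $\lambda_n^{-1}\|\breve\Sigma_{Z,n}-\Sigma_Z\|_{\ell_\infty}\to^p0$, and $(s_n+r)\lambda_n\to^p0$. 6. The block matrix $\begin{pmatrix}\hat\Sigma_{X,n}&\hat\Sigma_{YX,n}^\top\\ \hat\Sigma_{YX,n}&\hat\Sigma_{Y,n}\end{pmatrix}$ is positive semidefinite with probability tending to $1$. 7. For every $n$, $a_n>0$ is a number, $\mathfrak C_n$ is a positive semidefinite $d^2\times d^2$ random matrix and $J_n$ is an $m\times d^2$ random matrix, such that $a_n|\!|\!|J_n|\!|\!|_\infty\lambda_n^2s_n\sqrt{\mathfrak d_n\log(m+1)}\to^p0$. With $\tilde J_{Z,n}=-J_n(\Theta_Z\otimes\Theta_Z)$ and $\zeta_n$ a $d^2$-dimensional standard Gaussian vector independent of $\mathcal F$, defined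 on an extension of the probability space, $$\lim_{n\to\infty}\sup_{y\in\mathbb R^m}\Bigl|P\bigl(a_n\tilde J_{Z,n}\mathrm{vec}(\breve\Sigma_{Z,n}-\Sigma_Z)\le y\bigr)-P\bigl(\tilde J_{Z,n}\mathfrak C_n^{1/2}\zeta_n\le y\bigr)\Bigr|=0,$$ $$\lim_{b\downarrow0}\limsup_{n\to\infty}P\bigl(\min\mathrm{diag}(\tilde J_{Z,n}\mathfrak C_n\tilde J_{Z,n}^\top)<b\bigr)=0.$$ 8. $a_n|\!|\!|J_n|\!|\!|_\infty\, r\,\mathfrak d_n\sqrt{\log(m+1)}/d\to^p0$. **Conclusion.** Then $$\lim_{n\to\infty}\sup_{y\in\mathbb R^m}\Bigl|P\bigl(a_nJ_n\mathrm{vec}(\hat\Sigma_{Y,\lambda_n}^{-1}-\Gamma_{Z,n}-\Sigma_Y^{-1})\le y\bigr)-P\bigl(\tilde J_{Z,n}\mathfrak C_n^{1/2}\zeta_n\le y\bigr)\Bigr|=0.$$ -/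

import Mathlib

open MeasureTheory ProbabilityTheory Filter Topology
open scoped Matrix Kronecker MatrixOrder

noncomputable section

/-! ### Matrix notation -/

/-- The entrywise maximum norm `‖A‖_{ℓ_∞} = max_{i,j} |A i j|`. -/
def entryMax {l k : Type*} (A : Matrix l k ℝ) : ℝ :=
  ⨆ p : l × k, |A p.1 p.2|

/-- The `ℓ_∞`-operator norm of `A`, i.e. its norm as an operator between real coordinate
spaces with the maximum norm. -/
def opNormInf {l k : Type*} [Fintype l] [Fintype k] [DecidableEq k] (A : Matrix l k ℝ) : ℝ :=
  ‖LinearMap.toContinuousLinearMap (Matrix.mulVecLin A)‖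

/-- The `ℓ_2`-operator norm (spectral norm) of a square matrix. -/
def opNormTwo {k : Type*} [Fintype k] [DecidableEq k] (A : Matrix k k ℝ) : ℝ :=
  ‖Matrix.toEuclideanCLM (𝕜 := ℝ) A‖

/-- The largest eigenvalue of a symmetric matrix. -/
def eigMax {k : Type*} [Fintype k] [DecidableEq k] (A : Matrix k k ℝ) : ℝ :=
  sSup (spectrum ℝ A)

/-- The smallest eigenvalue of a symmetric matrix. -/
def eigMin {k : Type*} [Fintype k] [DecidableEq k] (A : Matrix k k ℝ) : ℝ :=
  sInf (spectrum ℝ A)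

/-- `s(A)`: the number of non-zero off-diagonal entries of `A`. -/
def offDiagCount {d : ℕ} (A : Matrix (Fin d) (Fin d) ℝ) : ℕ :=
  (Finset.univ.filter fun p : Fin d × Fin d => A p.1 p.2 ≠ 0 ∧ p.1 ≠ p.2).card

/-- `𝔡(A)`: the largest number of non-zero off-diagonal entries in a column of `A`. -/
def maxDegree {d : ℕ} (A : Matrix (Fin d) (Fin d) ℝ) : ℕ :=
  Finset.univ.sup fun j : Fin d => (Finset.univ.filter fun i : Fin d => A i j ≠ 0 ∧ i ≠ j).card

/-- A random matrix: all entries are measurable. -/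
def MeasurableEntries {Ω l k : Type*} [MeasurableSpace Ω] (A : Ω → Matrix l k ℝ) : Prop :=
  ∀ i j, Measurable fun ω => A ω i j

/-! ### Stochastic order symbols along a sequence of probability spaces -/

/-- `ξ n = O_p(b n)`. -/
def IsBigOProb {Ω : ℕ → Type*} [∀ n, MeasurableSpace (Ω n)] (P : ∀ n, Measure (Ω n))
    (ξ : ∀ n, Ω n → ℝ) (b : ℕ → ℝ) : Prop :=
  ∀ ε : ℝ, 0 < ε → ∃ K : ℝ, ∀ᶠ n in atTop, (P n).real {ω | K * b n < |ξ n ω|} ≤ ε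

/-- `ξ n → 0` in probability. -/
def TendstoZeroInProb {Ω : ℕ → Type*} [∀ n, MeasurableSpace (Ω n)] (P : ∀ n, Measure (Ω n))
    (ξ : ∀ n, Ω n → ℝ) : Prop :=
  ∀ ε : ℝ, 0 < ε → Tendsto (fun n => (P n).real {ω | ε < |ξ n ω|}) atTop (𝓝 0)

/-! ### Semimartingales on `[0,1]` and their quadratic covariation at time `1` -/

/-- Right-continuous with left limits. -/
def IsCadlagPath (f : unitInterval → ℝ) : Prop :=
  ∀ t, ContinuousWithinAt f (Set.Ici t) t ∧ ∃ l, Tendsto f (𝓝[<] t) (𝓝 l)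

/-- A real semimartingale `U = U_0 + L + A`, with `L` a càdlàg local martingale and `A` a càdlàg
adapted process of finite variation, both started at `0`. -/
def IsSemimartingale {Ω : Type*} [mΩ : MeasurableSpace Ω] (𝓕 : Filtration unitInterval mΩ)
    (P : Measure Ω) (U : unitInterval → Ω → ℝ) : Prop :=
  Adapted 𝓕 U ∧
  ∃ L A : unitInterval → Ω → ℝ,
    (∀ᵐ ω ∂P, L 0 ω = 0) ∧ (∀ᵐ ω ∂P, A 0 ω = 0) ∧
    (∀ᵐ ω ∂P, IsCadlagPath fun t => L t ω) ∧
    Locally (fun V => Martingale V 𝓕 P) 𝓕 L P ∧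
    Adapted 𝓕 A ∧
    (∀ᵐ ω ∂P, IsCadlagPath fun t => A t ω) ∧
    (∀ᵐ ω ∂P, BoundedVariationOn (fun t => A t ω) Set.univ) ∧
    (∀ᵐ ω ∂P, ∀ t, U t ω = U 0 ω + L t ω + A t ω)

/-- `Q` is (a version of) the quadratic covariation `[U,V]_1`: the limit in probability of
`∑ₖ (U_{t_{k+1}} - U_{t_k}) (V_{t_{k+1}} - V_{t_k})` over the deterministic partitions
`0 = t_0 ≤ t_1 ≤ ... ≤ t_N = 1` as the mesh tends to `0`. -/
def IsQuadCovariation {Ω : Type*} [MeasurableSpace Ω] (P : Measure Ω)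
    (U V : unitInterval → Ω → ℝ) (Q : Ω → ℝ) : Prop :=
  ∀ ε : ℝ, 0 < ε → ∃ δ : ℝ, 0 < δ ∧ ∀ (N : ℕ) (t : ℕ → unitInterval),
    Monotone t → t 0 = 0 → t N = 1 → (∀ k < N, (t (k + 1) : ℝ) - t k ≤ δ) →
    P.real {ω | ε ≤ |∑ k ∈ Finset.range N,
      (U (t (k + 1)) ω - U (t k) ω) * (V (t (k + 1)) ω - V (t k) ω) - Q ω|} ≤ ε

/-- The continuous-time factor model `Y = β X + Z` with `d` assets and `r` factors:
`X`, `Y`, `Z` are semimartingales, `[Z,X]_1 = 0`, and `SX`, `SY`, `SZ` are the quadratic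
covariation matrices `Σ_X = [X,X]_1`, `Σ_Y = [Y,Y]_1`, `Σ_Z = [Z,Z]_1`, the matrices `Σ_X` and
`Σ_Z` being almost surely invertible. -/
structure FactorModel {Ω : Type*} [mΩ : MeasurableSpace Ω] (P : Measure Ω) (d r : ℕ) where
  filt : Filtration unitInterval mΩ
  X : Fin r → unitInterval → Ω → ℝ
  Y : Fin d → unitInterval → Ω → ℝ
  Z : Fin d → unitInterval → Ω → ℝ
  β : Matrix (Fin d) (Fin r) ℝ
  SX : Ω → Matrix (Fin r) (Fin r) ℝ
  SY : Ω → Matrix (Fin d) (Fin d) ℝ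
  SZ : Ω → Matrix (Fin d) (Fin d) ℝ
  semimartingale_X : ∀ i, IsSemimartingale filt P (X i)
  semimartingale_Y : ∀ i, IsSemimartingale filt P (Y i)
  semimartingale_Z : ∀ i, IsSemimartingale filt P (Z i)
  factor_eq : ∀ᵐ ω ∂P, ∀ t i, Y i t ω = ∑ k, β i k * X k t ω + Z i t ω
  covariation_ZX : ∀ i k, IsQuadCovariation P (Z i) (X k) fun _ => 0
  measurable_SX : MeasurableEntries SX
  measurable_SY : MeasurableEntries SY
  measurable_SZ : MeasurableEntries SZ
  covariation_X : ∀ i j, IsQuadCovariation P (X i) (X j) fun ω => SX ω i j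
  covariation_Y : ∀ i j, IsQuadCovariation P (Y i) (Y j) fun ω => SY ω i j
  covariation_Z : ∀ i j, IsQuadCovariation P (Z i) (Z j) fun ω => SZ ω i j
  invertible_SX : ∀ᵐ ω ∂P, IsUnit (SX ω)
  invertible_SZ : ∀ᵐ ω ∂P, IsUnit (SZ ω)

/-- The residual precision matrix `Θ_Z = Σ_Z⁻¹`. -/
def FactorModel.ΘZ {Ω : Type*} [MeasurableSpace Ω] {P : Measure Ω} {d r : ℕ}
    (M : FactorModel P d r) (ω : Ω) : Matrix (Fin d) (Fin d) ℝ :=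
  (M.SZ ω)⁻¹

/-! ### Weighted graphical Lasso -/

/-- The objective `tr(ΘS) - log det Θ + lam ∑_{i ≠ j} √(S^{ii} S^{jj}) |Θ^{ij}|`. -/
def glassoObjective {d : ℕ} (S : Matrix (Fin d) (Fin d) ℝ) (lam : ℝ)
    (T : Matrix (Fin d) (Fin d) ℝ) : ℝ :=
  (T * S).trace - Real.log T.det +
    lam * ∑ i, ∑ j, if i ≠ j then Real.sqrt (S i i * S j j) * |T i j| else 0

/-- `T` solves the weighted graphical Lasso problem for `S` over positive definite matrices.
The problem is meaningful only if the radicands `S^{ii} S^{jj}` are non-negative. -/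
def IsGlassoSolution {d : ℕ} (S : Matrix (Fin d) (Fin d) ℝ) (lam : ℝ)
    (T : Matrix (Fin d) (Fin d) ℝ) : Prop :=
  (∀ i j, 0 ≤ S i i * S j j) ∧ T.PosDef ∧
    ∀ T' : Matrix (Fin d) (Fin d) ℝ, T'.PosDef → glassoObjective S lam T ≤ glassoObjective S lam T'

/-- Initial estimators `hSX`, `hSY`, `hSYX` of `Σ_X`, `Σ_Y`, `Σ_{YX}`, a positive definite
random matrix `hSXdag` which equals `hSX⁻¹` wherever the latter exists, a positive penalty
parameter `lam`, and the weighted graphical Lasso estimator `hΘZ` for the residual covariance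
estimator `hSY - hβ hSX hβᵀ`, `hβ = hSYX hSXdag`. Where the optimization problem does not have a
unique solution, `hΘZ` is an arbitrary positive definite matrix. -/
structure FactorEstimators (Ω : Type*) [MeasurableSpace Ω] (d r : ℕ) where
  hSX : Ω → Matrix (Fin r) (Fin r) ℝ
  hSY : Ω → Matrix (Fin d) (Fin d) ℝ
  hSYX : Ω → Matrix (Fin d) (Fin r) ℝ
  hSXdag : Ω → Matrix (Fin r) (Fin r) ℝ
  lam : Ω → ℝ
  hΘZ : Ω → Matrix (Fin d) (Fin d) ℝ
  measurable_hSX : MeasurableEntries hSX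
  measurable_hSY : MeasurableEntries hSY
  measurable_hSYX : MeasurableEntries hSYX
  measurable_hSXdag : MeasurableEntries hSXdag
  measurable_lam : Measurable lam
  measurable_hΘZ : MeasurableEntries hΘZ
  posSemidef_hSX : ∀ ω, (hSX ω).PosSemidef
  isSymm_hSY : ∀ ω, (hSY ω).IsSymm
  posDef_hSXdag : ∀ ω, (hSXdag ω).PosDef
  hSXdag_eq : ∀ ω, IsUnit (hSX ω) → hSXdag ω = (hSX ω)⁻¹
  lam_pos : ∀ ω, 0 < lam ω
  posDef_hΘZ : ∀ ω, (hΘZ ω).PosDef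
  hΘZ_eq : ∀ ω T,
    IsGlassoSolution (hSY ω - (hSYX ω * hSXdag ω) * hSX ω * (hSYX ω * hSXdag ω)ᵀ) (lam ω) T →
    (∀ T', IsGlassoSolution
      (hSY ω - (hSYX ω * hSXdag ω) * hSX ω * (hSYX ω * hSXdag ω)ᵀ) (lam ω) T' → T' = T) →
    hΘZ ω = T

namespace FactorEstimators

variable {Ω : Type*} [MeasurableSpace Ω] {d r : ℕ}

/-- The estimator `β̂ = Σ̂_{YX} Σ̂_X^†` of the loading matrix. -/
def hβ (E : FactorEstimators Ω d r) (ω : Ω) : Matrix (Fin d) (Fin r) ℝ :=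
  E.hSYX ω * E.hSXdag ω

/-- `Σ̂_Z = Σ̂_Y - β̂ Σ̂_X β̂ᵀ`. -/
def hSZ (E : FactorEstimators Ω d r) (ω : Ω) : Matrix (Fin d) (Fin d) ℝ :=
  E.hSY ω - E.hβ ω * E.hSX ω * (E.hβ ω)ᵀ

/-- `Σ̂_{Y,λ} = β̂ Σ̂_X β̂ᵀ + Θ̂_{Z,λ}⁻¹`. -/
def hSYlam (E : FactorEstimators Ω d r) (ω : Ω) : Matrix (Fin d) (Fin d) ℝ :=
  E.hβ ω * E.hSX ω * (E.hβ ω)ᵀ + (E.hΘZ ω)⁻¹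

/-- `Γ_Z = -(Θ̂_{Z,λ} - Θ̂_{Z,λ} Σ̂_Z Θ̂_{Z,λ})`. -/
def ΓZ (E : FactorEstimators Ω d r) (ω : Ω) : Matrix (Fin d) (Fin d) ℝ :=
  -(E.hΘZ ω - E.hΘZ ω * E.hSZ ω * E.hΘZ ω)

/-- `Σ̆_Z = Σ̂_Y - Σ̂_{YX} βᵀ - β Σ̂_{YX}ᵀ + β Σ̂_X βᵀ`. -/
def breveSZ (E : FactorEstimators Ω d r) (β : Matrix (Fin d) (Fin r) ℝ) (ω : Ω) :
    Matrix (Fin d) (Fin d) ℝ :=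
  E.hSY ω - E.hSYX ω * βᵀ - β * (E.hSYX ω)ᵀ + β * E.hSX ω * βᵀ

/-- The joint covariance estimator `(Σ̂_X, Σ̂_{YX}ᵀ; Σ̂_{YX}, Σ̂_Y)`. -/
def barS (E : FactorEstimators Ω d r) (ω : Ω) : Matrix (Fin r ⊕ Fin d) (Fin r ⊕ Fin d) ℝ :=
  Matrix.fromBlocks (E.hSX ω) (E.hSYX ω)ᵀ (E.hSYX ω) (E.hSY ω)

end FactorEstimators

/-! ### Distribution functions -/

/-- `P(V ≤ y)` for a random vector `V` (componentwise inequality). -/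
def vecCDF {Ω : Type*} [MeasurableSpace Ω] {m : ℕ} (P : Measure Ω) (V : Ω → Fin m → ℝ)
    (y : Fin m → ℝ) : ℝ :=
  P.real {ω | ∀ i, V ω i ≤ y i}

/-- `P(H C^{1/2} ζ ≤ y)`, where `ζ` is a standard Gaussian vector independent of the whole
`σ`-algebra of `Ω`, realized as the second coordinate of the product extension of `Ω`. Here
`C^{1/2}` is the positive semidefinite square root. The coordinates of `ℝ^(d²)` are indexed by
pairs, in agreement with `Matrix.vec` and the Kronecker product. -/
def mixedNormalCDF {Ω : Type*} [MeasurableSpace Ω] {m d : ℕ} (P : Measure Ω)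
    (H : Ω → Matrix (Fin m) (Fin d × Fin d) ℝ)
    (C : Ω → Matrix (Fin d × Fin d) (Fin d × Fin d) ℝ) (y : Fin m → ℝ) : ℝ :=
  (P.prod (Measure.pi fun _ : Fin d × Fin d => gaussianReal 0 1)).real
    {p | ∀ i, ((H p.1 * CFC.sqrt (C p.1)) *ᵥ p.2) i ≤ y i}

/-- `J̃_Z = -J (Θ_Z ⊗ Θ_Z)`. -/
def FactorModel.tildeJ {Ω : Type*} [MeasurableSpace Ω] {P : Measure Ω} {d r m : ℕ}
    (M : FactorModel P d r) (J : Ω → Matrix (Fin m) (Fin d × Fin d) ℝ) (ω : Ω) :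
    Matrix (Fin m) (Fin d × Fin d) ℝ :=
  -(J ω * (M.ΘZ ω ⊗ₖ M.ΘZ ω))

end

/-! The theorem is a perturbation statement. Since `J̃_Z = -J (Θ_Z ⊗ Θ_Z)`, the vector with known
loadings, whose mixed normal approximation is assumed, equals `-a J vec (Θ_Z (Σ̆_Z - Σ_Z) Θ_Z)`. The
estimator differs from it by `a J vec R`, where `R = Σ̂_{Y,λ}⁻¹ - Γ_Z - Σ_Y⁻¹ + Θ_Z (Σ̆_Z - Σ_Z)
Θ_Z`. Nazarov's inequality, applied conditionally on `ω`, says that widening a polytope with `m`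
facets by `ε` raises its Gaussian measure by at most a multiple of `ε √(log (m + 1))` when the
variances stay away from zero. Hence coordinatewise perturbations of size `o_p(1 / √(log (m + 1)))`
do no harm (`tendsto_iSup_vecCDF_sub_mixedNormalCDF_of_close`).

The entries of `R` are bounded deterministically on an event of probability close to one
(`GoodEvent.expansion`, `exists_eventuallyUpTo_goodEvent`). `R` has three parts. Two are factor
effects: because `Σ_Y = β Σ_X βᵀ + Σ_Z`, the Woodbury formula writes `Σ_Y⁻¹ - Θ_Z` through the
inverse of `Σ_X⁻¹ + βᵀ Θ_Z β`, which is of order `1 / d` for pervasive loadings; the same holds for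
the estimated matrices (`factor_effect_le`). The third is the error of the de-biased graphical Lasso
(`debiased_remainder_le`): with `D = Θ̂_Z - Θ_Z`, the terms linear in `D` alone cancel, and what is
left is of second order. Estimating the loadings adds only a quadratic term, since completing the
square gives `Σ̂_Z = Σ̆_Z - U Σ̂_X⁻¹ Uᵀ` with `U = Σ̂_{YX} - β Σ̂_X`.

The size of `D` comes from an oracle inequality (`exists_unique_graphicalLasso`, `glasso_rate`):
strong concavity of `log det` near the target beats the noise, which the penalty dominates off the
diagonal. The target is rescaled to have the variances of `Σ̂_Z`, so the unpenalized diagonal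
carries no noise and the rate involves the sparsity but not the dimension. -/

noncomputable section

set_option linter.unusedSectionVars false

/-! ### Gaussian anti-concentration and Nazarov's inequality. -/

/-- Resampling the component of a standard Gaussian vector in a unit direction `u` does not change
its law. -/
lemma map_resample_pi_gaussianReal {ι : Type*} [Fintype ι] (u : ι → ℝ) (hu : u ⬝ᵥ u = 1) :
    ((gaussianReal 0 1).prod (Measure.pi fun _ : ι => gaussianReal 0 1)).map
      (fun p => p.2 + (p.1 - u ⬝ᵥ p.2) • u) = Measure.pi fun _ : ι => gaussianReal 0 1 := by
  have hmeas : Measurable fun p : ℝ × (ι → ℝ) => p.2 + (p.1 - u ⬝ᵥ p.2) • u := by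
    unfold dotProduct; fun_prop
  have key : (((gaussianReal 0 1).prod (Measure.pi fun _ : ι => gaussianReal 0 1)).map
      (fun p => p.2 + (p.1 - u ⬝ᵥ p.2) • u)).map (WithLp.toLp 2)
      = (Measure.pi fun _ : ι => gaussianReal 0 1).map (WithLp.toLp 2) := by
    rw [Measure.map_map (by fun_prop) hmeas]
    apply Measure.ext_of_charFun (E := EuclideanSpace ℝ ι)
    ext t
    -- `t'` is the projection of `t` onto the complement of `u`. Pairing with `t` separates the
    -- fresh coordinate from the old vector, so the characteristic function factorizes.
    set t' : EuclideanSpace ℝ ι := WithLp.toLp 2 (t.ofLp - (u ⬝ᵥ t.ofLp) • u) with ht'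
    have hinner : ∀ p : ℝ × (ι → ℝ),
        inner ℝ (((WithLp.toLp 2) ∘ fun p : ℝ × (ι → ℝ) => p.2 + (p.1 - u ⬝ᵥ p.2) • u) p
          : EuclideanSpace ℝ ι) t
        = p.1 * (u ⬝ᵥ t.ofLp) + inner ℝ (WithLp.toLp 2 p.2 : EuclideanSpace ℝ ι) t' := by
      intro p
      simp only [Function.comp, EuclideanSpace.inner_eq_star_dotProduct, ht']
      simp only [star_trivial, dotProduct_add, dotProduct_smul, sub_dotProduct, smul_dotProduct,
        smul_eq_mul]
      rw [dotProduct_comm t.ofLp u]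
      ring
    rw [charFun_apply, integral_map (by fun_prop) (by fun_prop), map_pi_eq_stdGaussian]
    simp_rw [hinner]
    have hsplit : ∀ p : ℝ × (ι → ℝ),
        Complex.exp (((p.1 * (u ⬝ᵥ t.ofLp)
          + inner ℝ (WithLp.toLp 2 p.2 : EuclideanSpace ℝ ι) t' : ℝ) : ℂ) * Complex.I)
        = Complex.exp ((u ⬝ᵥ t.ofLp : ℝ) * p.1 * Complex.I) *
          Complex.exp ((inner ℝ (WithLp.toLp 2 p.2 : EuclideanSpace ℝ ι) t' : ℝ) * Complex.I) := by
      intro p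
      rw [← Complex.exp_add]
      congr 1
      push_cast
      ring
    simp_rw [hsplit]
    rw [integral_prod_mul (μ := gaussianReal 0 1)
      (ν := Measure.pi fun _ : ι => gaussianReal 0 1)
      (fun s : ℝ => Complex.exp ((u ⬝ᵥ t.ofLp : ℝ) * s * Complex.I))
      (fun x : ι → ℝ => Complex.exp
        ((inner ℝ (WithLp.toLp 2 x : EuclideanSpace ℝ ι) t' : ℝ) * Complex.I)),
      ← charFun_apply_real, charFun_gaussianReal]
    have h2 : ∫ x : ι → ℝ, Complex.exp
        ((inner ℝ (WithLp.toLp 2 x : EuclideanSpace ℝ ι) t' : ℝ) * Complex.I)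
        ∂(Measure.pi fun _ : ι => gaussianReal 0 1)
        = charFun (stdGaussian (EuclideanSpace ℝ ι)) t' := by
      rw [← map_pi_eq_stdGaussian, charFun_apply, integral_map (by fun_prop) (by fun_prop)]
    rw [h2, charFun_stdGaussian, charFun_stdGaussian, ← Complex.exp_add]
    congr 1
    -- Pythagoras reunites the two Gaussian exponents.
    have h3 : ‖t‖ ^ 2 = (u ⬝ᵥ t.ofLp) ^ 2 + ‖t'‖ ^ 2 := by
      rw [EuclideanSpace.real_norm_sq_eq, EuclideanSpace.real_norm_sq_eq]
      have e1 : ∀ v : ι → ℝ, ∑ i, v i ^ 2 = v ⬝ᵥ v := fun v => by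
        simp [dotProduct, sq]
      have e3 : ∑ i, t'.ofLp i ^ 2 = (t.ofLp - (u ⬝ᵥ t.ofLp) • u) ⬝ᵥ (t.ofLp - (u ⬝ᵥ t.ofLp) • u) := by
        rw [← e1]
      rw [e3, e1]
      simp only [sub_dotProduct, dotProduct_sub, smul_dotProduct, dotProduct_smul, smul_eq_mul, hu]
      rw [dotProduct_comm t.ofLp u]
      ring
    rw [← Complex.ofReal_pow ‖t‖, h3]
    push_cast
    ring
  have hinj := congrArg (Measure.map (WithLp.ofLp : EuclideanSpace ℝ ι → ι → ℝ)) key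
  rw [Measure.map_map (by fun_prop) (by fun_prop), Measure.map_map (by fun_prop) hmeas,
    Measure.map_map (by fun_prop) (by fun_prop)] at hinj
  have hid : (WithLp.ofLp : EuclideanSpace ℝ ι → ι → ℝ) ∘ WithLp.toLp 2 = id := rfl
  rw [hid, Function.id_comp, Measure.map_id] at hinj
  exact hinj

/-- Mills-type bound: the standard Gaussian density at `x ≤ M` is at most a multiple of `M` times
the upper tail at `x`. -/
lemma gaussianPDF_le_mul_tail {M x : ℝ} (hM : 1 ≤ M) (hx : x ≤ M) :
    gaussianPDF 0 1 x ≤ ENNReal.ofReal (Real.exp (3 / 2) * M) * gaussianReal 0 1 (Set.Ici x) := by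
  have hM0 : 0 < M := by linarith
  -- On `[x, x + 1/M]` the exponent falls by `(s - x)(s + x)/2`, which is at most `3/2` because `s -
  -- x ≤ 1/M` and `s + x ≤ 3M`. An interval of length `1/M` therefore already carries enough of the
  -- tail.
  have h1 : ENNReal.ofReal (Real.exp (-(3 / 2))) * gaussianPDF 0 1 x * ENNReal.ofReal (1 / M)
      ≤ gaussianReal 0 1 (Set.Ici x) := by
    calc _ = ∫⁻ _ in Set.Icc x (x + 1 / M),
            ENNReal.ofReal (Real.exp (-(3 / 2))) * gaussianPDF 0 1 x := by
          rw [setLIntegral_const, Real.volume_Icc]; congr 2; ring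
      _ ≤ ∫⁻ s in Set.Icc x (x + 1 / M), gaussianPDF 0 1 s := by
          refine setLIntegral_mono (by fun_prop) fun s hs => ?_
          simp only [gaussianPDF_def]
          rw [← ENNReal.ofReal_mul (by positivity)]
          apply ENNReal.ofReal_le_ofReal
          simp only [gaussianPDFReal, sub_zero, NNReal.coe_one, mul_one]
          rw [mul_left_comm]
          refine mul_le_mul_of_nonneg_left ?_ (by positivity)
          rw [← Real.exp_add]
          apply Real.exp_le_exp.2
          have hs1 : s - x ≤ 1 / M := by linarith [hs.2]
          have hs0 : 0 ≤ s - x := by linarith [hs.1]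
          have hM1 : 1 / M ≤ 1 := by rw [div_le_one hM0]; exact hM
          have hsx : (s - x) * (s + x) ≤ 3 := by
            by_cases hc : s + x ≤ 0
            · nlinarith
            · push Not at hc
              calc (s - x) * (s + x) ≤ (1 / M) * (3 * M) := by
                    apply mul_le_mul hs1 _ hc.le (by positivity)
                    linarith
                _ = 3 := by field_simp
          nlinarith
      _ ≤ ∫⁻ s in Set.Ici x, gaussianPDF 0 1 s :=
          lintegral_mono_set fun s hs => hs.1
      _ = gaussianReal 0 1 (Set.Ici x) := (gaussianReal_apply 0 one_ne_zero _).symm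
  calc gaussianPDF 0 1 x = ENNReal.ofReal (Real.exp (3 / 2) * M) *
        (ENNReal.ofReal (Real.exp (-(3 / 2))) * gaussianPDF 0 1 x * ENNReal.ofReal (1 / M)) := by
        rw [mul_right_comm, ← mul_assoc, ← ENNReal.ofReal_mul (by positivity),
          ← ENNReal.ofReal_mul (by positivity)]
        have : Real.exp (3 / 2) * M * (Real.exp (-(3 / 2)) * (1 / M)) = 1 := by
          rw [Real.exp_neg]; field_simp
        rw [this]; simp
    _ ≤ _ := by gcongr

/-- Anti-concentration on the real line, for sets which are closed upwards. -/
lemma gaussianReal_inter_Ioc_le {A : Set ℝ} (hA : ∀ x ∈ A, ∀ z, x ≤ z → z ∈ A)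
    {m : ℕ} (hm : 1 ≤ m) (y : ℝ) {ε : ℝ} (hε1 : ε ≤ 1) :
    gaussianReal 0 1 (A ∩ Set.Ioc y (y + ε)) ≤
      ENNReal.ofReal ε * (ENNReal.ofReal (Real.exp (3 / 2) * (Real.sqrt (2 * Real.log m) + 1))
        * gaussianReal 0 1 A + ENNReal.ofReal (1 / m)) := by
  set T := Real.sqrt (2 * Real.log m) with hT
  have hT0 : 0 ≤ T := Real.sqrt_nonneg _
  have hm0 : (0 : ℝ) < m := by exact_mod_cast hm
  set K := ENNReal.ofReal (Real.exp (3 / 2) * (T + 1)) * gaussianReal 0 1 A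
    + ENNReal.ofReal (1 / m) with hK
  have hAm : MeasurableSet A := by
    have : A.OrdConnected := ⟨fun x hx _ _ z hz => hA x hx z hz.1⟩
    exact this.measurableSet
  -- Below the level `T = √(2 log m)` the Mills-type bound applies, and the tail at `x` lies in `A`.
  -- Above it the density is at most `1/m`, an error that remains bounded when summed over `m`
  -- facets.
  have hpt : ∀ x ∈ A ∩ Set.Ioc y (y + ε), gaussianPDF 0 1 x ≤ K := by
    rintro x ⟨hxA, hx1, hx2⟩
    by_cases hyT : y ≤ T
    · refine le_trans (gaussianPDF_le_mul_tail (M := T + 1) (by linarith) (by linarith)) ?_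
      refine le_trans ?_ le_self_add
      gcongr
      exact fun z hz => hA x hxA z hz
    · push Not at hyT
      refine le_trans ?_ le_add_self
      rw [gaussianPDF_def]
      apply ENNReal.ofReal_le_ofReal
      simp only [gaussianPDFReal, sub_zero, NNReal.coe_one, mul_one]
      have h1 : (Real.sqrt (2 * Real.pi))⁻¹ ≤ 1 := by
        apply inv_le_one_of_one_le₀
        rw [Real.one_le_sqrt]
        nlinarith [Real.pi_gt_three]
      have h2 : Real.exp (-x ^ 2 / 2) ≤ 1 / m := by
        have hlog : 0 ≤ Real.log m := Real.log_nonneg (by exact_mod_cast hm)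
        have hTT : T ^ 2 = 2 * Real.log m := Real.sq_sqrt (by positivity)
        calc Real.exp (-x ^ 2 / 2) ≤ Real.exp (-Real.log m) := by
              apply Real.exp_le_exp.2; nlinarith
          _ = 1 / m := by rw [Real.exp_neg, Real.exp_log hm0, one_div]
      calc _ ≤ 1 * (1 / (m : ℝ)) := mul_le_mul h1 h2 (Real.exp_nonneg _) zero_le_one
        _ = _ := one_mul _
  calc gaussianReal 0 1 (A ∩ Set.Ioc y (y + ε))
      = ∫⁻ x in A ∩ Set.Ioc y (y + ε), gaussianPDF 0 1 x := gaussianReal_apply 0 one_ne_zero _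
    _ ≤ ∫⁻ _ in A ∩ Set.Ioc y (y + ε), K :=
        setLIntegral_mono' (hAm.inter measurableSet_Ioc) hpt
    _ = K * volume (A ∩ Set.Ioc y (y + ε)) := setLIntegral_const _ _
    _ ≤ K * volume (Set.Ioc y (y + ε)) := by gcongr; exact Set.inter_subset_right
    _ = ENNReal.ofReal ε * K := by rw [Real.volume_Ioc, add_sub_cancel_left, mul_comm]

/-- Anti-concentration of a standard Gaussian vector in a unit direction `u`, on a set which is
closed under shifts along `u`. -/
lemma pi_gaussianReal_inter_slab_le {ι : Type*} [Fintype ι] (u : ι → ℝ) (hu : u ⬝ᵥ u = 1)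
    {B : Set (ι → ℝ)} (hB : MeasurableSet B) (hshift : ∀ x ∈ B, ∀ t : ℝ, 0 ≤ t → x + t • u ∈ B)
    {m : ℕ} (hm : 1 ≤ m) (y : ℝ) {ε : ℝ} (hε1 : ε ≤ 1) :
    (Measure.pi fun _ : ι => gaussianReal 0 1) (B ∩ {x | u ⬝ᵥ x ∈ Set.Ioc y (y + ε)}) ≤
      ENNReal.ofReal ε * (ENNReal.ofReal (Real.exp (3 / 2) * (Real.sqrt (2 * Real.log m) + 1))
        * (Measure.pi fun _ : ι => gaussianReal 0 1) B + ENNReal.ofReal (1 / m)) := by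
  set γ := Measure.pi fun _ : ι => gaussianReal 0 1
  set Ψ : ℝ × (ι → ℝ) → ι → ℝ := fun p => p.2 + (p.1 - u ⬝ᵥ p.2) • u with hΨdef
  have hΨ : Measurable Ψ := by rw [hΨdef]; unfold dotProduct; fun_prop
  have hmap : ((gaussianReal 0 1).prod γ).map Ψ = γ := map_resample_pi_gaussianReal u hu
  have huΨ : ∀ p, u ⬝ᵥ Ψ p = p.1 := fun p => by
    simp [hΨdef, dotProduct_add, dotProduct_smul, hu]
  have hslab : MeasurableSet {x : ι → ℝ | u ⬝ᵥ x ∈ Set.Ioc y (y + ε)} := by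
    apply measurableSet_Ioc.preimage (f := fun x : ι → ℝ => u ⬝ᵥ x)
    unfold dotProduct; fun_prop
  have hfib : ∀ S : Set (ι → ℝ), MeasurableSet S →
      γ S = ∫⁻ x, gaussianReal 0 1 {s | Ψ (s, x) ∈ S} ∂γ := fun S hS => by
    conv_lhs => rw [← hmap]
    rw [Measure.map_apply hΨ hS, Measure.prod_apply_symm (hΨ hS)]
    rfl
  -- Given `x`, the resampled point moves along `u` as `s` grows, so the fibres of `B` are closed
  -- upwards and the one-dimensional bound applies to each of them.
  have hup : ∀ x, ∀ s ∈ {s | Ψ (s, x) ∈ B}, ∀ z, s ≤ z → z ∈ {s | Ψ (s, x) ∈ B} := by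
    intro x s hs z hz
    have := hshift _ hs (z - s) (by linarith)
    have e : Ψ (s, x) + (z - s) • u = Ψ (z, x) := by
      simp only [hΨdef]
      rw [add_assoc, ← add_smul]
      congr 2
      ring
    rw [e] at this
    exact this
  have hmeasB : Measurable fun x => gaussianReal 0 1 {s | Ψ (s, x) ∈ B} :=
    measurable_measure_prodMk_right (hΨ hB)
  rw [hfib _ (hB.inter hslab)]
  calc _ ≤ ∫⁻ x, ENNReal.ofReal ε *
        (ENNReal.ofReal (Real.exp (3 / 2) * (Real.sqrt (2 * Real.log m) + 1))
        * gaussianReal 0 1 {s | Ψ (s, x) ∈ B} + ENNReal.ofReal (1 / m)) ∂γ := by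
        refine lintegral_mono fun x => ?_
        refine le_trans (measure_mono ?_) (gaussianReal_inter_Ioc_le (hup x) hm y hε1)
        rintro s ⟨h1, h2⟩
        refine ⟨h1, ?_⟩
        have h2' : u ⬝ᵥ Ψ (s, x) ∈ Set.Ioc y (y + ε) := h2
        rwa [huΨ] at h2'
    _ = _ := by
        rw [lintegral_const_mul _ (by fun_prop), lintegral_add_right _ measurable_const,
          lintegral_const_mul _ hmeasB, ← hfib _ hB]
        simp

/-- **Nazarov's inequality** for unit normals: the probability that a standard Gaussian vector
lies in a strip of width `ε` around a polytope with `m` facets is of order `ε √(log m)`. -/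
lemma pi_gaussianReal_strip_le {ι : Type*} [Fintype ι] {m : ℕ} (hm : 1 ≤ m)
    (u : Fin m → ι → ℝ) (hu : ∀ i, u i ⬝ᵥ u i = 1) (y : Fin m → ℝ) {ε : ℝ}
    (hε1 : ε ≤ 1) :
    (Measure.pi fun _ : ι => gaussianReal 0 1)
        {x | (∃ i, y i < u i ⬝ᵥ x) ∧ ∀ i, u i ⬝ᵥ x ≤ y i + ε} ≤
      ENNReal.ofReal ε *
        (ENNReal.ofReal (Real.exp (3 / 2) * (Real.sqrt (2 * Real.log m) + 1)) + 1) := by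
  set γ := Measure.pi fun _ : ι => gaussianReal 0 1
  have : NeZero m := ⟨by omega⟩
  have hum : ∀ i, Measurable fun x : ι → ℝ => u i ⬝ᵥ x := fun i => by
    unfold dotProduct; fun_prop
  -- `B i` collects the points at which facet `i` is the most violated one, ties going to the
  -- smallest index. These sets partition the space, so their measures sum to one and no factor `m`
  -- is lost.
  let B : Fin m → Set (ι → ℝ) := fun i => {x | ∀ j, u j ⬝ᵥ x - y j ≤ u i ⬝ᵥ x - y i ∧
    (j < i → u j ⬝ᵥ x - y j < u i ⬝ᵥ x - y i)}
  have hBm : ∀ i, MeasurableSet (B i) := by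
    intro i
    have : B i = ⋂ j, {x | u j ⬝ᵥ x - y j ≤ u i ⬝ᵥ x - y i} ∩
        {x | j < i → u j ⬝ᵥ x - y j < u i ⬝ᵥ x - y i} := by
      ext x; simp [B]
    rw [this]
    refine MeasurableSet.iInter fun j => MeasurableSet.inter ?_ ?_
    · exact measurableSet_le ((hum j).sub_const _) ((hum i).sub_const _)
    · by_cases hji : j < i
      · simp only [hji, true_imp_iff]
        exact measurableSet_lt ((hum j).sub_const _) ((hum i).sub_const _)
      · simp [hji]
  have hBd : Pairwise fun i j => Disjoint (B i) (B j) := by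
    intro i j hij
    rw [Set.disjoint_left]
    intro x hi hj
    rcases lt_or_gt_of_ne hij with h | h
    · exact absurd ((hj i).2 h) (not_lt.2 (hi j).1)
    · exact absurd ((hi j).2 h) (not_lt.2 (hj i).1)
  have hcover : ∀ x, ∃ i, x ∈ B i := by
    intro x
    let M : Finset (Fin m) := Finset.univ.filter fun i => ∀ j, u j ⬝ᵥ x - y j ≤ u i ⬝ᵥ x - y i
    have hM : M.Nonempty := by
      obtain ⟨i, -, hi⟩ := Finset.exists_max_image Finset.univ (fun i => u i ⬝ᵥ x - y i)
        ⟨0, Finset.mem_univ _⟩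
      exact ⟨i, by simpa [M] using hi⟩
    have hmin := Finset.min'_mem M hM
    refine ⟨M.min' hM, fun j => ⟨(Finset.mem_filter.1 hmin).2 j, fun hj => ?_⟩⟩
    by_contra hcon
    push Not at hcon
    have : j ∈ M := by
      refine Finset.mem_filter.2 ⟨Finset.mem_univ _, fun k => ?_⟩
      exact ((Finset.mem_filter.1 hmin).2 k).trans hcon
    exact absurd (Finset.min'_le M j this) (not_le.2 hj)
  -- A shift along `u i` raises the `i`-th functional by `t` and any other by at most `t`, as the
  -- normals are unit vectors.
  have hshift : ∀ i, ∀ x ∈ B i, ∀ t : ℝ, 0 ≤ t → x + t • u i ∈ B i := by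
    intro i x hx t ht j
    have hcs : u j ⬝ᵥ u i ≤ 1 := by
      have h0 : 0 ≤ (u j - u i) ⬝ᵥ (u j - u i) :=
        Finset.sum_nonneg fun k _ => mul_self_nonneg _
      simp only [sub_dotProduct, dotProduct_sub, hu, dotProduct_comm (u i) (u j)] at h0
      linarith
    have h1 := mul_le_mul_of_nonneg_left hcs ht
    simp only [dotProduct_add, dotProduct_smul, smul_eq_mul, hu]
    exact ⟨by linarith [(hx j).1], fun hji => by linarith [(hx j).2 hji]⟩
  have hsub : {x | (∃ i, y i < u i ⬝ᵥ x) ∧ ∀ i, u i ⬝ᵥ x ≤ y i + ε} ⊆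
      ⋃ i, B i ∩ {x | u i ⬝ᵥ x ∈ Set.Ioc (y i) (y i + ε)} := by
    rintro x ⟨⟨k, hk⟩, hx⟩
    obtain ⟨i, hi⟩ := hcover x
    refine Set.mem_iUnion.2 ⟨i, hi, ?_, hx i⟩
    linarith [(hi k).1]
  have hm0 : (0 : ℝ) < m := by exact_mod_cast hm
  calc γ _ ≤ γ (⋃ i, B i ∩ {x | u i ⬝ᵥ x ∈ Set.Ioc (y i) (y i + ε)}) := measure_mono hsub
    _ ≤ ∑ i, γ (B i ∩ {x | u i ⬝ᵥ x ∈ Set.Ioc (y i) (y i + ε)}) := measure_iUnion_fintype_le _ _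
    _ ≤ ∑ i, ENNReal.ofReal ε *
        (ENNReal.ofReal (Real.exp (3 / 2) * (Real.sqrt (2 * Real.log m) + 1)) * γ (B i)
          + ENNReal.ofReal (1 / m)) := Finset.sum_le_sum fun i _ =>
        pi_gaussianReal_inter_slab_le (u i) (hu i) (hBm i) (hshift i) hm (y i) hε1
    _ = ENNReal.ofReal ε *
        (ENNReal.ofReal (Real.exp (3 / 2) * (Real.sqrt (2 * Real.log m) + 1)) * ∑ i, γ (B i)
          + ∑ _i : Fin m, ENNReal.ofReal (1 / m)) := by
        rw [← Finset.mul_sum, Finset.sum_add_distrib, ← Finset.mul_sum]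
    _ ≤ _ := by
        gcongr
        · calc _ ≤ ENNReal.ofReal (Real.exp (3 / 2) * (Real.sqrt (2 * Real.log m) + 1)) * 1 := by
                gcongr
                have := measure_iUnion (μ := γ) hBd hBm
                rw [tsum_fintype] at this
                rw [← this]
                exact prob_le_one
            _ = _ := mul_one _
        · rw [Finset.sum_const, Finset.card_univ, Fintype.card_fin, nsmul_eq_mul,
            ← ENNReal.ofReal_natCast, ← ENNReal.ofReal_mul hm0.le, mul_one_div_cancel hm0.ne']
          simp

/-- The order `√(log m)` in Nazarov's inequality, with an explicit constant. -/
lemma nazarov_const_le {m : ℕ} (hm : 1 ≤ m) :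
    Real.exp (3 / 2) * (Real.sqrt (2 * Real.log m) + 1) + 1
      ≤ 20 * Real.sqrt (Real.log ((m : ℝ) + 1)) := by
  have hm1 : (1 : ℝ) ≤ m := by exact_mod_cast hm
  set L := Real.sqrt (Real.log ((m : ℝ) + 1)) with hL
  -- Using `log (m + 1)` keeps `L` away from zero even for `m = 1`, so additive constants are
  -- absorbed into a multiple of `L`.
  have hL1 : 0.8 ≤ L := by
    apply Real.le_sqrt_of_sq_le
    calc (0.8 : ℝ) ^ 2 ≤ Real.log 2 := by linarith [Real.log_two_gt_d9]
      _ ≤ _ := Real.log_le_log (by norm_num) (by linarith)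
  have h1 : Real.sqrt (2 * Real.log m) ≤ 1.5 * L := by
    rw [Real.sqrt_mul (by norm_num)]
    refine mul_le_mul ?_ (Real.sqrt_le_sqrt (Real.log_le_log (by linarith) (by linarith)))
      (Real.sqrt_nonneg _) (by norm_num)
    rw [Real.sqrt_le_left (by norm_num)]
    norm_num
  have h2 : Real.exp (3 / 2) ≤ 4.6 := by
    have h3 : Real.exp (3 / 2) ^ 2 = Real.exp 1 ^ 3 := by
      rw [← Real.exp_nat_mul, ← Real.exp_nat_mul]; norm_num
    have h4 : Real.exp 1 ^ 3 ≤ 2.7182818286 ^ 3 := by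
      gcongr
      exact Real.exp_one_lt_d9.le
    refine abs_le_of_sq_le_sq' ?_ (by norm_num) |>.2
    rw [h3]
    exact h4.trans (by norm_num)
  calc _ ≤ 4.6 * (1.5 * L + 1) + 1 := by gcongr
    _ ≤ _ := by linarith

/-- **Nazarov's inequality**: if all rows of `A` have Euclidean norm at least `σ`, then enlarging
the polytope `A ζ ≤ y` by `ε` raises its Gaussian measure by a multiple of `ε √(log m) / σ`. -/
lemma pi_gaussianReal_polytope_le {ι : Type*} [Fintype ι] {m : ℕ} (hm : 1 ≤ m)
    (A : Matrix (Fin m) ι ℝ) {σ : ℝ} (hσ : 0 < σ) (hA : ∀ i, σ ^ 2 ≤ A i ⬝ᵥ A i)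
    (y : Fin m → ℝ) {ε : ℝ} (hε : 0 ≤ ε) :
    (Measure.pi fun _ : ι => gaussianReal 0 1).real {x | ∀ i, (A *ᵥ x) i ≤ y i + ε} ≤
      (Measure.pi fun _ : ι => gaussianReal 0 1).real {x | ∀ i, (A *ᵥ x) i ≤ y i} +
        20 * Real.sqrt (Real.log ((m : ℝ) + 1)) * (ε / σ) := by
  set γ := Measure.pi fun _ : ι => gaussianReal 0 1
  have hlog : 1 ≤ 20 * Real.sqrt (Real.log ((m : ℝ) + 1)) := by
    refine le_trans ?_ (nazarov_const_le hm)
    have : 0 ≤ Real.exp (3 / 2) * (Real.sqrt (2 * Real.log m) + 1) := by positivity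
    linarith
  -- For wide strips the right-hand side already exceeds one.
  by_cases hεσ : ε / σ ≤ 1
  swap
  · push Not at hεσ
    calc _ ≤ (1 : ℝ) := measureReal_le_one
      _ ≤ 20 * Real.sqrt (Real.log ((m : ℝ) + 1)) * (ε / σ) := by nlinarith
      _ ≤ _ := le_add_of_nonneg_left measureReal_nonneg
  have hn : ∀ i, 0 < A i ⬝ᵥ A i := fun i => (by positivity : 0 < σ ^ 2).trans_le (hA i)
  let q : Fin m → ℝ := fun i => Real.sqrt (A i ⬝ᵥ A i)
  have hq : ∀ i, 0 < q i := fun i => Real.sqrt_pos.2 (hn i)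
  have hqσ : ∀ i, σ ≤ q i := fun i => Real.le_sqrt_of_sq_le (hA i)
  have hqq : ∀ i, q i * q i = A i ⬝ᵥ A i := fun i => Real.mul_self_sqrt (hn i).le
  let u : Fin m → ι → ℝ := fun i => (q i)⁻¹ • A i
  have hu : ∀ i, u i ⬝ᵥ u i = 1 := fun i => by
    simp only [u, smul_dotProduct, dotProduct_smul, smul_eq_mul, ← hqq]
    have := (hq i).ne'
    field_simp
  have hux : ∀ i x, u i ⬝ᵥ x = (A *ᵥ x) i / q i := fun i x => by
    simp only [u, smul_dotProduct, smul_eq_mul, Matrix.mulVec]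
    rw [div_eq_inv_mul]
  have hsub : {x : ι → ℝ | ∀ i, (A *ᵥ x) i ≤ y i + ε} ⊆ {x | ∀ i, (A *ᵥ x) i ≤ y i} ∪
      {x | (∃ i, y i / q i < u i ⬝ᵥ x) ∧ ∀ i, u i ⬝ᵥ x ≤ y i / q i + ε / σ} := by
    intro x hx
    by_cases h : ∀ i, (A *ᵥ x) i ≤ y i
    · exact Or.inl h
    · push Not at h
      obtain ⟨i, hi⟩ := h
      refine Or.inr ⟨⟨i, ?_⟩, fun j => ?_⟩
      · rw [hux]; exact div_lt_div_of_pos_right hi (hq i)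
      · rw [hux]
        calc (A *ᵥ x) j / q j ≤ (y j + ε) / q j := div_le_div_of_nonneg_right (hx j) (hq j).le
          _ = y j / q j + ε / q j := add_div _ _ _
          _ ≤ _ := by gcongr; exact hqσ j
  have hstrip := pi_gaussianReal_strip_le hm u hu (fun i => y i / q i) hεσ
  have hC : 0 ≤ Real.exp (3 / 2) * (Real.sqrt (2 * Real.log m) + 1) := by positivity
  rw [← ENNReal.ofReal_one, ← ENNReal.ofReal_add hC zero_le_one,
    ← ENNReal.ofReal_mul (by positivity)] at hstrip
  calc _ ≤ γ.real ({x | ∀ i, (A *ᵥ x) i ≤ y i} ∪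
      {x | (∃ i, y i / q i < u i ⬝ᵥ x) ∧ ∀ i, u i ⬝ᵥ x ≤ y i / q i + ε / σ}) :=
        measureReal_mono hsub
    _ ≤ _ := measureReal_union_le _ _
    _ ≤ γ.real {x | ∀ i, (A *ᵥ x) i ≤ y i} + ε / σ *
        (Real.exp (3 / 2) * (Real.sqrt (2 * Real.log m) + 1) + 1) := by
        refine add_le_add_right ?_ _
        exact ENNReal.toReal_le_of_le_ofReal (by positivity) hstrip
    _ ≤ _ := by
        refine add_le_add_right ?_ _
        rw [mul_comm (20 * _)]
        exact mul_le_mul_of_nonneg_left (nazarov_const_le hm) (by positivity)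

/-! ### Measurability of random matrices and anti-concentration of mixed normal vectors. -/

open scoped Matrix.Norms.L2Operator in
lemma continuousOn_matrix_sqrt (ι : Type*) [Fintype ι] [DecidableEq ι] :
    ContinuousOn (CFC.sqrt : Matrix ι ι ℝ → Matrix ι ι ℝ) {A | 0 ≤ A} :=
  CFC.continuousOn_sqrt

/-- The square root is continuous only on the positive semidefinite cone. All values of `C` lie
there, so composing through the subtype of the cone gives measurability. -/
lemma MeasurableEntries.sqrt {Ω ι : Type*} [MeasurableSpace Ω] [Fintype ι] [DecidableEq ι]
    {C : Ω → Matrix ι ι ℝ} (hC : MeasurableEntries C) (hpos : ∀ ω, (C ω).PosSemidef) :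
    MeasurableEntries fun ω => CFC.sqrt (C ω) := by
  intro i j
  let S : Set (ι → ι → ℝ) := {a | 0 ≤ (Matrix.of a : Matrix ι ι ℝ)}
  let g : S → ℝ := fun a => CFC.sqrt (Matrix.of a.1 : Matrix ι ι ℝ) i j
  have hg : Continuous g := by
    have h1 : ContinuousOn (fun a : ι → ι → ℝ => CFC.sqrt (Matrix.of a : Matrix ι ι ℝ)) S :=
      (continuousOn_matrix_sqrt ι).comp (t := {A | 0 ≤ A}) continuousOn_id fun a ha => ha
    have h2 := continuousOn_iff_continuous_domRestrict.1 h1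
    exact (continuous_apply_apply i j).comp h2
  have hCm : Measurable fun ω => (⟨fun i j => C ω i j, (hpos ω).nonneg⟩ : S) := by
    refine Measurable.subtype_mk ?_
    exact measurable_pi_lambda _ fun i => measurable_pi_lambda _ fun j => hC i j
  exact hg.measurable.comp hCm

lemma MeasurableEntries.mul {Ω l k p : Type*} [MeasurableSpace Ω] [Fintype k]
    {A : Ω → Matrix l k ℝ} {B : Ω → Matrix k p ℝ} (hA : MeasurableEntries A)
    (hB : MeasurableEntries B) : MeasurableEntries fun ω => A ω * B ω := by
  intro i j
  simp only [Matrix.mul_apply]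
  exact Finset.measurable_sum _ fun k _ => (hA i k).mul (hB k j)

lemma MeasurableEntries.det {Ω k : Type*} [MeasurableSpace Ω] [Fintype k] [DecidableEq k]
    {A : Ω → Matrix k k ℝ} (hA : MeasurableEntries A) : Measurable fun ω => (A ω).det := by
  simp only [Matrix.det_apply]
  refine Finset.measurable_sum _ fun σ _ => ?_
  exact (Finset.measurable_prod _ fun i _ => hA _ _).const_smul _

/-- The entries are the reciprocal determinant times determinants of row-replaced matrices. At
singular matrices the convention `0⁻¹ = 0` is harmless, so invertibility is not needed. -/
lemma MeasurableEntries.inv {Ω k : Type*} [MeasurableSpace Ω] [Fintype k] [DecidableEq k]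
    {A : Ω → Matrix k k ℝ} (hA : MeasurableEntries A) : MeasurableEntries fun ω => (A ω)⁻¹ := by
  intro i j
  simp only [Matrix.inv_def, Matrix.smul_apply, Ring.inverse_eq_inv', smul_eq_mul,
    Matrix.adjugate_apply]
  refine (hA.det.inv).mul (MeasurableEntries.det fun a b => ?_)
  by_cases h : a = j
  · subst h; simp only [Matrix.updateRow_self]; exact measurable_const
  · simp only [Matrix.updateRow_ne h]; exact hA a b

lemma FactorModel.measurableEntries_tildeJ {Ω : Type*} [MeasurableSpace Ω] {P : Measure Ω}
    {d r m : ℕ} (M : FactorModel P d r) {J : Ω → Matrix (Fin m) (Fin d × Fin d) ℝ}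
    (hJ : MeasurableEntries J) : MeasurableEntries (M.tildeJ J) := by
  intro i j
  refine ((hJ.mul (B := fun ω => M.ΘZ ω ⊗ₖ M.ΘZ ω) fun a b => ?_) i j).neg
  simp only [Matrix.kroneckerMap_apply]
  exact (M.measurable_SZ.inv _ _).mul (M.measurable_SZ.inv _ _)

/-- Identifies the squared row norms in Nazarov's inequality with the limiting variances, for which
a lower bound is available. -/
lemma sqrt_row_dotProduct {ι : Type*} [Fintype ι] [DecidableEq ι] {m : ℕ}
    (H : Matrix (Fin m) ι ℝ) {C : Matrix ι ι ℝ} (hC : C.PosSemidef) (i : Fin m) :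
    (H * CFC.sqrt C) i ⬝ᵥ (H * CFC.sqrt C) i = (H * C * Hᵀ) i i := by
  have h1 : (CFC.sqrt C)ᵀ = CFC.sqrt C := by
    have := (Matrix.nonneg_iff_posSemidef.1 (CFC.sqrt_nonneg C)).isHermitian
    rwa [Matrix.IsHermitian, Matrix.conjTranspose_eq_transpose_of_trivial] at this
  have h2 : H * C * Hᵀ = (H * CFC.sqrt C) * (H * CFC.sqrt C)ᵀ := by
    rw [Matrix.transpose_mul, h1, ← Matrix.mul_assoc, Matrix.mul_assoc H (CFC.sqrt C),
      CFC.sqrt_mul_sqrt_self C hC.nonneg]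
  rw [h2]
  rfl

/-- Anti-concentration of a mixed normal vector. -/
lemma mixedNormalCDF_add_le {Ω : Type*} [MeasurableSpace Ω] {m d : ℕ} (P : Measure Ω)
    [IsProbabilityMeasure P] (hm : 1 ≤ m) {H : Ω → Matrix (Fin m) (Fin d × Fin d) ℝ}
    {C : Ω → Matrix (Fin d × Fin d) (Fin d × Fin d) ℝ} (hH : MeasurableEntries H)
    (hC : MeasurableEntries C) (hpos : ∀ ω, (C ω).PosSemidef) {b : ℝ} (hb : 0 < b)
    (y : Fin m → ℝ) {ε : ℝ} (hε : 0 ≤ ε) :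
    mixedNormalCDF P H C (fun i => y i + ε) ≤ mixedNormalCDF P H C y +
      20 * Real.sqrt (Real.log ((m : ℝ) + 1)) * (ε / Real.sqrt b) +
      P.real {ω | (⨅ i, (H ω * C ω * (H ω)ᵀ) i i) < b} := by
  set γ := Measure.pi fun _ : Fin d × Fin d => gaussianReal 0 1 with hγ
  have : Nonempty (Fin m) := ⟨⟨0, hm⟩⟩
  set Bad := {ω | (⨅ i, (H ω * C ω * (H ω)ᵀ) i i) < b} with hBad
  set K := 20 * Real.sqrt (Real.log ((m : ℝ) + 1)) * (ε / Real.sqrt b) with hK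
  have hK0 : 0 ≤ K := by positivity
  have hmeas : ∀ z : Fin m → ℝ, MeasurableSet {p : Ω × (Fin d × Fin d → ℝ) |
      ∀ i, ((H p.1 * CFC.sqrt (C p.1)) *ᵥ p.2) i ≤ z i} := by
    intro z
    rw [Set.ofPred_forall]
    refine MeasurableSet.iInter fun i => measurableSet_le ?_ measurable_const
    simp only [Matrix.mulVec, dotProduct]
    refine Finset.measurable_sum _ fun k _ => Measurable.mul ?_ ?_
    · exact ((hH.mul (hC.sqrt hpos)) i k).comp measurable_fst
    · exact (measurable_pi_apply k).comp measurable_snd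
  have hBm : MeasurableSet Bad := by
    refine measurableSet_lt (Measurable.iInf fun i => ?_) measurable_const
    exact ((hH.mul hC).mul (B := fun ω => (H ω)ᵀ) fun a c => hH c a) i i
  -- By Fubini the mixed normal probability averages Gaussian polytope measures over `ω`. Nazarov's
  -- inequality is used where the variances are at least `b`; elsewhere the integrand is bounded by
  -- one.
  have hval : ∀ z : Fin m → ℝ, mixedNormalCDF P H C z =
      ∫ ω, γ.real {x | ∀ i, ((H ω * CFC.sqrt (C ω)) *ᵥ x) i ≤ z i} ∂P := by
    intro z
    unfold mixedNormalCDF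
    rw [measureReal_def, Measure.prod_apply (hmeas z), ← integral_toReal
      (measurable_measure_prodMk_left (hmeas z)).aemeasurable
      (ae_of_all _ fun _ => measure_lt_top _ _)]
    rfl
  have hmf : ∀ z : Fin m → ℝ, Measurable fun ω =>
      γ.real {x | ∀ i, ((H ω * CFC.sqrt (C ω)) *ᵥ x) i ≤ z i} := fun z =>
    (measurable_measure_prodMk_left (hmeas z)).ennreal_toReal
  have hint : ∀ z : Fin m → ℝ, Integrable (fun ω =>
      γ.real {x | ∀ i, ((H ω * CFC.sqrt (C ω)) *ᵥ x) i ≤ z i}) P := fun z =>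
    Integrable.of_bound (C := 1) (hmf z).aestronglyMeasurable <| ae_of_all _ fun ω => by
      rw [Real.norm_of_nonneg measureReal_nonneg]; exact measureReal_le_one
  rw [hval, hval]
  have hintB : Integrable (Bad.indicator fun _ => (1 : ℝ)) P :=
    (integrable_const 1).indicator hBm
  calc _ ≤ ∫ ω, (γ.real {x | ∀ i, ((H ω * CFC.sqrt (C ω)) *ᵥ x) i ≤ y i} + K
        + Bad.indicator (fun _ => (1 : ℝ)) ω) ∂P := by
        refine integral_mono (hint _) (((hint y).add (integrable_const K)).add hintB) fun ω => ?_
        simp only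
        by_cases hω : ω ∈ Bad
        · rw [Set.indicator_of_mem hω]
          have h1 : γ.real {x | ∀ i, ((H ω * CFC.sqrt (C ω)) *ᵥ x) i ≤ y i + ε} ≤ 1 :=
            measureReal_le_one
          have h2 : 0 ≤ γ.real {x | ∀ i, ((H ω * CFC.sqrt (C ω)) *ᵥ x) i ≤ y i} :=
            measureReal_nonneg
          linarith
        · rw [Set.indicator_of_notMem hω, add_zero]
          refine pi_gaussianReal_polytope_le hm _ (Real.sqrt_pos.2 hb) (fun i => ?_) y hε
          rw [sqrt_row_dotProduct _ (hpos ω), Real.sq_sqrt hb.le]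
          have hω' : b ≤ ⨅ i, (H ω * C ω * (H ω)ᵀ) i i := by
            simpa [hBad] using hω
          exact hω'.trans (ciInf_le (Set.finite_range _).bddBelow i)
    _ = _ := by
        have h1 := integral_add ((hint y).add (integrable_const K)) hintB
        simp only [Pi.add_apply] at h1
        rw [h1, integral_add (hint y) (integrable_const K), integral_indicator_const _ hBm]
        simp

/-! ### Stability of mixed normal approximations under small perturbations. -/

lemma vecCDF_le_add {Ω : Type*} [MeasurableSpace Ω] {m : ℕ} (P : Measure Ω)
    [IsProbabilityMeasure P] {V W : Ω → Fin m → ℝ} {y : Fin m → ℝ} {e : ℝ} :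
    vecCDF P W y ≤ vecCDF P V (fun i => y i + e) + P.real {ω | ¬ ∀ i, |W ω i - V ω i| ≤ e} := by
  refine le_trans (measureReal_mono ?_) (measureReal_union_le _ _)
  intro ω hω
  by_cases h : ∀ i, |W ω i - V ω i| ≤ e
  · exact Or.inl fun i => by linarith [hω i, (abs_le.1 (h i)).1]
  · exact Or.inr h

lemma vecCDF_mem_Icc {Ω : Type*} [MeasurableSpace Ω] {m : ℕ} (P : Measure Ω)
    [IsProbabilityMeasure P] (V : Ω → Fin m → ℝ) (y : Fin m → ℝ) :
    vecCDF P V y ∈ Set.Icc (0 : ℝ) 1 :=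
  ⟨measureReal_nonneg, measureReal_le_one⟩

lemma mixedNormalCDF_mem_Icc {Ω : Type*} [MeasurableSpace Ω] {m d : ℕ} (P : Measure Ω)
    [IsProbabilityMeasure P] (H : Ω → Matrix (Fin m) (Fin d × Fin d) ℝ)
    (C : Ω → Matrix (Fin d × Fin d) (Fin d × Fin d) ℝ) (y : Fin m → ℝ) :
    mixedNormalCDF P H C y ∈ Set.Icc (0 : ℝ) 1 :=
  ⟨measureReal_nonneg, measureReal_le_one⟩

/-- A high-dimensional mixed normal approximation is not affected by a perturbation of order
`o_p(1 / √(log m))`, provided that the limiting variances do not degenerate. -/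
theorem tendsto_iSup_vecCDF_sub_mixedNormalCDF_of_close
    {Ω : ℕ → Type*} [∀ n, MeasurableSpace (Ω n)]
    (P : ∀ n, Measure (Ω n)) [∀ n, IsProbabilityMeasure (P n)]
    {d m : ℕ → ℕ} (hm : ∀ n, 1 ≤ m n)
    {V W : ∀ n, Ω n → Fin (m n) → ℝ}
    {H : ∀ n, Ω n → Matrix (Fin (m n)) (Fin (d n) × Fin (d n)) ℝ}
    {C : ∀ n, Ω n → Matrix (Fin (d n) × Fin (d n)) (Fin (d n) × Fin (d n)) ℝ}
    (hH : ∀ n, MeasurableEntries (H n)) (hC : ∀ n, MeasurableEntries (C n))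
    (hpos : ∀ n ω, (C n ω).PosSemidef)
    (hV : Tendsto (fun n => ⨆ y : Fin (m n) → ℝ,
      |vecCDF (P n) (V n) y - mixedNormalCDF (P n) (H n) (C n) y|) atTop (𝓝 0))
    (hdiag : Tendsto (fun b : ℝ => limsup (fun n => (P n).real
        {ω | (⨅ i, (H n ω * C n ω * (H n ω)ᵀ) i i) < b}) atTop) (𝓝[>] 0) (𝓝 0))
    (hclose : ∀ η : ℝ, 0 < η → Tendsto (fun n => (P n).real
      {ω | ¬ ∀ i, |W n ω i - V n ω i| * Real.sqrt (Real.log ((m n : ℝ) + 1)) ≤ η})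
      atTop (𝓝 0)) :
    Tendsto (fun n => ⨆ y : Fin (m n) → ℝ,
      |vecCDF (P n) (W n) y - mixedNormalCDF (P n) (H n) (C n) y|) atTop (𝓝 0) := by
  rw [Metric.tendsto_atTop']
  intro ε hε
  -- The total cost will be `4 * τ`: one `τ` each for the approximation of `V`, for the event where
  -- `W` and `V` are far apart, for Nazarov's bound and for degenerate variances.
  set τ := ε / 5 with hτdef
  have hτ : 0 < τ := by positivity
  obtain ⟨b, hbτ, hb⟩ : ∃ b : ℝ, limsup (fun n => (P n).real
      {ω | (⨅ i, (H n ω * C n ω * (H n ω)ᵀ) i i) < b}) atTop < τ ∧ 0 < b :=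
    ((hdiag.eventually_lt_const hτ).and self_mem_nhdsWithin).exists
  have hb0 : 0 < Real.sqrt b := Real.sqrt_pos.2 hb
  have e1 : ∀ᶠ n in atTop, (P n).real
      {ω | (⨅ i, (H n ω * C n ω * (H n ω)ᵀ) i i) < b} < τ :=
    eventually_lt_of_limsup_lt hbτ
      (isBoundedUnder_of ⟨1, fun n => measureReal_le_one⟩)
  -- With this choice a shift by `η / L` costs exactly `τ` in Nazarov's bound.
  set η := τ * Real.sqrt b / 20 with hη
  have e2 := (hclose η (by positivity)).eventually_lt_const hτ
  have e3 := hV.eventually_lt_const hτ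
  have main : ∀ᶠ n in atTop, dist (⨆ y : Fin (m n) → ℝ,
      |vecCDF (P n) (W n) y - mixedNormalCDF (P n) (H n) (C n) y|) 0 < ε := by
    filter_upwards [e1, e2, e3] with n h1 h2 h3
    set L := Real.sqrt (Real.log ((m n : ℝ) + 1)) with hL
    have hm1 : (1 : ℝ) ≤ m n := by exact_mod_cast hm n
    have hL0 : 0 < L := Real.sqrt_pos.2 (Real.log_pos (by linarith))
    have hbad : (P n).real {ω | ¬ ∀ i, |W n ω i - V n ω i| ≤ η / L} < τ := by
      simpa only [le_div_iff₀ hL0] using h2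
    have hbad' : (P n).real {ω | ¬ ∀ i, |V n ω i - W n ω i| ≤ η / L} < τ := by
      simpa only [abs_sub_comm (V n _ _)] using hbad
    have hVy : ∀ y, |vecCDF (P n) (V n) y - mixedNormalCDF (P n) (H n) (C n) y| ≤ τ := by
      intro y
      refine le_trans (le_ciSup (f := fun y : Fin (m n) → ℝ =>
        |vecCDF (P n) (V n) y - mixedNormalCDF (P n) (H n) (C n) y|) ⟨1, ?_⟩ y) h3.le
      rintro _ ⟨z, rfl⟩
      have a1 := vecCDF_mem_Icc (P n) (V n) z
      have a2 := mixedNormalCDF_mem_Icc (P n) (H n) (C n) z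
      exact abs_sub_le_of_nonneg_of_le a1.1 a1.2 a2.1 a2.2
    have hanti : ∀ y : Fin (m n) → ℝ, mixedNormalCDF (P n) (H n) (C n) (fun i => y i + η / L) ≤
        mixedNormalCDF (P n) (H n) (C n) y + 2 * τ := by
      intro y
      refine (mixedNormalCDF_add_le (P n) (hm n) (hH n) (hC n) (hpos n) hb y
        (ε := η / L) (by positivity)).trans ?_
      have : 20 * L * (η / L / Real.sqrt b) = τ := by
        rw [hη]; field_simp
      rw [← hL, this]
      linarith
    have hWy : ∀ y, |vecCDF (P n) (W n) y - mixedNormalCDF (P n) (H n) (C n) y| ≤ 4 * τ := by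
      intro y
      rw [abs_le]
      constructor
      · have a1 := vecCDF_le_add (P n) (V := W n) (W := V n) (y := fun i => y i - η / L)
          (e := η / L)
        have a2 := hanti fun i => y i - η / L
        simp only [sub_add_cancel] at a1 a2
        have a3 := (abs_le.1 (hVy fun i => y i - η / L)).1
        linarith
      · have a1 := vecCDF_le_add (P n) (V := V n) (W := W n) (y := y) (e := η / L)
        have a2 := hanti y
        have a3 := (abs_le.1 (hVy fun i => y i + η / L)).2
        linarith
    rw [Real.dist_0_eq_abs, abs_of_nonneg (Real.iSup_nonneg fun y => abs_nonneg _)]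
    refine lt_of_le_of_lt (ciSup_le hWy) ?_
    linarith
  obtain ⟨N, hN⟩ := eventually_atTop.1 main
  exact ⟨N, fun n hn => hN n hn.le⟩

/-! ### Spectral bounds phrased as quadratic form inequalities, and the Frobenius norm. -/

section QuadraticForms

variable {ι κ : Type*} [Fintype ι] [Fintype κ]

lemma dotProduct_self_nonneg' (v : ι → ℝ) : 0 ≤ v ⬝ᵥ v :=
  Finset.sum_nonneg fun _ _ => mul_self_nonneg _

lemma dotProduct_self_pos' {v : ι → ℝ} (hv : v ≠ 0) : 0 < v ⬝ᵥ v := by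
  rcases (dotProduct_self_nonneg' v).lt_or_eq with h | h
  · exact h
  · exact absurd (dotProduct_self_eq_zero.1 h.symm) hv

lemma dotProduct_sq_le (x y : ι → ℝ) : (x ⬝ᵥ y) ^ 2 ≤ (x ⬝ᵥ x) * (y ⬝ᵥ y) := by
  have := Finset.sum_mul_sq_le_sq_mul_sq Finset.univ x y
  simpa [dotProduct, sq] using this

lemma abs_dotProduct_le_of_sq {x y : ι → ℝ} {a b : ℝ} (ha : 0 ≤ a) (hb : 0 ≤ b)
    (hx : x ⬝ᵥ x ≤ a ^ 2) (hy : y ⬝ᵥ y ≤ b ^ 2) : |x ⬝ᵥ y| ≤ a * b := by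
  apply abs_le_of_sq_le_sq _ (mul_nonneg ha hb)
  calc (x ⬝ᵥ y) ^ 2 ≤ (x ⬝ᵥ x) * (y ⬝ᵥ y) := dotProduct_sq_le x y
    _ ≤ a ^ 2 * b ^ 2 := mul_le_mul hx hy (dotProduct_self_nonneg' y) (by positivity)
    _ = _ := by ring

lemma dotProduct_mulVec_comm_of_symm {A : Matrix ι ι ℝ} (hA : Aᵀ = A) (x y : ι → ℝ) :
    x ⬝ᵥ A *ᵥ y = y ⬝ᵥ A *ᵥ x := by
  rw [Matrix.dotProduct_mulVec, dotProduct_comm, ← Matrix.mulVec_transpose, hA]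

lemma Matrix.PosDef.transpose_eq {A : Matrix ι ι ℝ} (hA : A.PosDef) : Aᵀ = A := by
  have := hA.isHermitian
  rwa [Matrix.IsHermitian, Matrix.conjTranspose_eq_transpose_of_trivial] at this

lemma Matrix.PosSemidef.transpose_eq {A : Matrix ι ι ℝ} (hA : A.PosSemidef) : Aᵀ = A := by
  have := hA.isHermitian
  rwa [Matrix.IsHermitian, Matrix.conjTranspose_eq_transpose_of_trivial] at this

lemma posDef_of_dotProduct_mulVec {A : Matrix ι ι ℝ} (hA : Aᵀ = A)
    (h : ∀ v : ι → ℝ, v ≠ 0 → 0 < v ⬝ᵥ A *ᵥ v) : A.PosDef := by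
  refine Matrix.PosDef.of_dotProduct_mulVec_pos ?_ fun v hv => by simpa using h v hv
  rwa [Matrix.IsHermitian, Matrix.conjTranspose_eq_transpose_of_trivial]

lemma Matrix.PosDef.qf_pos {A : Matrix ι ι ℝ} (hA : A.PosDef) {v : ι → ℝ} (hv : v ≠ 0) :
    0 < v ⬝ᵥ A *ᵥ v := by
  simpa using hA.dotProduct_mulVec_pos hv

lemma Matrix.PosSemidef.qf_nonneg {A : Matrix ι ι ℝ} (hA : A.PosSemidef) (v : ι → ℝ) :
    0 ≤ v ⬝ᵥ A *ᵥ v := by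
  simpa using hA.dotProduct_mulVec_nonneg v

lemma posDef_of_lowerBound {A : Matrix ι ι ℝ} (hA : Aᵀ = A) {c : ℝ} (hc : 0 < c)
    (h : ∀ v : ι → ℝ, c * (v ⬝ᵥ v) ≤ v ⬝ᵥ A *ᵥ v) : A.PosDef :=
  posDef_of_dotProduct_mulVec hA fun v hv =>
    (mul_pos hc (dotProduct_self_pos' hv)).trans_le (h v)

lemma qf_sub_smul {A : Matrix ι ι ℝ} (hA : Aᵀ = A) (x y : ι → ℝ) (t : ℝ) :
    (x - t • y) ⬝ᵥ A *ᵥ (x - t • y)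
      = x ⬝ᵥ A *ᵥ x - 2 * t * (y ⬝ᵥ A *ᵥ x) + t ^ 2 * (y ⬝ᵥ A *ᵥ y) := by
  simp only [Matrix.mulVec_sub, Matrix.mulVec_smul, sub_dotProduct, dotProduct_sub,
    smul_dotProduct, dotProduct_smul, smul_eq_mul, dotProduct_mulVec_comm_of_symm hA x y]
  ring

/-- For `0 ≤ A ≤ c`, `‖A v‖² ≤ c ⟨v, A v⟩`. -/
lemma mulVec_dotProduct_self_le {A : Matrix ι ι ℝ} (hA : A.PosSemidef) {c : ℝ} (hc : 0 < c)
    (h : ∀ v : ι → ℝ, v ⬝ᵥ A *ᵥ v ≤ c * (v ⬝ᵥ v)) (v : ι → ℝ) :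
    (A *ᵥ v) ⬝ᵥ (A *ᵥ v) ≤ c * (v ⬝ᵥ A *ᵥ v) := by
  -- Positivity at `v - c⁻¹ A v` expands to `⟨v, A v⟩ - 2 c⁻¹ ‖A v‖²` plus `c⁻²` times the form at
  -- `A v`, and the upper bound turns the last term into at most `c⁻¹ ‖A v‖²`.
  have h1 := hA.qf_nonneg (v - c⁻¹ • (A *ᵥ v))
  rw [qf_sub_smul hA.transpose_eq] at h1
  have h2 := h (A *ᵥ v)
  have h3 : c⁻¹ ^ 2 * ((A *ᵥ v) ⬝ᵥ A *ᵥ (A *ᵥ v)) ≤ c⁻¹ * ((A *ᵥ v) ⬝ᵥ (A *ᵥ v)) := by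
    calc _ ≤ c⁻¹ ^ 2 * (c * ((A *ᵥ v) ⬝ᵥ (A *ᵥ v))) := by gcongr
      _ = _ := by field_simp
  have h4 : c⁻¹ * ((A *ᵥ v) ⬝ᵥ (A *ᵥ v)) ≤ v ⬝ᵥ A *ᵥ v := by linarith
  rwa [inv_mul_le_iff₀ hc] at h4

lemma mulVec_dotProduct_self_le_sq {A : Matrix ι ι ℝ} (hA : A.PosSemidef) {c : ℝ} (hc : 0 < c)
    (h : ∀ v : ι → ℝ, v ⬝ᵥ A *ᵥ v ≤ c * (v ⬝ᵥ v)) (v : ι → ℝ) :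
    (A *ᵥ v) ⬝ᵥ (A *ᵥ v) ≤ c ^ 2 * (v ⬝ᵥ v) := by
  calc _ ≤ c * (v ⬝ᵥ A *ᵥ v) := mulVec_dotProduct_self_le hA hc h v
    _ ≤ c * (c * (v ⬝ᵥ v)) := by gcongr; exact h v
    _ = _ := by ring

/-- Bounds entries of products such as `D Σ Dᵀ` by Euclidean row norms, which is sharper than using
row sums. -/
lemma abs_dotProduct_mulVec_le {A : Matrix ι ι ℝ} (hA : A.PosSemidef) {c : ℝ} (hc : 0 < c)
    (h : ∀ v : ι → ℝ, v ⬝ᵥ A *ᵥ v ≤ c * (v ⬝ᵥ v)) {x y : ι → ℝ} {a b : ℝ}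
    (ha : 0 ≤ a) (hb : 0 ≤ b) (hx : x ⬝ᵥ x ≤ a ^ 2) (hy : y ⬝ᵥ y ≤ b ^ 2) :
    |x ⬝ᵥ A *ᵥ y| ≤ c * (a * b) := by
  have h1 : (A *ᵥ y) ⬝ᵥ (A *ᵥ y) ≤ (c * b) ^ 2 := by
    calc _ ≤ c ^ 2 * (y ⬝ᵥ y) := mulVec_dotProduct_self_le_sq hA hc h y
      _ ≤ c ^ 2 * b ^ 2 := by gcongr
      _ = _ := by ring
  calc _ ≤ a * (c * b) := abs_dotProduct_le_of_sq ha (by positivity) hx h1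
    _ = _ := by ring

variable [DecidableEq ι]

lemma mulVec_single_dotProduct_self {A : Matrix ι ι ℝ} (hA : Aᵀ = A) (i : ι) :
    (A *ᵥ Pi.single i 1) ⬝ᵥ (A *ᵥ Pi.single i 1) = ∑ j, A i j ^ 2 := by
  simp only [dotProduct, Matrix.mulVec_single_one, Matrix.col_apply, sq]
  refine Finset.sum_congr rfl fun j _ => ?_
  rw [← congrFun (congrFun hA i) j, Matrix.transpose_apply]

lemma single_qf (A : Matrix ι ι ℝ) (i j : ι) :
    (Pi.single i (1 : ℝ)) ⬝ᵥ A *ᵥ Pi.single j 1 = A i j := by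
  simp

lemma sum_row_sq_le {A : Matrix ι ι ℝ} (hA : A.PosSemidef) {c : ℝ} (hc : 0 < c)
    (h : ∀ v : ι → ℝ, v ⬝ᵥ A *ᵥ v ≤ c * (v ⬝ᵥ v)) (i : ι) : ∑ j, A i j ^ 2 ≤ c ^ 2 := by
  have := mulVec_dotProduct_self_le_sq hA hc h (Pi.single i 1)
  rw [mulVec_single_dotProduct_self hA.transpose_eq] at this
  simpa using this

lemma abs_entry_le {A : Matrix ι ι ℝ} (hA : A.PosSemidef) {c : ℝ} (hc : 0 < c)
    (h : ∀ v : ι → ℝ, v ⬝ᵥ A *ᵥ v ≤ c * (v ⬝ᵥ v)) (i j : ι) : |A i j| ≤ c := by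
  apply abs_le_of_sq_le_sq _ hc.le
  exact (Finset.single_le_sum (f := fun j => A i j ^ 2) (fun j _ => sq_nonneg _)
    (Finset.mem_univ j)).trans (sum_row_sq_le hA hc h i)

lemma Matrix.PosDef.mul_inv_cancel' {A : Matrix ι ι ℝ} (hA : A.PosDef) : A * A⁻¹ = 1 :=
  Matrix.mul_nonsing_inv _ ((Matrix.isUnit_iff_isUnit_det _).1 hA.isUnit)

lemma Matrix.PosDef.inv_mul_cancel' {A : Matrix ι ι ℝ} (hA : A.PosDef) : A⁻¹ * A = 1 :=
  Matrix.nonsing_inv_mul _ ((Matrix.isUnit_iff_isUnit_det _).1 hA.isUnit)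

lemma Matrix.PosDef.inv_inv' {A : Matrix ι ι ℝ} (hA : A.PosDef) : A⁻¹⁻¹ = A :=
  Matrix.nonsing_inv_nonsing_inv _ ((Matrix.isUnit_iff_isUnit_det _).1 hA.isUnit)

lemma inv_qf_le {A : Matrix ι ι ℝ} (hA : A.PosDef) {c : ℝ} (hc : 0 < c)
    (h : ∀ v : ι → ℝ, c * (v ⬝ᵥ v) ≤ v ⬝ᵥ A *ᵥ v) (v : ι → ℝ) :
    v ⬝ᵥ A⁻¹ *ᵥ v ≤ c⁻¹ * (v ⬝ᵥ v) := by
  have hAw : A *ᵥ (A⁻¹ *ᵥ v) = v := by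
    rw [Matrix.mulVec_mulVec, hA.mul_inv_cancel', Matrix.one_mulVec]
  set w := A⁻¹ *ᵥ v
  have h1 := h w
  rw [hAw, dotProduct_comm w v] at h1
  -- Expanding the square and inserting `c ‖w‖² ≤ ⟨v, w⟩` leaves `c ⟨v, w⟩ ≤ ‖v‖²`.
  have h2 : 0 ≤ (c • w - v) ⬝ᵥ (c • w - v) := dotProduct_self_nonneg' _
  simp only [sub_dotProduct, dotProduct_sub, smul_dotProduct, dotProduct_smul, smul_eq_mul,
    dotProduct_comm w v] at h2
  rw [le_inv_mul_iff₀ hc]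
  nlinarith [mul_le_mul_of_nonneg_left h1 hc.le]

lemma le_inv_qf {A : Matrix ι ι ℝ} (hA : A.PosDef) {c : ℝ} (hc : 0 < c)
    (h : ∀ v : ι → ℝ, v ⬝ᵥ A *ᵥ v ≤ c * (v ⬝ᵥ v)) (v : ι → ℝ) :
    c⁻¹ * (v ⬝ᵥ v) ≤ v ⬝ᵥ A⁻¹ *ᵥ v := by
  have hAw : A *ᵥ (A⁻¹ *ᵥ v) = v := by
    rw [Matrix.mulVec_mulVec, hA.mul_inv_cancel', Matrix.one_mulVec]
  have h1 := mulVec_dotProduct_self_le hA.posSemidef hc h (A⁻¹ *ᵥ v)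
  rw [hAw, dotProduct_comm (A⁻¹ *ᵥ v)] at h1
  rwa [inv_mul_le_iff₀ hc]

/-- The squared Frobenius norm. -/
def frobSq (A : Matrix ι κ ℝ) : ℝ := ∑ i, ∑ j, A i j ^ 2

omit [DecidableEq ι] in
lemma frobSq_nonneg (A : Matrix ι κ ℝ) : 0 ≤ frobSq A :=
  Finset.sum_nonneg fun _ _ => Finset.sum_nonneg fun _ _ => sq_nonneg _

omit [DecidableEq ι] in
lemma frobSq_transpose (A : Matrix ι κ ℝ) : frobSq Aᵀ = frobSq A := Finset.sum_comm

omit [DecidableEq ι] in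
lemma row_sq_le_frobSq (A : Matrix ι κ ℝ) (i : ι) : ∑ j, A i j ^ 2 ≤ frobSq A :=
  Finset.single_le_sum (f := fun i => ∑ j, A i j ^ 2)
    (fun _ _ => Finset.sum_nonneg fun _ _ => sq_nonneg _) (Finset.mem_univ i)

omit [DecidableEq ι] in
lemma sq_entry_le_frobSq (A : Matrix ι κ ℝ) (i : ι) (j : κ) : A i j ^ 2 ≤ frobSq A :=
  (Finset.single_le_sum (f := fun j => A i j ^ 2) (fun _ _ => sq_nonneg _)
    (Finset.mem_univ j)).trans (row_sq_le_frobSq A i)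

omit [DecidableEq ι] in
lemma frobSq_pos {A : Matrix ι κ ℝ} (hA : A ≠ 0) : 0 < frobSq A := by
  by_contra h
  apply hA
  ext i j
  have := sq_entry_le_frobSq A i j
  have h2 : A i j ^ 2 = 0 := le_antisymm (by linarith) (sq_nonneg _)
  simpa using h2

omit [DecidableEq ι] in
lemma mulVec_dotProduct_self_le_frobSq (A : Matrix ι κ ℝ) (v : κ → ℝ) :
    (A *ᵥ v) ⬝ᵥ (A *ᵥ v) ≤ frobSq A * (v ⬝ᵥ v) := by
  calc (A *ᵥ v) ⬝ᵥ (A *ᵥ v) = ∑ i, (A i ⬝ᵥ v) ^ 2 := by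
        simp [dotProduct, Matrix.mulVec, sq]
    _ ≤ ∑ i, (A i ⬝ᵥ A i) * (v ⬝ᵥ v) := Finset.sum_le_sum fun i _ => dotProduct_sq_le _ _
    _ = _ := by rw [← Finset.sum_mul]; simp [frobSq, dotProduct, sq]

omit [DecidableEq ι] in
lemma abs_qf_le_of_frobSq {A : Matrix ι ι ℝ} {ρ : ℝ} (hρ : 0 ≤ ρ) (hA : frobSq A ≤ ρ ^ 2)
    (v : ι → ℝ) : |v ⬝ᵥ A *ᵥ v| ≤ ρ * (v ⬝ᵥ v) := by
  have hv := dotProduct_self_nonneg' v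
  apply abs_le_of_sq_le_sq _ (by positivity)
  calc _ ≤ (v ⬝ᵥ v) * ((A *ᵥ v) ⬝ᵥ (A *ᵥ v)) := dotProduct_sq_le _ _
    _ ≤ (v ⬝ᵥ v) * (frobSq A * (v ⬝ᵥ v)) := by
        gcongr; exact mulVec_dotProduct_self_le_frobSq A v
    _ ≤ (v ⬝ᵥ v) * (ρ ^ 2 * (v ⬝ᵥ v)) := by gcongr
    _ = _ := by ring

end QuadraticForms

/-! ### Quantitative concavity of `log det`. -/

section LogDet

variable {ι : Type*} [Fintype ι] [DecidableEq ι]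

/-- From `log x = 2 log √x ≤ 2 (√x - 1)` the right-hand side is at least `(√x - 1)²`. The constant
`6` dominates `(1 + √x)²` for `x ≤ 2`. -/
lemma sq_le_sub_one_sub_log {x : ℝ} (hx : 0 < x) (hx2 : x ≤ 2) :
    (x - 1) ^ 2 / 6 ≤ x - 1 - Real.log x := by
  have hs0 : 0 < Real.sqrt x := Real.sqrt_pos.2 hx
  have hs : Real.sqrt x ^ 2 = x := Real.sq_sqrt hx.le
  have h2 := Real.log_le_sub_one_of_pos hs0
  rw [Real.log_sqrt hx.le] at h2
  have h3 : (1 - Real.sqrt x) ^ 2 ≤ x - 1 - Real.log x := by nlinarith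
  refine le_trans ?_ h3
  have : (x - 1) ^ 2 / 6 = (1 - Real.sqrt x) ^ 2 * ((1 + Real.sqrt x) ^ 2 / 6) := by
    rw [show x - 1 = (Real.sqrt x - 1) * (Real.sqrt x + 1) by nlinarith]
    ring
  rw [this]
  apply mul_le_of_le_one_right (sq_nonneg _)
  nlinarith [sq_nonneg (Real.sqrt x - 3 / 2)]

lemma trace_mul_self_eq_sum_eigenvalues {A : Matrix ι ι ℝ} (hA : A.IsHermitian) :
    (A * A).trace = ∑ i, hA.eigenvalues i ^ 2 := by
  have h := hA.spectral_theorem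
  rw [Unitary.conjStarAlgAut_apply] at h
  set U := hA.eigenvectorUnitary
  have hU : (star (U : Matrix ι ι ℝ)) * (U : Matrix ι ι ℝ) = 1 := Unitary.coe_star_mul_self U
  set D : Matrix ι ι ℝ := Matrix.diagonal (RCLike.ofReal ∘ hA.eigenvalues) with hD
  have h2 : A * A = U * (D * D) * star (U : Matrix ι ι ℝ) := by
    conv_lhs => rw [h]
    calc _ = (U : Matrix ι ι ℝ) * D * (star (U : Matrix ι ι ℝ) * U) * D * star (U : Matrix ι ι ℝ) := by
          simp only [Matrix.mul_assoc]
      _ = _ := by rw [hU]; simp only [Matrix.mul_assoc, Matrix.mul_one]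
  rw [h2, Matrix.trace_mul_comm, ← Matrix.mul_assoc, hU, Matrix.one_mul, hD,
    Matrix.diagonal_mul_diagonal, Matrix.trace_diagonal]
  simp [sq]

lemma frobSq_eq_trace {A : Matrix ι ι ℝ} (hA : Aᵀ = A) : frobSq A = (A * A).trace := by
  simp only [frobSq, Matrix.trace, Matrix.diag, Matrix.mul_apply, sq]
  refine Finset.sum_congr rfl fun i _ => Finset.sum_congr rfl fun j _ => ?_
  rw [← Matrix.transpose_apply A i j, hA]

/-- Eigenvalue expansion of the Bregman divergence of `-log det` at the identity. -/
lemma exists_eigenvalues_one_add {N : Matrix ι ι ℝ} (hN : (1 + N).PosDef) :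
    ∃ e : ι → ℝ, (∀ i, 0 < e i) ∧ N.trace = ∑ i, (e i - 1) ∧
      Real.log (1 + N).det = ∑ i, Real.log (e i) ∧ frobSq N = ∑ i, (e i - 1) ^ 2 ∧
      ((∀ v : ι → ℝ, v ⬝ᵥ N *ᵥ v ≤ v ⬝ᵥ v) → ∀ i, e i ≤ 2) := by
  have hH := hN.isHermitian
  have hNs : Nᵀ = N := by
    have := hN.transpose_eq
    rw [Matrix.transpose_add, Matrix.transpose_one] at this
    exact add_left_cancel this
  have htr : (1 + N).trace = ∑ i, hH.eigenvalues i := by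
    simpa using hH.trace_eq_sum_eigenvalues
  have htr1 : N.trace = ∑ i, (hH.eigenvalues i - 1) := by
    rw [Finset.sum_sub_distrib, ← htr, Matrix.trace_add, Matrix.trace_one]
    simp
  refine ⟨hH.eigenvalues, hN.eigenvalues_pos, htr1, ?_, ?_, fun h i => ?_⟩
  · rw [hH.det_eq_prod_eigenvalues]
    simp only [RCLike.ofReal_real_eq_id, id]
    exact Real.log_prod fun i _ => (hN.eigenvalues_pos i).ne'
  · have h2 := trace_mul_self_eq_sum_eigenvalues hH
    have h3 : (1 + N) * (1 + N) = 1 + (2 : ℝ) • N + N * N := by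
      rw [two_smul]; noncomm_ring
    rw [frobSq_eq_trace hNs]
    rw [h3, Matrix.trace_add, Matrix.trace_add, Matrix.trace_smul, Matrix.trace_one, htr1] at h2
    have h4 : ∑ i, (hH.eigenvalues i - 1) ^ 2 = ∑ i, hH.eigenvalues i ^ 2
        - 2 * ∑ i, (hH.eigenvalues i - 1) - Fintype.card ι := by
      have : (Fintype.card ι : ℝ) = ∑ _i : ι, (1 : ℝ) := by simp
      rw [this, Finset.mul_sum, ← Finset.sum_sub_distrib, ← Finset.sum_sub_distrib]
      exact Finset.sum_congr rfl fun i _ => by ring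
    rw [h4, ← h2, smul_eq_mul]
    ring
  · set v : ι → ℝ := (hH.eigenvectorBasis i).ofLp with hv
    have hv1 : v ⬝ᵥ v = 1 := by
      have := (hH.eigenvectorBasis.orthonormal).1 i
      have h2 : ‖hH.eigenvectorBasis i‖ ^ 2 = 1 := by rw [this]; norm_num
      rw [EuclideanSpace.real_norm_sq_eq] at h2
      simpa [dotProduct, sq] using h2
    have h1 := hH.mulVec_eigenvectorBasis i
    have h3 : v ⬝ᵥ (1 + N) *ᵥ v = hH.eigenvalues i := by
      rw [hv, h1, dotProduct_smul, ← hv, hv1]; simp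
    have h4 := h v
    rw [Matrix.add_mulVec, Matrix.one_mulVec, dotProduct_add, hv1] at h3
    linarith

/-- Row `i` of `N * G` is `G` applied to row `i` of `N`, so the operator bound can be summed over
rows. -/
lemma frobSq_mul_symm_le {G N : Matrix ι ι ℝ} (hG : Gᵀ = G) {c : ℝ}
    (h : ∀ v : ι → ℝ, (G *ᵥ v) ⬝ᵥ (G *ᵥ v) ≤ c * (v ⬝ᵥ v)) :
    frobSq (N * G) ≤ c * frobSq N := by
  have h1 : ∀ A : Matrix ι ι ℝ, frobSq A = ∑ i, A i ⬝ᵥ A i := fun A => by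
    simp [frobSq, dotProduct, sq]
  rw [h1, h1, Finset.mul_sum]
  refine Finset.sum_le_sum fun i _ => ?_
  have : (N * G) i = G *ᵥ (N i) := by
    rw [← Matrix.vecMul_transpose, hG]
    exact Matrix.mul_apply_eq_vecMul N G i
  rw [this]
  exact h _

/-- First order concavity of `log det`, with quadratic remainder when the increment is not larger
than the base point. -/
lemma logDet_add_le {A Δ : Matrix ι ι ℝ} (hA : A.PosDef) (hAΔ : (A + Δ).PosDef) :
    Real.log (A + Δ).det ≤ Real.log A.det + (A⁻¹ * Δ).trace ∧
    ∀ c : ℝ, 0 < c → (∀ v : ι → ℝ, v ⬝ᵥ A *ᵥ v ≤ c * (v ⬝ᵥ v)) →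
      (∀ v : ι → ℝ, v ⬝ᵥ Δ *ᵥ v ≤ v ⬝ᵥ A *ᵥ v) →
      Real.log (A + Δ).det ≤ Real.log A.det + (A⁻¹ * Δ).trace - frobSq Δ / (6 * c ^ 2) := by
  set G := CFC.sqrt A with hGdef
  have hGp : G.PosSemidef := Matrix.nonneg_iff_posSemidef.1 (CFC.sqrt_nonneg A)
  have hGG : G * G = A := CFC.sqrt_mul_sqrt_self A hA.posSemidef.nonneg
  have hGs : Gᵀ = G := hGp.transpose_eq
  have hdet : G.det ≠ 0 := by
    intro h0
    have := hA.det_pos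
    rw [← hGG, Matrix.det_mul, h0] at this
    simp at this
  have hGu : IsUnit G.det := isUnit_iff_ne_zero.2 hdet
  have hi1 : G * G⁻¹ = 1 := Matrix.mul_nonsing_inv _ hGu
  have hi2 : G⁻¹ * G = 1 := Matrix.nonsing_inv_mul _ hGu
  have hGis : (G⁻¹)ᵀ = G⁻¹ := by rw [Matrix.transpose_nonsing_inv, hGs]
  -- Conjugation by `A^{-1/2}` moves the base point to the identity, where the claim reduces to
  -- scalar inequalities for the eigenvalues of `1 + N`. The condition `Δ ≤ A` becomes `N ≤ 1`, so
  -- these eigenvalues are at most `2`.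
  set N := G⁻¹ * Δ * G⁻¹ with hN
  have hΔ : Δ = G * N * G := by
    rw [hN]
    calc Δ = (G * G⁻¹) * Δ * (G⁻¹ * G) := by rw [hi1, hi2]; simp
      _ = _ := by simp only [Matrix.mul_assoc]
  have hAΔ' : A + Δ = G * (1 + N) * G := by
    rw [hΔ, ← hGG, mul_add, add_mul, mul_one]
  have h1N : 1 + N = G⁻¹ * (A + Δ) * (G⁻¹)ᵀ := by
    rw [hAΔ', hGis]
    calc 1 + N = (G⁻¹ * G) * (1 + N) * (G * G⁻¹) := by rw [hi1, hi2]; simp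
      _ = _ := by simp only [Matrix.mul_assoc]
  have hNpd : (1 + N).PosDef := by
    rw [h1N, ← Matrix.conjTranspose_eq_transpose_of_trivial]
    refine hAΔ.mul_mul_conjTranspose_same ?_
    rw [Matrix.vecMul_injective_iff_isUnit]
    exact (Matrix.isUnit_nonsing_inv_iff).2 ((Matrix.isUnit_iff_isUnit_det _).2 hGu)
  have hlog : Real.log (A + Δ).det = Real.log A.det + Real.log (1 + N).det := by
    rw [← Real.log_mul hA.det_pos.ne' hNpd.det_pos.ne', hAΔ', ← hGG]
    simp only [Matrix.det_mul]
    congr 1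
    ring
  have htrace : (A⁻¹ * Δ).trace = N.trace := by
    rw [← hGG, Matrix.mul_inv_rev, Matrix.mul_assoc, Matrix.trace_mul_comm, hN]
  obtain ⟨e, he0, he1, he2, he3, he4⟩ := exists_eigenvalues_one_add hNpd
  refine ⟨?_, fun c hc hAc hΔA => ?_⟩
  · rw [hlog, htrace, he1, he2]
    gcongr with i
    exact Real.log_le_sub_one_of_pos (he0 i)
  · have hGv : ∀ v : ι → ℝ, (G *ᵥ v) ⬝ᵥ (G *ᵥ v) = v ⬝ᵥ A *ᵥ v := fun v => by
      rw [← hGG, ← Matrix.mulVec_mulVec, dotProduct_mulVec_comm_of_symm hGs v]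
    have hN1 : ∀ v : ι → ℝ, v ⬝ᵥ N *ᵥ v ≤ v ⬝ᵥ v := by
      intro v
      have h1 := hΔA (G⁻¹ *ᵥ v)
      rw [← hGv, Matrix.mulVec_mulVec v G, hi1, Matrix.one_mulVec] at h1
      refine le_trans (le_of_eq ?_) h1
      rw [hN, ← Matrix.mulVec_mulVec, ← Matrix.mulVec_mulVec, Matrix.dotProduct_mulVec v,
        ← Matrix.mulVec_transpose, hGis]
    have he2' := he4 hN1
    have hfrob : frobSq Δ ≤ c ^ 2 * frobSq N := by
      have hb : ∀ v : ι → ℝ, (G *ᵥ v) ⬝ᵥ (G *ᵥ v) ≤ c * (v ⬝ᵥ v) := fun v => by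
        rw [hGv]; exact hAc v
      calc frobSq Δ = frobSq (G * N * G) := by rw [hΔ]
        _ ≤ c * frobSq (G * N) := frobSq_mul_symm_le hGs hb
        _ = c * frobSq (Nᵀ * G) := by
            rw [← frobSq_transpose, Matrix.transpose_mul, hGs]
        _ ≤ c * (c * frobSq Nᵀ) := by gcongr; exact frobSq_mul_symm_le hGs hb
        _ = _ := by rw [frobSq_transpose]; ring
    have hsum : ∑ i, (e i - 1) ^ 2 / 6 ≤ ∑ i, (e i - 1 - Real.log (e i)) :=
      Finset.sum_le_sum fun i _ => sq_le_sub_one_sub_log (he0 i) (he2' i)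
    rw [Finset.sum_sub_distrib, ← he1, ← he2, ← Finset.sum_div, ← he3] at hsum
    have hq : frobSq Δ / (6 * c ^ 2) ≤ frobSq N / 6 := by
      rw [div_le_div_iff₀ (by positivity) (by norm_num)]
      linarith
    rw [hlog, htrace]
    linarith

end LogDet

/-! ### The graphical Lasso: convexity, uniqueness and the oracle inequality. -/

section GraphicalLasso

variable {ι : Type*} [Fintype ι] [DecidableEq ι]

/-- The weighted off-diagonal `ℓ_1`-norm. -/
def offPenalty (w T : Matrix ι ι ℝ) : ℝ := ∑ i, ∑ j, if i ≠ j then w i j * |T i j| else 0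

/-- The graphical Lasso objective with general weights. -/
def penLogDet (S w : Matrix ι ι ℝ) (lam : ℝ) (T : Matrix ι ι ℝ) : ℝ :=
  (T * S).trace - Real.log T.det + lam * offPenalty w T

lemma offPenalty_nonneg {w : Matrix ι ι ℝ} (hw : ∀ i j, 0 ≤ w i j) (T : Matrix ι ι ℝ) :
    0 ≤ offPenalty w T := by
  refine Finset.sum_nonneg fun i _ => Finset.sum_nonneg fun j _ => ?_
  split_ifs
  · exact mul_nonneg (hw i j) (abs_nonneg _)
  · exact le_rfl

lemma offPenalty_segment_le {w : Matrix ι ι ℝ} (hw : ∀ i j, 0 ≤ w i j) (A B : Matrix ι ι ℝ)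
    {t : ℝ} (ht0 : 0 ≤ t) (ht1 : t ≤ 1) :
    offPenalty w (A + t • (B - A)) ≤ (1 - t) * offPenalty w A + t * offPenalty w B := by
  simp only [offPenalty, Finset.mul_sum]
  rw [← Finset.sum_add_distrib]
  refine Finset.sum_le_sum fun i _ => ?_
  rw [← Finset.sum_add_distrib]
  refine Finset.sum_le_sum fun j _ => ?_
  split_ifs
  · have h1 : |(A + t • (B - A)) i j| ≤ (1 - t) * |A i j| + t * |B i j| := by
      have : (A + t • (B - A)) i j = (1 - t) * A i j + t * B i j := by
        simp [Matrix.add_apply, Matrix.smul_apply, Matrix.sub_apply]; ring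
      rw [this]
      refine (abs_add_le _ _).trans (le_of_eq ?_)
      rw [abs_mul, abs_mul, abs_of_nonneg ht0, abs_of_nonneg (sub_nonneg.2 ht1)]
    calc _ ≤ w i j * ((1 - t) * |A i j| + t * |B i j|) := mul_le_mul_of_nonneg_left h1 (hw i j)
      _ = _ := by ring
  · simp

lemma posDef_segment {A B : Matrix ι ι ℝ} (hA : A.PosDef) (hB : B.PosDef) {t : ℝ}
    (ht0 : 0 ≤ t) (ht1 : t ≤ 1) : (A + t • (B - A)).PosDef := by
  refine posDef_of_dotProduct_mulVec ?_ fun v hv => ?_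
  · rw [Matrix.transpose_add, Matrix.transpose_smul, Matrix.transpose_sub, hA.transpose_eq,
      hB.transpose_eq]
  · have h1 := hA.qf_pos hv
    have h2 := hB.qf_pos hv
    simp only [Matrix.add_mulVec, Matrix.smul_mulVec, Matrix.sub_mulVec, dotProduct_add,
      dotProduct_smul, dotProduct_sub, smul_eq_mul]
    rcases ht0.eq_or_lt with rfl | ht
    · simpa using h1
    · nlinarith [mul_pos ht h2, mul_nonneg (sub_nonneg.2 ht1) h1.le]

/-- The tangent bound at the intermediate point is used towards both ends; the linear terms cancel
after weighting by `1 - t` and `t`. -/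
lemma logDet_segment_ge {A B : Matrix ι ι ℝ} (hA : A.PosDef) (hB : B.PosDef) {t : ℝ}
    (ht0 : 0 ≤ t) (ht1 : t ≤ 1) :
    (1 - t) * Real.log A.det + t * Real.log B.det ≤ Real.log (A + t • (B - A)).det := by
  set M := A + t • (B - A) with hM
  have hMp : M.PosDef := posDef_segment hA hB ht0 ht1
  have eA : M + (A - M) = A := by abel
  have eB : M + (B - M) = B := by abel
  have h1 := (logDet_add_le (Δ := A - M) hMp (by rwa [eA])).1
  have h2 := (logDet_add_le (Δ := B - M) hMp (by rwa [eB])).1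
  rw [eA] at h1
  rw [eB] at h2
  have e3 : A - M = -(t • (B - A)) := by rw [hM]; abel
  have e4 : B - M = (1 - t) • (B - A) := by rw [hM, sub_smul, one_smul]; abel
  rw [e3, Matrix.mul_neg, Matrix.mul_smul, Matrix.trace_neg, Matrix.trace_smul, smul_eq_mul] at h1
  rw [e4, Matrix.mul_smul, Matrix.trace_smul, smul_eq_mul] at h2
  nlinarith [mul_le_mul_of_nonneg_left h1 (sub_nonneg.2 ht1), mul_le_mul_of_nonneg_left h2 ht0]

lemma penLogDet_segment_le (S : Matrix ι ι ℝ) {w : Matrix ι ι ℝ} (hw : ∀ i j, 0 ≤ w i j)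
    {lam : ℝ} (hlam : 0 ≤ lam) {A B : Matrix ι ι ℝ} (hA : A.PosDef) (hB : B.PosDef) {t : ℝ}
    (ht0 : 0 ≤ t) (ht1 : t ≤ 1) :
    penLogDet S w lam (A + t • (B - A)) ≤
      (1 - t) * penLogDet S w lam A + t * penLogDet S w lam B := by
  have h1 := logDet_segment_ge hA hB ht0 ht1
  have h2 := mul_le_mul_of_nonneg_left (offPenalty_segment_le hw A B ht0 ht1) hlam
  have h3 : ((A + t • (B - A)) * S).trace = (1 - t) * (A * S).trace + t * (B * S).trace := by
    rw [Matrix.add_mul, Matrix.smul_mul, Matrix.sub_mul, Matrix.trace_add, Matrix.trace_smul,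
      Matrix.trace_sub, smul_eq_mul]
    ring
  simp only [penLogDet, h3]
  nlinarith

/-- Minimizers of the graphical Lasso objective are unique. -/
lemma penLogDet_minimizer_unique (S : Matrix ι ι ℝ) {w : Matrix ι ι ℝ} (hw : ∀ i j, 0 ≤ w i j)
    {lam : ℝ} (hlam : 0 ≤ lam) {A B : Matrix ι ι ℝ} (hA : A.PosDef) (hB : B.PosDef)
    (hAm : ∀ T : Matrix ι ι ℝ, T.PosDef → penLogDet S w lam A ≤ penLogDet S w lam T)
    (hBm : ∀ T : Matrix ι ι ℝ, T.PosDef → penLogDet S w lam B ≤ penLogDet S w lam T) :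
    B = A := by
  by_contra hne
  set D := (1 / 2 : ℝ) • (B - A) with hD
  set M := A + D with hM
  have hMp : M.PosDef := posDef_segment hA hB (by norm_num) (by norm_num)
  have hD0 : D ≠ 0 := by
    rw [hD]
    exact smul_ne_zero (by norm_num) (sub_ne_zero.2 hne)
  have eA : M + -D = A := by rw [hM]; abel
  have eB : M + D = B := by
    have : D + D = B - A := by rw [hD, ← add_smul]; norm_num
    rw [hM, add_assoc, this]; abel
  set c := Real.sqrt (frobSq M) + 1 with hc
  have hc0 : 0 < c := by positivity
  have hMc : ∀ v : ι → ℝ, v ⬝ᵥ M *ᵥ v ≤ c * (v ⬝ᵥ v) := fun v => by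
    refine (le_abs_self _).trans (abs_qf_le_of_frobSq hc0.le ?_ v)
    rw [hc]
    nlinarith [Real.sq_sqrt (frobSq_nonneg M), Real.sqrt_nonneg (frobSq M)]
  -- The increment does not exceed the base point because `M + D = B` is positive definite; for the
  -- opposite increment `A` plays this role.
  have h1 := (logDet_add_le (Δ := -D) hMp (by rwa [eA])).2 c hc0 hMc fun v => by
    rcases eq_or_ne v 0 with rfl | hv
    · simp
    · have := hB.qf_pos hv
      rw [← eB, Matrix.add_mulVec, dotProduct_add] at this
      rw [Matrix.neg_mulVec, dotProduct_neg]
      linarith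
  have h2 := (logDet_add_le (Δ := D) hMp (by rwa [eB])).2 c hc0 hMc fun v => by
    rcases eq_or_ne v 0 with rfl | hv
    · simp
    · have := hA.qf_pos hv
      rw [← eA, Matrix.add_mulVec, dotProduct_add, Matrix.neg_mulVec, dotProduct_neg] at this
      linarith
  rw [eA, Matrix.mul_neg, Matrix.trace_neg] at h1
  rw [eB] at h2
  have hF1 : 0 < frobSq D / (6 * c ^ 2) := div_pos (frobSq_pos hD0) (by positivity)
  have hF2 : 0 < frobSq (-D) / (6 * c ^ 2) :=
    div_pos (frobSq_pos (neg_ne_zero.2 hD0)) (by positivity)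
  have h3 := mul_le_mul_of_nonneg_left
    (offPenalty_segment_le hw A B (t := 1 / 2) (by norm_num) (by norm_num)) hlam
  have h4 : (M * S).trace = (1 / 2) * (A * S).trace + (1 / 2) * (B * S).trace := by
    rw [hM, hD, Matrix.add_mul, Matrix.smul_mul, Matrix.sub_mul, Matrix.trace_add,
      Matrix.trace_smul, Matrix.trace_sub, smul_eq_mul]
    ring
  have h5 := hAm M hMp
  have h6 := hBm M hMp
  rw [← hD, ← hM] at h3
  simp only [penLogDet] at h5 h6
  rw [h4] at h5 h6
  linarith

lemma continuous_frobSq_sub (A : Matrix ι ι ℝ) :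
    Continuous fun T : Matrix ι ι ℝ => frobSq (T - A) := by
  unfold frobSq
  refine continuous_finsetSum _ fun i _ => continuous_finsetSum _ fun j _ => ?_
  simp only [Matrix.sub_apply]
  exact ((continuous_apply_apply i j).sub continuous_const).pow 2

lemma isCompact_symm_frobBall (A : Matrix ι ι ℝ) (R : ℝ) :
    IsCompact {T : Matrix ι ι ℝ | Tᵀ = T ∧ frobSq (T - A) ≤ R} := by
  have hbox : IsCompact (Set.Icc (fun i j => A i j - (R + 1)) (fun i j => A i j + (R + 1))
      : Set (ι → ι → ℝ)) := isCompact_Icc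
  have hclosed : IsClosed {T : Matrix ι ι ℝ | Tᵀ = T ∧ frobSq (T - A) ≤ R} := by
    refine IsClosed.inter ?_ (isClosed_le (continuous_frobSq_sub A) continuous_const)
    exact isClosed_eq (Continuous.matrix_transpose continuous_id) continuous_id
  refine IsCompact.of_isClosed_subset (s := (Set.Icc (fun i j => A i j - (R + 1))
    (fun i j => A i j + (R + 1)) : Set (ι → ι → ℝ))) hbox hclosed ?_
  rintro T ⟨-, hT⟩
  have h : ∀ i j, |T i j - A i j| ≤ R + 1 := fun i j => by
    have h1 : (T i j - A i j) ^ 2 ≤ R := (sq_entry_le_frobSq (Matrix.of T - A) i j).trans hT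
    have hR : 0 ≤ R := (sq_nonneg _).trans h1
    exact abs_le_of_sq_le_sq (by nlinarith) (by linarith)
  exact ⟨fun i j => by linarith [(abs_le.1 (h i j)).1], fun i j => by
    linarith [(abs_le.1 (h i j)).2]⟩

lemma trace_mul_eq_sum (A B : Matrix ι ι ℝ) : (A * B).trace = ∑ i, ∑ j, A i j * B j i := by
  simp [Matrix.trace, Matrix.mul_apply]

/-- The basic inequality of the Lasso analysis, on the level of penalties. -/
lemma offPenalty_add_sub_ge {w T₀ : Matrix ι ι ℝ} {W : ℝ} (hw : ∀ i j, 0 ≤ w i j)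
    (hwW : ∀ i j, i ≠ j → w i j ≤ W) (hW : 0 ≤ W) {N : ℝ}
    (hN : ((Finset.univ.filter fun p : ι × ι => T₀ p.1 p.2 ≠ 0 ∧ p.1 ≠ p.2).card : ℝ) ≤ N)
    (D : Matrix ι ι ℝ) {ρ : ℝ} (hρ : 0 ≤ ρ) (hD : frobSq D ≤ ρ ^ 2) :
    offPenalty w D - 2 * (W * Real.sqrt N * ρ) ≤ offPenalty w (T₀ + D) - offPenalty w T₀ := by
  set Sp := Finset.univ.filter fun p : ι × ι => T₀ p.1 p.2 ≠ 0 ∧ p.1 ≠ p.2 with hSp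
  -- Cauchy–Schwarz on the support turns the Frobenius radius into an `ℓ_1` bound at the price `√N`.
  have hsup : ∑ p ∈ Sp, |D p.1 p.2| ≤ Real.sqrt N * ρ := by
    have hN0 : 0 ≤ N := le_trans (Nat.cast_nonneg _) hN
    apply abs_le_of_sq_le_sq' _ (by positivity) |>.2
    calc (∑ p ∈ Sp, |D p.1 p.2|) ^ 2 ≤ (Sp.card : ℝ) * ∑ p ∈ Sp, |D p.1 p.2| ^ 2 :=
          sq_sum_le_card_mul_sum_sq
      _ ≤ N * frobSq D := by
          refine mul_le_mul hN ?_ (Finset.sum_nonneg fun _ _ => sq_nonneg _) hN0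
          have : frobSq D = ∑ p : ι × ι, |D p.1 p.2| ^ 2 := by
            rw [Fintype.sum_prod_type]; simp [frobSq]
          rw [this]
          exact Finset.sum_le_sum_of_subset_of_nonneg (Finset.subset_univ _)
            fun _ _ _ => sq_nonneg _
      _ ≤ N * ρ ^ 2 := by gcongr
      _ = _ := by rw [mul_pow, Real.sq_sqrt hN0]
  have hprod : ∀ A : Matrix ι ι ℝ, offPenalty w A =
      ∑ p : ι × ι, if p.1 ≠ p.2 then w p.1 p.2 * |A p.1 p.2| else 0 := fun A => by
    rw [Fintype.sum_prod_type]; rfl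
  have hWs : ∑ p : ι × ι, (if T₀ p.1 p.2 ≠ 0 ∧ p.1 ≠ p.2 then W * |D p.1 p.2| else 0)
      ≤ W * Real.sqrt N * ρ := by
    rw [← Finset.sum_filter, ← Finset.mul_sum, mul_assoc]
    exact mul_le_mul_of_nonneg_left hsup hW
  -- Off the support of `T₀` the penalty increment is exactly the penalty of `D`. On the support the
  -- triangle inequality loses at most twice that penalty.
  have hpt : offPenalty w D - 2 * ∑ p : ι × ι,
      (if T₀ p.1 p.2 ≠ 0 ∧ p.1 ≠ p.2 then W * |D p.1 p.2| else 0)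
      ≤ offPenalty w (T₀ + D) - offPenalty w T₀ := by
    rw [hprod, hprod, hprod, Finset.mul_sum, ← Finset.sum_sub_distrib, ← Finset.sum_sub_distrib]
    refine Finset.sum_le_sum fun p _ => ?_
    by_cases hp : p.1 = p.2
    · simp [hp]
    · by_cases h0 : T₀ p.1 p.2 = 0
      · simp [hp, h0]
      · simp only [ne_eq, hp, not_false_eq_true, if_true, h0, and_self, Matrix.add_apply]
        have h1 : |T₀ p.1 p.2| ≤ |T₀ p.1 p.2 + D p.1 p.2| + |D p.1 p.2| := by
          have := abs_sub_abs_le_abs_sub (T₀ p.1 p.2) (-(D p.1 p.2))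
          rw [sub_neg_eq_add, abs_neg] at this
          linarith
        have h2 := mul_le_mul_of_nonneg_left h1 (hw p.1 p.2)
        have h3 := mul_le_mul_of_nonneg_right (hwW p.1 p.2 hp) (abs_nonneg (D p.1 p.2))
        nlinarith
  linarith

/-- **Oracle inequality for the weighted graphical Lasso.** If `S` agrees with `T₀⁻¹` on the
diagonal and up to half the penalty level off the diagonal, then the graphical Lasso problem for
`S` has a unique solution, and the solution is close to `T₀`. -/
theorem exists_unique_graphicalLasso {S w T₀ : Matrix ι ι ℝ} {lam W N κ ρ : ℝ}
    (hlam : 0 < lam) (hT₀ : T₀.PosDef) (hw : ∀ i j, 0 ≤ w i j)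
    (hwW : ∀ i j, i ≠ j → w i j ≤ W) (hW : 0 ≤ W)
    (hN : ((Finset.univ.filter fun p : ι × ι => T₀ p.1 p.2 ≠ 0 ∧ p.1 ≠ p.2).card : ℝ) ≤ N)
    (hdiag : ∀ i, S i i = T₀⁻¹ i i)
    (hoff : ∀ i j, i ≠ j → |S j i - T₀⁻¹ j i| ≤ lam * w i j / 2)
    (hκ : 0 < κ) (hup : ∀ v : ι → ℝ, v ⬝ᵥ T₀ *ᵥ v ≤ κ * (v ⬝ᵥ v))
    (hlow : ∀ v : ι → ℝ, κ⁻¹ * (v ⬝ᵥ v) ≤ v ⬝ᵥ T₀ *ᵥ v)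
    (hρκ : ρ < κ⁻¹) (hρ : 12 * κ ^ 2 * lam * W * Real.sqrt N < ρ) :
    ∃ T : Matrix ι ι ℝ, T.PosDef ∧
      (∀ T' : Matrix ι ι ℝ, T'.PosDef → penLogDet S w lam T ≤ penLogDet S w lam T') ∧
      frobSq (T - T₀) ≤ ρ ^ 2 ∧ offPenalty w (T - T₀) ≤ 4 * (W * Real.sqrt N * ρ) := by
  have hρ0 : 0 < ρ := lt_of_le_of_lt (by positivity) hρ
  set f := penLogDet S w lam with hf
  -- positive definiteness in the ball
  have hball : ∀ D : Matrix ι ι ℝ, Dᵀ = D → frobSq D ≤ ρ ^ 2 → (T₀ + D).PosDef := by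
    intro D hDs hD
    refine posDef_of_lowerBound (c := κ⁻¹ - ρ) ?_ (by linarith) fun v => ?_
    · rw [Matrix.transpose_add, hT₀.transpose_eq, hDs]
    · have h1 := (abs_le.1 (abs_qf_le_of_frobSq hρ0.le hD v)).1
      have h2 := hlow v
      rw [Matrix.add_mulVec, dotProduct_add]
      linarith
  -- Growth of the objective around `T₀`: curvature of `-log det`, plus the penalty, minus the
  -- noise. The noise vanishes on the diagonal and uses up half of the penalty off it, so half of
  -- the penalty survives.
  have hbasic : ∀ D : Matrix ι ι ℝ, Dᵀ = D → frobSq D ≤ ρ ^ 2 →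
      frobSq D / (6 * κ ^ 2) + lam / 2 * offPenalty w D - 2 * lam * (W * Real.sqrt N * ρ)
        ≤ f (T₀ + D) - f T₀ := by
    intro D hDs hD
    have h1 := (logDet_add_le hT₀ (hball D hDs hD)).2 κ hκ hup fun v => by
      have h1 := (abs_le.1 (abs_qf_le_of_frobSq hρ0.le hD v)).2
      have h2 := hlow v
      have h3 := mul_le_mul_of_nonneg_right hρκ.le (dotProduct_self_nonneg' v)
      linarith
    have h2 := mul_le_mul_of_nonneg_left
      (offPenalty_add_sub_ge hw hwW hW hN D hρ0.le hD) hlam.le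
    have h3 : -(lam / 2 * offPenalty w D) ≤ (D * S).trace - (T₀⁻¹ * D).trace := by
      rw [Matrix.trace_mul_comm T₀⁻¹, trace_mul_eq_sum, trace_mul_eq_sum, offPenalty,
        Finset.mul_sum, ← Finset.sum_sub_distrib, ← Finset.sum_neg_distrib]
      refine Finset.sum_le_sum fun i _ => ?_
      rw [Finset.mul_sum, ← Finset.sum_sub_distrib, ← Finset.sum_neg_distrib]
      refine Finset.sum_le_sum fun j _ => ?_
      by_cases hij : i = j
      · subst hij; simp [hdiag]
      · simp only [ne_eq, hij, not_false_eq_true, if_true]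
        have h4 := mul_le_mul_of_nonneg_left (hoff i j hij) (abs_nonneg (D i j))
        rw [← abs_mul] at h4
        have h5 := neg_abs_le (D i j * (S j i - T₀⁻¹ j i))
        nlinarith
    simp only [hf, penLogDet, Matrix.add_mul, Matrix.trace_add]
    nlinarith
  -- minimization over the ball
  set K := {T : Matrix ι ι ℝ | Tᵀ = T ∧ frobSq (T - T₀) ≤ ρ ^ 2} with hK
  have hKpd : ∀ T ∈ K, T.PosDef := by
    rintro T ⟨h1, h2⟩
    have := hball (T - T₀) (by rw [Matrix.transpose_sub, h1, hT₀.transpose_eq]) h2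
    rwa [add_sub_cancel] at this
  have hKc : IsCompact K := isCompact_symm_frobBall T₀ _
  have hT₀K : T₀ ∈ K := ⟨hT₀.transpose_eq, by simp [frobSq]; positivity⟩
  have hfc : ContinuousOn f K := by
    have c1 : Continuous fun T : Matrix ι ι ℝ => (T * S).trace := by fun_prop
    have c2 : ContinuousOn (fun T : Matrix ι ι ℝ => Real.log T.det) K :=
      ContinuousOn.log (by fun_prop) fun T hT => (hKpd T hT).det_pos.ne'
    have c3 : Continuous fun T : Matrix ι ι ℝ => offPenalty w T := by
      unfold offPenalty
      refine continuous_finsetSum _ fun i _ => continuous_finsetSum _ fun j _ => ?_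
      split_ifs
      · exact continuous_const.mul (continuous_apply_apply i j).abs
      · exact continuous_const
    exact (c1.continuousOn.sub c2).add (continuous_const.mul c3).continuousOn
  obtain ⟨T, hTK, hTmin⟩ := hKc.exists_isMinOn ⟨T₀, hT₀K⟩ hfc
  have hTpd := hKpd T hTK
  have hTs : (T - T₀)ᵀ = T - T₀ := by
    rw [Matrix.transpose_sub, hTK.1, hT₀.transpose_eq]
  have hTb := hbasic (T - T₀) hTs hTK.2
  rw [add_sub_cancel] at hTb
  have hTT₀ : f T ≤ f T₀ := hTmin hT₀K
  have hpen : lam * offPenalty w (T - T₀) ≤ lam * (4 * (W * Real.sqrt N * ρ)) := by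
    have : 0 ≤ frobSq (T - T₀) / (6 * κ ^ 2) := div_nonneg (frobSq_nonneg _) (by positivity)
    linarith
  -- Comparison with `T₀` gives a squared error of at most `12 κ² lam W √N ρ`, and the lower bound
  -- on `ρ` is chosen to make this less than `ρ²`. The minimizer is thus interior, and convexity
  -- makes it global.
  have hint : frobSq (T - T₀) < ρ ^ 2 := by
    have h1 : 0 ≤ lam / 2 * offPenalty w (T - T₀) :=
      mul_nonneg (by positivity) (offPenalty_nonneg hw _)
    have h2 : frobSq (T - T₀) / (6 * κ ^ 2) ≤ 2 * lam * (W * Real.sqrt N * ρ) := by linarith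
    rw [div_le_iff₀ (by positivity)] at h2
    nlinarith [mul_lt_mul_of_pos_right hρ hρ0]
  refine ⟨T, hTpd, fun T' hT' => ?_, hTK.2, le_of_mul_le_mul_left hpen hlam⟩
  -- a minimizer in the interior of the ball is a global minimizer
  have hcont : Continuous fun t : ℝ => frobSq (T + t • (T' - T) - T₀) :=
    (continuous_frobSq_sub T₀).comp (by fun_prop)
  have hnear : ∀ᶠ t : ℝ in 𝓝[>] 0, frobSq (T + t • (T' - T) - T₀) < ρ ^ 2 := by
    refine Filter.Eventually.filter_mono nhdsWithin_le_nhds ?_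
    refine hcont.continuousAt.eventually_lt continuousAt_const ?_
    simpa using hint
  have hle1 : ∀ᶠ t : ℝ in 𝓝[>] 0, t ≤ 1 :=
    Filter.Eventually.filter_mono nhdsWithin_le_nhds (eventually_le_nhds one_pos)
  obtain ⟨t, ⟨ht1, ht2⟩, ht0⟩ := ((hnear.and hle1).and self_mem_nhdsWithin).exists
  have ht0' : 0 < t := ht0
  have hmem : T + t • (T' - T) ∈ K := by
    refine ⟨?_, ht1.le⟩
    rw [Matrix.transpose_add, Matrix.transpose_smul, Matrix.transpose_sub, hTK.1,
      hT'.transpose_eq]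
  have h1 : f T ≤ f (T + t • (T' - T)) := hTmin hmem
  have h2 := penLogDet_segment_le S hw hlam.le hTpd hT' ht0'.le ht2
  change f (T + t • (T' - T)) ≤ (1 - t) * f T + t * f T' at h2
  have h3 : t * f T ≤ t * f T' := by linarith
  exact le_of_mul_le_mul_left h3 ht0'

end GraphicalLasso

/-! ### Rates of the weighted graphical Lasso. -/

section GlassoRate

variable {d : ℕ}

lemma maxDegree_le_offDiagCount (A : Matrix (Fin d) (Fin d) ℝ) :
    maxDegree A ≤ offDiagCount A := by
  refine Finset.sup_le fun j _ => ?_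
  refine Finset.card_le_card_of_injOn (fun i => (i, j)) ?_ ?_
  · intro i hi
    simpa using hi
  · intro a _ b _ h
    exact (Prod.mk.inj h).1

/-- The row sums of a sparse symmetric matrix. -/
lemma sum_row_abs_sq_le_maxDegree {A : Matrix (Fin d) (Fin d) ℝ} (hA : Aᵀ = A) {c : ℝ}
    (h : ∀ i, ∑ j, A i j ^ 2 ≤ c) (i : Fin d) :
    (∑ j, |A i j|) ^ 2 ≤ (maxDegree A + 1) * c := by
  set Sp := Finset.univ.filter fun j : Fin d => A i j ≠ 0 with hSp
  -- The extra one accounts for the diagonal entry; symmetry exchanges rows and columns.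
  have hcard : Sp.card ≤ maxDegree A + 1 := by
    have h1 : Sp ⊆ insert i (Finset.univ.filter fun j : Fin d => A j i ≠ 0 ∧ j ≠ i) := by
      intro j hj
      have hj' : A i j ≠ 0 := (Finset.mem_filter.1 hj).2
      rw [← hA, Matrix.transpose_apply] at hj'
      by_cases hji : j = i
      · simp [hji]
      · simp [hji, hj']
    refine (Finset.card_le_card h1).trans ((Finset.card_insert_le _ _).trans ?_)
    gcongr
    exact Finset.le_sup (f := fun j : Fin d =>
      (Finset.univ.filter fun i : Fin d => A i j ≠ 0 ∧ i ≠ j).card) (Finset.mem_univ i)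
  have hsum : ∑ j, |A i j| = ∑ j ∈ Sp, |A i j| := by
    rw [hSp, Finset.sum_filter]
    refine Finset.sum_congr rfl fun j _ => ?_
    split_ifs with h0
    · rfl
    · rw [not_not.1 h0, abs_zero]
  rw [hsum]
  calc _ ≤ (Sp.card : ℝ) * ∑ j ∈ Sp, |A i j| ^ 2 := sq_sum_le_card_mul_sum_sq
    _ ≤ (maxDegree A + 1) * c := by
        refine mul_le_mul (by exact_mod_cast hcard) ?_
          (Finset.sum_nonneg fun _ _ => sq_nonneg _) (by positivity)
        simp only [sq_abs]
        exact (Finset.sum_le_sum_of_subset_of_nonneg (Finset.subset_univ _)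
          fun _ _ _ => sq_nonneg _).trans (h i)

lemma abs_sqrt_sub_one_le {x : ℝ} (hx : 0 ≤ x) : |Real.sqrt x - 1| ≤ |x - 1| := by
  have h1 : x - 1 = (Real.sqrt x - 1) * (Real.sqrt x + 1) := by
    nlinarith [Real.sq_sqrt hx]
  rw [h1, abs_mul]
  apply le_mul_of_one_le_right (abs_nonneg _)
  rw [abs_of_nonneg (by positivity)]
  linarith [Real.sqrt_nonneg x]

/-- Congruence with a positive diagonal matrix close to the identity. -/
lemma diagonal_congr_bounds {A : Matrix (Fin d) (Fin d) ℝ} {p : Fin d → ℝ} {a b c C : ℝ}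
    (ha : ∀ i, a ≤ p i ^ 2) (hb : ∀ i, p i ^ 2 ≤ b) (hc : 0 ≤ c) (hC : 0 ≤ C)
    (hlow : ∀ v : Fin d → ℝ, c * (v ⬝ᵥ v) ≤ v ⬝ᵥ A *ᵥ v)
    (hup : ∀ v : Fin d → ℝ, v ⬝ᵥ A *ᵥ v ≤ C * (v ⬝ᵥ v)) (v : Fin d → ℝ) :
    c * a * (v ⬝ᵥ v) ≤ v ⬝ᵥ (Matrix.diagonal p * A * Matrix.diagonal p) *ᵥ v ∧
    v ⬝ᵥ (Matrix.diagonal p * A * Matrix.diagonal p) *ᵥ v ≤ C * b * (v ⬝ᵥ v) := by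
  set u : Fin d → ℝ := fun i => p i * v i with hu
  have hqf : v ⬝ᵥ (Matrix.diagonal p * A * Matrix.diagonal p) *ᵥ v = u ⬝ᵥ A *ᵥ u := by
    have h1 : Matrix.diagonal p *ᵥ v = u := by
      ext i; simp [Matrix.mulVec_diagonal, hu]
    rw [← Matrix.mulVec_mulVec, ← Matrix.mulVec_mulVec, h1, Matrix.dotProduct_mulVec v,
      ← Matrix.mulVec_transpose, Matrix.diagonal_transpose, h1]
  have huu : u ⬝ᵥ u = ∑ i, p i ^ 2 * (v i * v i) := by
    simp only [dotProduct, hu]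
    exact Finset.sum_congr rfl fun i _ => by ring
  have h1 : a * (v ⬝ᵥ v) ≤ u ⬝ᵥ u := by
    rw [huu, dotProduct, Finset.mul_sum]
    exact Finset.sum_le_sum fun i _ => mul_le_mul_of_nonneg_right (ha i) (mul_self_nonneg _)
  have h2 : u ⬝ᵥ u ≤ b * (v ⬝ᵥ v) := by
    rw [huu, dotProduct, Finset.mul_sum]
    exact Finset.sum_le_sum fun i _ => mul_le_mul_of_nonneg_right (hb i) (mul_self_nonneg _)
  rw [hqf]
  constructor
  · calc _ = c * (a * (v ⬝ᵥ v)) := by ring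
      _ ≤ c * (u ⬝ᵥ u) := by gcongr
      _ ≤ _ := hlow u
  · calc _ ≤ C * (u ⬝ᵥ u) := hup u
      _ ≤ C * (b * (v ⬝ᵥ v)) := by gcongr
      _ = _ := by ring

set_option maxHeartbeats 1000000 in
/-- Rates of convergence of the weighted graphical Lasso, in the rowwise `ℓ_1`- and
`ℓ_2`-norms. -/
theorem glasso_rate {Sg S Th : Matrix (Fin d) (Fin d) ℝ} {lam κ N δ L : ℝ}
    (hSg : Sg.PosDef) (hκ : 1 ≤ κ)
    (hlow : ∀ v : Fin d → ℝ, κ⁻¹ * (v ⬝ᵥ v) ≤ v ⬝ᵥ Sg *ᵥ v)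
    (hup : ∀ v : Fin d → ℝ, v ⬝ᵥ Sg *ᵥ v ≤ κ * (v ⬝ᵥ v))
    (hN1 : 1 ≤ N) (hN : (offDiagCount Sg⁻¹ : ℝ) ≤ N)
    (hlam : 0 < lam) (hδ : ∀ i j, |S i j - Sg i j| ≤ δ) (hδlam : 16 * κ ^ 3 * δ ≤ lam)
    (hδκ : 2 * κ * δ ≤ 1) (hsmall : 210 * κ ^ 4 * lam * Real.sqrt N < 1)
    (hL : ∀ i, ∑ j, |Sg⁻¹ i j| ≤ L) (hLN : L ≤ 2 * κ * Real.sqrt N)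
    (hTh : ∀ T, IsGlassoSolution S lam T → (∀ T', IsGlassoSolution S lam T' → T' = T) → Th = T) :
    (∀ i, ∑ j, |(Th - Sg⁻¹) i j| ≤ 2000 * κ ^ 5 * N * lam) ∧
    (∀ i, ∑ j, (Th - Sg⁻¹) i j ^ 2 ≤ (150 * κ ^ 3 * Real.sqrt N * lam) ^ 2) := by
  have hκ0 : 0 < κ := by linarith
  have hκinv : κ⁻¹ ≤ 1 := inv_le_one_of_one_le₀ hκ
  have hsN1 : 1 ≤ Real.sqrt N := Real.one_le_sqrt.2 hN1
  have hsN : Real.sqrt N ^ 2 = N := Real.sq_sqrt (by linarith)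
  have hSgd : ∀ i, κ⁻¹ ≤ Sg i i ∧ Sg i i ≤ κ := fun i => by
    have h1 := hlow (Pi.single i 1)
    have h2 := hup (Pi.single i 1)
    simp only [single_qf] at h1 h2
    simp at h1 h2
    exact ⟨h1, h2⟩
  have hSgp : ∀ i, 0 < Sg i i := fun i => (inv_pos.2 hκ0).trans_le (hSgd i).1
  rcases isEmpty_or_nonempty (Fin d) with hemp | hne
  · exact ⟨fun i => (hemp.false i).elim, fun i => (hemp.false i).elim⟩
  have hδ0 : 0 ≤ δ := (abs_nonneg _).trans (hδ hne.some hne.some)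
  -- the ratio of the variances
  set x : Fin d → ℝ := fun i => S i i / Sg i i with hx
  have hx1 : ∀ i, |x i - 1| ≤ κ * δ := fun i => by
    have : x i - 1 = (S i i - Sg i i) / Sg i i := by
      rw [hx]; field_simp [(hSgp i).ne']
    rw [this, abs_div, abs_of_pos (hSgp i), div_le_iff₀ (hSgp i)]
    calc _ ≤ δ := hδ i i
      _ = κ * δ * κ⁻¹ := by field_simp
      _ ≤ _ := by gcongr; exact (hSgd i).1
  have hxl : ∀ i, 1 / 2 ≤ x i := fun i => by linarith [(abs_le.1 (hx1 i)).1]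
  have hxu : ∀ i, x i ≤ 3 / 2 := fun i => by linarith [(abs_le.1 (hx1 i)).2]
  have hSd : ∀ i, S i i = x i * Sg i i := fun i => by
    rw [hx]; field_simp [(hSgp i).ne']
  have hSl : ∀ i, κ⁻¹ / 2 ≤ S i i := fun i => by
    rw [hSd]; nlinarith [hxl i, (hSgd i).1, inv_pos.2 hκ0]
  have hSu : ∀ i, S i i ≤ 2 * κ := fun i => by
    rw [hSd]; nlinarith [hxu i, hxl i, (hSgd i).2, hSgp i]
  have hSp : ∀ i, 0 < S i i := fun i => (by positivity : 0 < κ⁻¹ / 2).trans_le (hSl i)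
  set q : Fin d → ℝ := fun i => Real.sqrt (x i) with hq
  have hq0 : ∀ i, 0 < q i := fun i => Real.sqrt_pos.2 (by linarith [hxl i])
  have hqq : ∀ i, q i ^ 2 = x i := fun i => Real.sq_sqrt (by linarith [hxl i])
  have hq1 : ∀ i, |q i - 1| ≤ κ * δ := fun i =>
    (abs_sqrt_sub_one_le (by linarith [hxl i])).trans (hx1 i)
  have hqu : ∀ i, q i ≤ 3 / 2 := fun i => by linarith [(abs_le.1 (hq1 i)).2]
  have hql : ∀ i, 1 / 2 ≤ q i := fun i => by linarith [(abs_le.1 (hq1 i)).1]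
  have hqij : ∀ i j, |q i * q j - 1| ≤ 3 * κ * δ := fun i j => by
    have : q i * q j - 1 = (q i - 1) * q j + (q j - 1) := by ring
    rw [this]
    refine (abs_add_le _ _).trans ?_
    rw [abs_mul, abs_of_pos (hq0 j)]
    nlinarith [hq1 i, hq1 j, hqu j, hq0 j, abs_nonneg (q i - 1), abs_nonneg (q j - 1)]
  have hqijl : ∀ i j, 1 / 2 ≤ q i * q j := fun i j => by
    apply abs_le_of_sq_le_sq' _ (mul_pos (hq0 i) (hq0 j)).le |>.2
    rw [mul_pow, hqq, hqq]
    nlinarith [hxl i, hxl j]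
  have hqinv : ∀ i j, |(q i)⁻¹ * (q j)⁻¹ - 1| ≤ 6 * κ * δ := fun i j => by
    have h0 : 0 < q i * q j := mul_pos (hq0 i) (hq0 j)
    have : (q i)⁻¹ * (q j)⁻¹ - 1 = -(q i * q j - 1) / (q i * q j) := by
      field_simp [(hq0 i).ne', (hq0 j).ne']; ring
    rw [this, abs_div, abs_neg, abs_of_pos h0, div_le_iff₀ h0]
    nlinarith [hqij i j, hqijl i j, mul_nonneg hκ0.le hδ0]
  -- the rescaled target
  set Dq := Matrix.diagonal q
  set Di := Matrix.diagonal fun i => (q i)⁻¹ with hDi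
  have hDD : Di * Dq = 1 := by
    rw [Matrix.diagonal_mul_diagonal]
    ext i j
    simp [Matrix.diagonal_apply, Matrix.one_apply, (hq0 i).ne']
  have hDD' : Dq * Di = 1 := by
    rw [Matrix.diagonal_mul_diagonal]
    ext i j
    simp [Matrix.diagonal_apply, Matrix.one_apply, (hq0 i).ne']
  -- Dividing rows and columns by `q` gives `T₀⁻¹` exactly the diagonal of `S`, as the oracle
  -- inequality requires, and leaves the support unchanged. The off-diagonal noise only grows by a
  -- multiple of `κ² δ`.
  set T₀ := Di * Sg⁻¹ * Di with hT₀
  have hT₀e : ∀ i j, T₀ i j = (q i)⁻¹ * Sg⁻¹ i j * (q j)⁻¹ := fun i j => by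
    simp [hT₀, hDi, Matrix.diagonal_mul, Matrix.mul_diagonal]
  have hT₀i : T₀⁻¹ = Dq * Sg * Dq := by
    apply Matrix.inv_eq_right_inv
    calc _ = Di * Sg⁻¹ * (Di * Dq) * Sg * Dq := by rw [hT₀]; simp only [Matrix.mul_assoc]
      _ = Di * (Sg⁻¹ * Sg) * Dq := by rw [hDD]; simp only [Matrix.mul_assoc, Matrix.one_mul]
      _ = 1 := by rw [hSg.inv_mul_cancel', Matrix.mul_one, hDD]
  have hT₀ie : ∀ i j, T₀⁻¹ i j = q i * Sg i j * q j := fun i j => by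
    rw [hT₀i]; simp [Dq, Matrix.diagonal_mul, Matrix.mul_diagonal]
  -- Since `q i ^ 2 = x i` lies in `[1/2, 3/2]`, its inverse lies in `[2/3, 2]`; the rescaled target
  -- satisfies the spectral bounds with `2 * κ` in place of `κ`.
  have hbd := diagonal_congr_bounds (A := Sg⁻¹) (p := fun i => (q i)⁻¹) (a := 2 / 3) (b := 2)
    (c := κ⁻¹) (C := κ)
    (fun i => by
      rw [inv_pow, hqq, le_inv_comm₀ (by norm_num) (by linarith [hxl i])]
      linarith [hxu i])
    (fun i => by
      rw [inv_pow, hqq, inv_le_comm₀ (by linarith [hxl i]) (by norm_num)]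
      linarith [hxl i]) (by positivity) hκ0.le
    (le_inv_qf hSg hκ0 hup) (fun v => by
      simpa using inv_qf_le hSg (inv_pos.2 hκ0) hlow v)
  have hT₀s : T₀ᵀ = T₀ := by
    rw [hT₀, Matrix.transpose_mul, Matrix.transpose_mul, hDi, Matrix.diagonal_transpose,
      hSg.inv.transpose_eq, Matrix.mul_assoc]
  have hT₀p : T₀.PosDef := posDef_of_lowerBound hT₀s (c := κ⁻¹ * (2 / 3)) (by positivity)
    fun v => (hbd v).1
  set w : Matrix (Fin d) (Fin d) ℝ := Matrix.of fun i j => Real.sqrt (S i i * S j j) with hw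
  have hwl : ∀ i j, κ⁻¹ / 2 ≤ w i j := fun i j => by
    apply Real.le_sqrt_of_sq_le
    rw [sq]
    exact mul_le_mul (hSl i) (hSl j) (by positivity) (hSp i).le
  have hwu : ∀ i j, w i j ≤ 2 * κ := fun i j => by
    apply Real.sqrt_le_iff.2 ⟨by positivity, ?_⟩
    rw [sq]
    exact mul_le_mul (hSu i) (hSu j) (hSp j).le (by positivity)
  have hsupp : (Finset.univ.filter fun p : Fin d × Fin d => T₀ p.1 p.2 ≠ 0 ∧ p.1 ≠ p.2)
      = Finset.univ.filter fun p : Fin d × Fin d => Sg⁻¹ p.1 p.2 ≠ 0 ∧ p.1 ≠ p.2 := by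
    refine Finset.filter_congr fun p _ => ?_
    rw [hT₀e]
    simp [(hq0 p.1).ne', (hq0 p.2).ne']
  -- With `2 * κ` for both `κ` and `W`, the oracle inequality needs `96 κ³ lam √N < ρ`, and `ρ <
  -- (2κ)⁻¹` follows from `hsmall` because `208 ≤ 210`.
  set ρ := 104 * κ ^ 3 * lam * Real.sqrt N with hρ
  have hρ0 : 0 < ρ := by positivity
  obtain ⟨T, hTp, hTmin, hTf, hTo⟩ := exists_unique_graphicalLasso (S := S) (w := w) (T₀ := T₀)
    (lam := lam) (W := 2 * κ) (N := N) (κ := 2 * κ) (ρ := ρ) hlam hT₀p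
    (fun i j => (by positivity : 0 ≤ κ⁻¹ / 2).trans (hwl i j)) (fun i j _ => hwu i j)
    (by positivity) (by rw [hsupp]; exact hN)
    (fun i => by rw [hT₀ie, hSd, ← hqq]; ring)
    (fun i j _ => by
      rw [hT₀ie]
      have e1 : S j i - q j * Sg j i * q i = (S j i - Sg j i) - Sg j i * (q j * q i - 1) := by ring
      have e2 : |S j i - q j * Sg j i * q i| ≤ δ + κ * (3 * κ * δ) := by
        rw [e1]
        refine (abs_sub _ _).trans (add_le_add (hδ j i) ?_)
        rw [abs_mul]
        exact mul_le_mul (abs_entry_le hSg.posSemidef hκ0 hup j i) (hqij j i) (abs_nonneg _) hκ0.le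
      refine e2.trans ?_
      have e3 : lam * (κ⁻¹ / 2) / 2 ≤ lam * w i j / 2 := by gcongr; exact hwl i j
      refine le_trans ?_ e3
      have e4 : δ + κ * (3 * κ * δ) ≤ 4 * κ ^ 2 * δ := by nlinarith [mul_nonneg hδ0 (by linarith : (0:ℝ) ≤ κ - 1), mul_nonneg (mul_nonneg hδ0 (by linarith : (0:ℝ) ≤ κ - 1)) hκ0.le]
      refine e4.trans ?_
      calc 4 * κ ^ 2 * δ = (16 * κ ^ 3 * δ) * κ⁻¹ / 4 := by field_simp; ring
        _ ≤ lam * κ⁻¹ / 4 := by gcongr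
        _ = _ := by ring)
    (by positivity) (fun v => (hbd v).2.trans (le_of_eq (by ring)))
    (fun v => le_trans (by
      rw [mul_inv]
      have := dotProduct_self_nonneg' v
      have h3 : 0 ≤ κ⁻¹ * (v ⬝ᵥ v) := by positivity
      nlinarith) (hbd v).1)
    (by
      rw [← one_div, lt_div_iff₀ (by positivity)]
      calc ρ * (2 * κ) = 208 * κ ^ 4 * lam * Real.sqrt N := by rw [hρ]; ring
        _ ≤ 210 * κ ^ 4 * lam * Real.sqrt N := by gcongr; norm_num
        _ < 1 := hsmall)
    (by
      have : 0 < κ ^ 3 * lam * Real.sqrt N := by positivity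
      rw [hρ]; nlinarith)
  have hobj : ∀ T', glassoObjective S lam T' = penLogDet S w lam T' := fun T' => rfl
  have hsol : IsGlassoSolution S lam T := ⟨fun i j => mul_nonneg (hSp i).le (hSp j).le, hTp,
    fun T' hT' => by rw [hobj, hobj]; exact hTmin T' hT'⟩
  have hThT : Th = T := hTh T hsol fun T' hT' =>
    penLogDet_minimizer_unique S (fun i j => (by positivity : 0 ≤ κ⁻¹ / 2).trans (hwl i j)) hlam.le hTp
      hT'.2.1 hTmin fun T'' hT'' => by
        rw [← hobj, ← hobj]; exact hT'.2.2 T'' hT''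
  rw [hThT]
  have hdiff : ∀ i j, |(T₀ - Sg⁻¹) i j| ≤ 6 * κ * δ * |Sg⁻¹ i j| := fun i j => by
    rw [Matrix.sub_apply, hT₀e]
    have : (q i)⁻¹ * Sg⁻¹ i j * (q j)⁻¹ - Sg⁻¹ i j = ((q i)⁻¹ * (q j)⁻¹ - 1) * Sg⁻¹ i j := by ring
    rw [this, abs_mul]
    exact mul_le_mul_of_nonneg_right (hqinv i j) (abs_nonneg _)
  have hδl : κ * δ ≤ lam / 16 := by
    have : κ * δ ≤ κ ^ 3 * δ := by
      apply mul_le_mul_of_nonneg_right _ hδ0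
      nlinarith [mul_nonneg hκ0.le (by linarith : (0:ℝ) ≤ κ - 1), sq_nonneg (κ - 1)]
    linarith
  have hsplit : ∀ i j, (T - Sg⁻¹) i j = (T - T₀) i j + (T₀ - Sg⁻¹) i j := fun i j => by
    simp only [Matrix.sub_apply]; ring
  have hκ35 : κ ^ 3 ≤ κ ^ 5 := pow_le_pow_right₀ hκ (by norm_num)
  have hκ15 : κ ≤ κ ^ 5 := le_self_pow₀ hκ (by norm_num)
  have hsNN : Real.sqrt N ≤ N := by nlinarith
  constructor
  · intro i
    -- The diagonal entry is controlled by the Frobenius radius and the others by the penalty, whose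
    -- weights are at least `κ⁻¹ / 2`.
    have h1 : ∑ j, |(T - T₀) i j| ≤ ρ + 2 * κ * offPenalty w (T - T₀) := by
      rw [← Finset.add_sum_erase _ _ (Finset.mem_univ i)]
      refine add_le_add (abs_le_of_sq_le_sq ((sq_entry_le_frobSq _ i i).trans hTf) hρ0.le) ?_
      have h2 : ∑ j, (if i ≠ j then w i j * |(T - T₀) i j| else 0) ≤ offPenalty w (T - T₀) :=
        Finset.single_le_sum (f := fun i => ∑ j, if i ≠ j then w i j * |(T - T₀) i j| else 0)
          (fun k _ => Finset.sum_nonneg fun j _ => by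
            split_ifs
            · exact mul_nonneg (Real.sqrt_nonneg _) (abs_nonneg _)
            · exact le_rfl) (Finset.mem_univ i)
      refine le_trans ?_ (mul_le_mul_of_nonneg_left h2 (by positivity))
      rw [Finset.mul_sum, ← Finset.add_sum_erase _ _ (Finset.mem_univ i)]
      simp only [ne_eq, not_true_eq_false, if_false, mul_zero, zero_add]
      refine Finset.sum_le_sum fun j hj => ?_
      have hij : ¬ i = j := fun h => (Finset.mem_erase.1 hj).1 h.symm
      simp only [hij, not_false_eq_true, if_true]
      calc |(T - T₀) i j| = 2 * κ * (κ⁻¹ / 2 * |(T - T₀) i j|) := by field_simp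
        _ ≤ _ := by gcongr; exact hwl i j
    have h2 : ∑ j, |(T₀ - Sg⁻¹) i j| ≤ 6 * κ * δ * L := by
      refine (Finset.sum_le_sum fun j _ => hdiff i j).trans ?_
      rw [← Finset.mul_sum]
      exact mul_le_mul_of_nonneg_left (hL i) (by positivity)
    calc ∑ j, |(T - Sg⁻¹) i j| ≤ ∑ j, (|(T - T₀) i j| + |(T₀ - Sg⁻¹) i j|) :=
          Finset.sum_le_sum fun j _ => by rw [hsplit]; exact abs_add_le _ _
      _ = ∑ j, |(T - T₀) i j| + ∑ j, |(T₀ - Sg⁻¹) i j| := Finset.sum_add_distrib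
      _ ≤ (ρ + 2 * κ * (4 * (2 * κ * Real.sqrt N * ρ))) + 6 * (lam / 16) * (2 * κ * Real.sqrt N) := by
          refine add_le_add (h1.trans ?_) (h2.trans ?_)
          · gcongr
          · have hL0 : 0 ≤ L := (Finset.sum_nonneg fun _ _ => abs_nonneg _).trans (hL i)
            have : 6 * κ * δ ≤ 6 * (lam / 16) := by linarith
            exact mul_le_mul this hLN hL0 (by positivity)
      _ = 104 * κ ^ 3 * Real.sqrt N * lam + 1664 * κ ^ 5 * Real.sqrt N ^ 2 * lam
          + 3 / 4 * κ * Real.sqrt N * lam := by rw [hρ]; ring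
      _ ≤ 104 * κ ^ 5 * N * lam + 1664 * κ ^ 5 * N * lam + 3 / 4 * κ ^ 5 * N * lam := by
          rw [hsN]; gcongr
      _ ≤ 2000 * κ ^ 5 * N * lam := by
          have : 0 ≤ κ ^ 5 * N * lam := by positivity
          linarith
  · intro i
    have h1 : ∑ j, (T - T₀) i j ^ 2 ≤ ρ ^ 2 := (row_sq_le_frobSq _ i).trans hTf
    have h2 : ∑ j, (T₀ - Sg⁻¹) i j ^ 2 ≤ (6 * (lam / 16)) ^ 2 * κ ^ 2 := by
      have h3 := sum_row_sq_le hSg.inv.posSemidef hκ0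
        (fun v => by simpa using inv_qf_le hSg (inv_pos.2 hκ0) hlow v) i
      refine le_trans ?_ (mul_le_mul_of_nonneg_left h3 (sq_nonneg _))
      rw [Finset.mul_sum]
      refine Finset.sum_le_sum fun j _ => ?_
      rw [← sq_abs ((T₀ - Sg⁻¹) i j), ← sq_abs (Sg⁻¹ i j), ← mul_pow]
      refine pow_le_pow_left₀ (abs_nonneg _) ((hdiff i j).trans ?_) 2
      exact mul_le_mul_of_nonneg_right (by linarith) (abs_nonneg _)
    calc ∑ j, (T - Sg⁻¹) i j ^ 2 ≤ ∑ j, (2 * (T - T₀) i j ^ 2 + 2 * (T₀ - Sg⁻¹) i j ^ 2) :=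
          Finset.sum_le_sum fun j _ => by
            rw [hsplit]
            nlinarith [sq_nonneg ((T - T₀) i j - (T₀ - Sg⁻¹) i j)]
      _ = 2 * ∑ j, (T - T₀) i j ^ 2 + 2 * ∑ j, (T₀ - Sg⁻¹) i j ^ 2 := by
          rw [Finset.sum_add_distrib, Finset.mul_sum, Finset.mul_sum]
      _ ≤ 2 * ρ ^ 2 + 2 * ((6 * (lam / 16)) ^ 2 * κ ^ 2) := by gcongr
      _ ≤ _ := by
          have e1 : κ ^ 2 ≤ κ ^ 6 := pow_le_pow_right₀ hκ (by norm_num)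
          have e2 : lam ^ 2 * κ ^ 2 ≤ lam ^ 2 * κ ^ 6 * Real.sqrt N ^ 2 := by
            calc lam ^ 2 * κ ^ 2 ≤ lam ^ 2 * κ ^ 6 := by gcongr
              _ ≤ _ := le_mul_of_one_le_right (by positivity) (by nlinarith)
          have e3 : 0 ≤ lam ^ 2 * κ ^ 6 * Real.sqrt N ^ 2 := by positivity
          have e4 : 2 * ρ ^ 2 + 2 * ((6 * (lam / 16)) ^ 2 * κ ^ 2)
              = 21632 * (lam ^ 2 * κ ^ 6 * Real.sqrt N ^ 2) + 9 / 32 * (lam ^ 2 * κ ^ 2) := by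
            rw [hρ]; ring
          have e5 : (150 * κ ^ 3 * Real.sqrt N * lam) ^ 2
              = 22500 * (lam ^ 2 * κ ^ 6 * Real.sqrt N ^ 2) := by ring
          rw [e4, e5]
          linarith

end GlassoRate

/-! ### Entrywise bounds for de-biasing and for the factor effect. -/

section EntryBounds

variable {d r : ℕ}

lemma abs_mul_mul_entry_le {l k p q : Type*} [Fintype k] [Fintype p] {A : Matrix l k ℝ}
    {E : Matrix k p ℝ} {B : Matrix p q ℝ} {a δ b : ℝ} (ha : ∀ i, ∑ j, |A i j| ≤ a)
    (hE : ∀ i j, |E i j| ≤ δ) (hb : ∀ j, ∑ i, |B i j| ≤ b) (hδ : 0 ≤ δ) (ha0 : 0 ≤ a)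
    (i : l) (j : q) : |(A * E * B) i j| ≤ a * δ * b := by
  have h1 : ∀ t, |(A * E) i t| ≤ a * δ := fun t => by
    rw [Matrix.mul_apply]
    calc _ ≤ ∑ s, |A i s * E s t| := Finset.abs_sum_le_sum_abs _ _
      _ ≤ ∑ s, |A i s| * δ := Finset.sum_le_sum fun s _ => by
          rw [abs_mul]; exact mul_le_mul_of_nonneg_left (hE s t) (abs_nonneg _)
      _ = (∑ s, |A i s|) * δ := (Finset.sum_mul _ _ _).symm
      _ ≤ _ := mul_le_mul_of_nonneg_right (ha i) hδ
  rw [Matrix.mul_apply]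
  calc _ ≤ ∑ t, |(A * E) i t * B t j| := Finset.abs_sum_le_sum_abs _ _
    _ ≤ ∑ t, (a * δ) * |B t j| := Finset.sum_le_sum fun t _ => by
        rw [abs_mul]; exact mul_le_mul_of_nonneg_right (h1 t) (abs_nonneg _)
    _ = (a * δ) * ∑ t, |B t j| := (Finset.mul_sum _ _ _).symm
    _ ≤ _ := mul_le_mul_of_nonneg_left (hb j) (by positivity)

lemma mul_mul_transpose_apply {l k : Type*} [Fintype k] (A B : Matrix l k ℝ) (M : Matrix k k ℝ)
    (i j : l) : (A * M * Bᵀ) i j = A i ⬝ᵥ M *ᵥ B j := by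
  rw [Matrix.mul_apply, Matrix.dotProduct_mulVec]
  simp only [dotProduct, Matrix.transpose_apply, Matrix.mul_apply, Matrix.vecMul]

lemma sum_abs_col_eq {ι : Type*} [Fintype ι] {A : Matrix ι ι ℝ} (hA : Aᵀ = A) (j : ι) :
    ∑ i, |A i j| = ∑ i, |A j i| :=
  Finset.sum_congr rfl fun i _ => by rw [← Matrix.transpose_apply A j i, hA]

/-- The Schur test for symmetric matrices. -/
lemma abs_qf_le_of_row_sum {ι : Type*} [Fintype ι] {A : Matrix ι ι ℝ} (hA : Aᵀ = A) {a : ℝ}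
    (ha : ∀ i, ∑ j, |A i j| ≤ a) (v : ι → ℝ) : |v ⬝ᵥ A *ᵥ v| ≤ a * (v ⬝ᵥ v) := by
  -- Each product `v i * v j` is replaced by the mean of the squares; symmetry then collects
  -- everything into row sums.
  have h1 : |v ⬝ᵥ A *ᵥ v| ≤ ∑ i, ∑ j, |A i j| * ((v i ^ 2 + v j ^ 2) / 2) := by
    simp only [dotProduct, Matrix.mulVec, Finset.mul_sum]
    refine (Finset.abs_sum_le_sum_abs _ _).trans (Finset.sum_le_sum fun i _ => ?_)
    refine (Finset.abs_sum_le_sum_abs _ _).trans (Finset.sum_le_sum fun j _ => ?_)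
    rw [mul_left_comm, abs_mul]
    refine mul_le_mul_of_nonneg_left ?_ (abs_nonneg _)
    rw [abs_mul]
    nlinarith [sq_nonneg (|v i| - |v j|), sq_abs (v i), sq_abs (v j)]
  have h2 : ∑ i, ∑ j, |A i j| * ((v i ^ 2 + v j ^ 2) / 2)
      = ∑ i, (∑ j, |A i j|) * v i ^ 2 := by
    have e1 : ∑ i, ∑ j, |A i j| * ((v i ^ 2 + v j ^ 2) / 2)
        = (∑ i, ∑ j, |A i j| * v i ^ 2) / 2 + (∑ i, ∑ j, |A i j| * v j ^ 2) / 2 := by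
      rw [Finset.sum_div, Finset.sum_div, ← Finset.sum_add_distrib]
      refine Finset.sum_congr rfl fun i _ => ?_
      rw [Finset.sum_div, Finset.sum_div, ← Finset.sum_add_distrib]
      exact Finset.sum_congr rfl fun j _ => by ring
    have e2 : ∑ i, ∑ j, |A i j| * v j ^ 2 = ∑ i, ∑ j, |A i j| * v i ^ 2 := by
      rw [Finset.sum_comm]
      refine Finset.sum_congr rfl fun i _ => Finset.sum_congr rfl fun j _ => ?_
      rw [← Matrix.transpose_apply A i j, hA]
    rw [e1, e2, add_halves]
    exact Finset.sum_congr rfl fun i _ => (Finset.sum_mul _ _ _).symm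
  rw [h2] at h1
  refine h1.trans ?_
  rw [dotProduct, Finset.mul_sum]
  refine Finset.sum_le_sum fun i _ => ?_
  rw [← sq]
  exact mul_le_mul_of_nonneg_right (ha i) (sq_nonneg _)

/-- The expansion of the de-biased estimator of a precision matrix, with `F` a perturbation of the
covariance estimator which is put into the remainder. -/
lemma debiased_remainder_le {ι : Type*} [Fintype ι] [DecidableEq ι] {Sg S F T : Matrix ι ι ℝ}
    (hSg : Sg.PosDef)
    (hTs : Tᵀ = T) {κ δ φ L l h : ℝ} (hκ : 0 < κ) (hδ0 : 0 ≤ δ) (hφ0 : 0 ≤ φ) (hL0 : 0 ≤ L)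
    (hl0 : 0 ≤ l) (hh0 : 0 ≤ h)
    (hup : ∀ v : ι → ℝ, v ⬝ᵥ Sg *ᵥ v ≤ κ * (v ⬝ᵥ v))
    (hL : ∀ i, ∑ j, |Sg⁻¹ i j| ≤ L) (hl : ∀ i, ∑ j, |(T - Sg⁻¹) i j| ≤ l)
    (hh : ∀ i, ∑ j, (T - Sg⁻¹) i j ^ 2 ≤ h ^ 2)
    (hE : ∀ i j, |(S - Sg) i j| ≤ δ) (hF : ∀ i j, |F i j| ≤ φ) (i j : ι) :
    |(T + T - T * S * T - Sg⁻¹ + Sg⁻¹ * (S + F - Sg) * Sg⁻¹) i j|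
      ≤ 2 * (l * δ * L) + l * δ * l + κ * (h * h) + L * φ * L := by
  set Th := Sg⁻¹ with hTh
  set D := T - Th with hD
  set E := S - Sg with hEdef
  have hThs : Thᵀ = Th := hSg.inv.transpose_eq
  have hDs : Dᵀ = D := by rw [hD, Matrix.transpose_sub, hTs, hThs]
  have h1 : Th * Sg = 1 := hSg.inv_mul_cancel'
  have h2 : Sg * Th = 1 := hSg.mul_inv_cancel'
  have hT : T = Th + D := by rw [hD]; abel
  have hS : S = Sg + E := by rw [hEdef]; abel
  -- This cancellation is the purpose of de-biasing: `Θ Σ = 1` removes the terms linear in `D`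
  -- alone. The part `D Σ Dᵀ` is kept apart because Euclidean row bounds suffice for it, whereas
  -- `ℓ_1` bounds would cost too much.
  have hid : T + T - T * S * T - Th + Th * (S + F - Sg) * Th
      = Th * F * Th - D * E * Th - Th * E * D - D * E * D - D * Sg * Dᵀ := by
    rw [hDs, hT, hS]
    have e1 : (Th + D) * (Sg + E) * (Th + D) = Th * Sg * Th + Th * Sg * D + D * (Sg * Th)
        + D * Sg * D + Th * E * Th + Th * E * D + D * E * Th + D * E * D := by noncomm_ring
    have e2 : Sg + E + F - Sg = E + F := by abel
    rw [e1, e2, h1, h2]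
    noncomm_ring
  rw [hid]
  have hcol : ∀ j, ∑ i, |Th i j| ≤ L := fun j => by rw [sum_abs_col_eq hThs]; exact hL j
  have hcolD : ∀ j, ∑ i, |D i j| ≤ l := fun j => by rw [sum_abs_col_eq hDs]; exact hl j
  have b1 := abs_mul_mul_entry_le hL hF hcol hφ0 hL0 i j
  have b2 := abs_mul_mul_entry_le hl hE hcol hδ0 hl0 i j
  have b3 := abs_mul_mul_entry_le hL hE hcolD hδ0 hL0 i j
  have b4 := abs_mul_mul_entry_le hl hE hcolD hδ0 hl0 i j
  have hrow : ∀ i, D i ⬝ᵥ D i ≤ h ^ 2 := fun i => by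
    have := hh i; simpa [dotProduct, sq] using this
  have b5 : |(D * Sg * Dᵀ) i j| ≤ κ * (h * h) := by
    rw [mul_mul_transpose_apply]
    exact abs_dotProduct_mulVec_le hSg.posSemidef hκ hup hh0 hh0 (hrow i) (hrow j)
  simp only [Matrix.sub_apply]
  rw [abs_le] at *
  constructor <;> nlinarith [b1.1, b1.2, b2.1, b2.2, b3.1, b3.2, b4.1, b4.2, b5.1, b5.2]

/-- With pervasive loadings, adding the factor part to a covariance matrix has an effect of order
`1 / d` on the entries of the precision matrix. -/
lemma factor_effect_le {T : Matrix (Fin d) (Fin d) ℝ} {b : Matrix (Fin d) (Fin r) ℝ}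
    {X : Matrix (Fin r) (Fin r) ℝ} (hT : T.PosDef) (hX : X.PosDef) {L k c c₀ : ℝ}
    (hd : 0 < d) (hc : 0 < c) (hc₀ : 0 < c₀) (hL0 : 0 ≤ L) (hk : 0 ≤ k)
    (hL : ∀ i, ∑ j, |T i j| ≤ L)
    (hb : ∀ i j, |b i j| ≤ k) (hlow : ∀ v : Fin d → ℝ, c * (v ⬝ᵥ v) ≤ v ⬝ᵥ T *ᵥ v)
    (hbl : ∀ v : Fin r → ℝ, c₀ * d * (v ⬝ᵥ v) ≤ (b *ᵥ v) ⬝ᵥ (b *ᵥ v)) (i j : Fin d) :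
    |((b * X * bᵀ + T⁻¹)⁻¹ - T) i j| ≤ (c * c₀)⁻¹ * (L * k) ^ 2 * (r / d) := by
  have hd0 : (0 : ℝ) < d := by exact_mod_cast hd
  -- The core matrix of the Woodbury formula. Pervasive loadings give `M ≥ c c₀ d`, which is the
  -- source of the factor `1 / d`; the rows of `T * b` have norm at most `√r L k`.
  set M := X⁻¹ + bᵀ * T * b with hM
  have hMs : Mᵀ = M := by
    rw [hM, Matrix.transpose_add, hX.inv.transpose_eq, Matrix.transpose_mul, Matrix.transpose_mul,
      Matrix.transpose_transpose, hT.transpose_eq, Matrix.mul_assoc]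
  have hMl : ∀ v : Fin r → ℝ, c * c₀ * d * (v ⬝ᵥ v) ≤ v ⬝ᵥ M *ᵥ v := fun v => by
    have h1 := hX.inv.posSemidef.qf_nonneg v
    have h2 := hlow (b *ᵥ v)
    have h3 : v ⬝ᵥ (bᵀ * T * b) *ᵥ v = (b *ᵥ v) ⬝ᵥ T *ᵥ (b *ᵥ v) := by
      rw [← Matrix.mulVec_mulVec, ← Matrix.mulVec_mulVec, Matrix.dotProduct_mulVec v,
        Matrix.vecMul_transpose]
    rw [hM, Matrix.add_mulVec, dotProduct_add, h3]
    have h4 := mul_le_mul_of_nonneg_left (hbl v) hc.le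
    linarith
  have hpos : 0 < c * c₀ * d := by positivity
  have hMp : M.PosDef := posDef_of_lowerBound hMs hpos hMl
  have hwood : (b * X * bᵀ + T⁻¹)⁻¹ = T - T * b * M⁻¹ * bᵀ * T := by
    have h0 : X⁻¹ + bᵀ * T⁻¹⁻¹ * b = M := by rw [hT.inv_inv', hM]
    rw [add_comm, Matrix.add_mul_mul_inv_eq_sub _ _ _ _ hT.inv.isUnit hX.isUnit
      (by rw [h0]; exact hMp.isUnit), h0, hT.inv_inv']
  have hx : ∀ i, (T * b) i ⬝ᵥ (T * b) i ≤ (Real.sqrt r * (L * k)) ^ 2 := fun i => by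
    have he : ∀ t, ((T * b) i t) ^ 2 ≤ (L * k) ^ 2 := fun t => by
      rw [sq_le_sq, abs_of_nonneg (by positivity : 0 ≤ L * k), Matrix.mul_apply]
      calc _ ≤ ∑ s, |T i s * b s t| := Finset.abs_sum_le_sum_abs _ _
        _ ≤ ∑ s, |T i s| * k := Finset.sum_le_sum fun s _ => by
            rw [abs_mul]; exact mul_le_mul_of_nonneg_left (hb s t) (abs_nonneg _)
        _ = (∑ s, |T i s|) * k := (Finset.sum_mul _ _ _).symm
        _ ≤ _ := mul_le_mul_of_nonneg_right (hL i) hk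
    calc _ = ∑ t, ((T * b) i t) ^ 2 := by simp [dotProduct, sq]
      _ ≤ ∑ _t : Fin r, (L * k) ^ 2 := Finset.sum_le_sum fun t _ => he t
      _ = _ := by
        rw [mul_pow (Real.sqrt r), Real.sq_sqrt (Nat.cast_nonneg _)]; simp
  have hent : ((b * X * bᵀ + T⁻¹)⁻¹ - T) i j = -((T * b) i ⬝ᵥ M⁻¹ *ᵥ (T * b) j) := by
    rw [hwood, ← mul_mul_transpose_apply, Matrix.transpose_mul, hT.transpose_eq,
      sub_sub_cancel_left, Matrix.neg_apply]
    simp only [Matrix.mul_assoc]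
  rw [hent, abs_neg]
  refine (abs_dotProduct_mulVec_le hMp.inv.posSemidef (inv_pos.2 hpos)
    (inv_qf_le hMp hpos hMl) (by positivity) (by positivity) (hx i) (hx j)).trans (le_of_eq ?_)
  have hr : Real.sqrt r * Real.sqrt r = r := Real.mul_self_sqrt (Nat.cast_nonneg _)
  calc _ = (c * c₀ * d)⁻¹ * (L * k) ^ 2 * (Real.sqrt r * Real.sqrt r) := by ring
    _ = _ := by rw [hr, mul_inv]; ring

end EntryBounds

/-! ### The linear expansion of the de-biased factor-based estimator. -/

section FactorExpansion

lemma frobSq_le_of_entry_le {l k : Type*} [Fintype l] [Fintype k] {A : Matrix l k ℝ} {e : ℝ}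
    (h : ∀ i j, |A i j| ≤ e) : frobSq A ≤ Fintype.card l * Fintype.card k * e ^ 2 := by
  calc frobSq A ≤ ∑ _i : l, ∑ _j : k, e ^ 2 :=
        Finset.sum_le_sum fun i _ => Finset.sum_le_sum fun j _ => sq_le_sq'
          (abs_le.1 (h i j)).1 (abs_le.1 (h i j)).2
    _ = _ := by simp; ring

lemma dotProduct_self_le_of_abs_le {k : Type*} [Fintype k] {x : k → ℝ} {e : ℝ}
    (h : ∀ j, |x j| ≤ e) : x ⬝ᵥ x ≤ Fintype.card k * e ^ 2 := by
  calc x ⬝ᵥ x ≤ ∑ _j : k, e ^ 2 := Finset.sum_le_sum fun j _ => by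
        rw [← sq]; exact sq_le_sq' (abs_le.1 (h j)).1 (abs_le.1 (h j)).2
    _ = _ := by simp

variable {Ω : Type*} [MeasurableSpace Ω] {d r : ℕ}

/-- The residual covariance estimator differs from the one with known loadings by a term which is
quadratic in the estimation error of the loadings. -/
lemma FactorEstimators.hSZ_add_eq_breveSZ (E : FactorEstimators Ω d r)
    (β : Matrix (Fin d) (Fin r) ℝ) {ω : Ω} (hX : (E.hSX ω).PosDef) :
    E.hSZ ω + (E.hSYX ω - β * E.hSX ω) * (E.hSX ω)⁻¹ * (E.hSYX ω - β * E.hSX ω)ᵀ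
      = E.breveSZ β ω := by
  have h1 := hX.mul_inv_cancel'
  have h2 := hX.inv_mul_cancel'
  have h3 := hX.transpose_eq
  have h4 := hX.inv.transpose_eq
  have hdag := E.hSXdag_eq ω hX.isUnit
  unfold hSZ breveSZ hβ
  rw [hdag]
  set X := E.hSX ω
  set U := E.hSYX ω
  rw [Matrix.transpose_sub, Matrix.transpose_mul, Matrix.transpose_mul, h3, h4]
  have e1 : U * X⁻¹ * X * (X⁻¹ * Uᵀ) = U * X⁻¹ * Uᵀ := by
    rw [Matrix.mul_assoc U, h2, Matrix.mul_one, Matrix.mul_assoc]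
  have e2 : (U - β * X) * X⁻¹ * (Uᵀ - X * βᵀ) = U * X⁻¹ * Uᵀ - U * (X⁻¹ * X) * βᵀ
      - β * (X * X⁻¹) * Uᵀ + β * (X * X⁻¹) * X * βᵀ := by
    simp only [Matrix.sub_mul, Matrix.mul_sub, Matrix.mul_assoc]
    abel
  rw [e1, e2, h1, h2, Matrix.mul_one, Matrix.mul_one]
  abel

/-- Deterministic bounds for the initial estimators under which the expansion of the de-biased
estimator holds. -/
structure GoodEvent (E : FactorEstimators Ω d r) (β : Matrix (Fin d) (Fin r) ℝ)
    (SX : Matrix (Fin r) (Fin r) ℝ) (SZ : Matrix (Fin d) (Fin d) ℝ) (s deg κ : ℝ) (ω : Ω) :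
    Prop where
  posDef_SX : SX.PosDef
  posDef_SZ : SZ.PosDef
  SX_lower : ∀ v : Fin r → ℝ, κ⁻¹ * (v ⬝ᵥ v) ≤ v ⬝ᵥ SX *ᵥ v
  SZ_lower : ∀ v : Fin d → ℝ, κ⁻¹ * (v ⬝ᵥ v) ≤ v ⬝ᵥ SZ *ᵥ v
  SZ_upper : ∀ v : Fin d → ℝ, v ⬝ᵥ SZ *ᵥ v ≤ κ * (v ⬝ᵥ v)
  β_le : ∀ i k, |β i k| ≤ κ
  β_lower : ∀ v : Fin r → ℝ, κ⁻¹ * d * (v ⬝ᵥ v) ≤ (β *ᵥ v) ⬝ᵥ (β *ᵥ v)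
  r_le : (r : ℝ) ≤ κ
  offDiagCount_le : (offDiagCount SZ⁻¹ : ℝ) ≤ κ * s
  maxDegree_le : (maxDegree SZ⁻¹ : ℝ) ≤ κ * deg
  hSX_close : ∀ i j, 4000 * κ ^ 7 * |(E.hSX ω - SX) i j| ≤ E.lam ω
  hSYX_close : ∀ i j, 4000 * κ ^ 7 * |(E.hSYX ω - β * E.hSX ω) i j| ≤ E.lam ω
  breveSZ_close : ∀ i j, 4000 * κ ^ 7 * |(E.breveSZ β ω - SZ) i j| ≤ E.lam ω
  lam_small : 4000 * κ ^ 7 * ((s + r) * E.lam ω) ≤ 1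

set_option maxHeartbeats 2000000 in
/-- On the good event, the de-biased factor-based estimator of the precision matrix admits a linear
expansion in the estimator with known loadings. -/
theorem GoodEvent.expansion {E : FactorEstimators Ω d r} {β : Matrix (Fin d) (Fin r) ℝ}
    {SX : Matrix (Fin r) (Fin r) ℝ} {SZ : Matrix (Fin d) (Fin d) ℝ} {s deg κ : ℝ} {ω : Ω}
    (h : GoodEvent E β SX SZ s deg κ ω) (hκ : 1 ≤ κ) (hs : 1 ≤ s) (hdeg : 1 ≤ deg) (hd : 0 < d)
    (i j : Fin d) :
    |((E.hSYlam ω)⁻¹ - E.ΓZ ω - (β * SX * βᵀ + SZ)⁻¹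
        + SZ⁻¹ * (E.breveSZ β ω - SZ) * SZ⁻¹) i j|
      ≤ 40000 * κ ^ 8 * (s * Real.sqrt deg * E.lam ω ^ 2) + 300 * κ ^ 8 * (deg * r / d) := by
  obtain ⟨hXp, hZp, hXl, hZl, hZu, hβ, hβl, hr, hN, hD, hcX, hcYX, hcZ, hlam⟩ := h
  have hκ0 : 0 < κ := by linarith
  set lam := E.lam ω with hlamdef
  have hlam0 : 0 < lam := E.lam_pos ω
  have hr0 : (0 : ℝ) ≤ r := Nat.cast_nonneg r
  have hd0 : (0 : ℝ) < d := by exact_mod_cast hd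
  -- The constant is exactly what brings the row-sum rate `l = 2000 κ⁶ s lam` below `(2κ)⁻¹`; the
  -- other smallness conditions follow through `hεk`.
  set ε := (4000 * κ ^ 7)⁻¹ with hε
  have hε0 : 0 < ε := by positivity
  have hK : 4000 * κ ^ 7 * ε = 1 := mul_inv_cancel₀ (by positivity)
  have pw : ∀ a b : ℕ, a ≤ b → κ ^ a ≤ κ ^ b := fun a b hab => pow_le_pow_right₀ hκ hab
  have pw1 : ∀ a : ℕ, 1 ≤ κ ^ a := fun a => one_le_pow₀ hκ
  have hεk : ∀ a : ℕ, a ≤ 7 → 4000 * κ ^ a * ε ≤ 1 := fun a ha => by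
    rw [← hK]; gcongr
  have hdiv : ∀ {x y : ℝ}, 4000 * κ ^ 7 * x ≤ y → x ≤ ε * y := fun {x y} hxy => by
    rw [hε, ← div_eq_inv_mul, le_div_iff₀ (by positivity)]
    linarith
  have hcX' := fun i j => hdiv (hcX i j)
  have hcYX' := fun i j => hdiv (hcYX i j)
  have hcZ' := fun i j => hdiv (hcZ i j)
  have hlam' : (s + r) * lam ≤ ε := by simpa using hdiv hlam
  have hslam : s * lam ≤ ε := by nlinarith
  have hrlam : r * lam ≤ ε := by nlinarith
  have hlamε : lam ≤ ε := by nlinarith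
  have hε1 : 4000 * ε ≤ 1 := by simpa using hεk 0 (by norm_num)
  have hεκ : ε * 1 ≤ (2 * κ)⁻¹ := by
    rw [mul_one, ← one_div, le_div_iff₀ (by positivity)]
    have := hεk 1 (by norm_num)
    rw [pow_one] at this
    nlinarith [mul_pos hκ0 hε0]
  -- the factor covariance estimator
  have hXhp : ∀ v : Fin r → ℝ, (2 * κ)⁻¹ * (v ⬝ᵥ v) ≤ v ⬝ᵥ E.hSX ω *ᵥ v := by
    intro v
    have h1 : frobSq (E.hSX ω - SX) ≤ (r * (ε * lam)) ^ 2 := by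
      refine (frobSq_le_of_entry_le hcX').trans (le_of_eq ?_)
      rw [Fintype.card_fin]; ring
    have h2 := (abs_le.1 (abs_qf_le_of_frobSq (by positivity) h1 v)).1
    have h3 := hXl v
    rw [Matrix.sub_mulVec, dotProduct_sub] at h2
    have h4 : r * (ε * lam) ≤ (2 * κ)⁻¹ := by
      calc r * (ε * lam) = ε * (r * lam) := by ring
        _ ≤ ε * ε := by gcongr
        _ ≤ ε * 1 := by gcongr; linarith
        _ ≤ (2 * κ)⁻¹ := hεκ
    have h5 := mul_le_mul_of_nonneg_right h4 (dotProduct_self_nonneg' v)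
    have h6 : κ⁻¹ = (2 * κ)⁻¹ + (2 * κ)⁻¹ := by field_simp; norm_num
    rw [h6] at h3
    linarith
  have hXh : (E.hSX ω).PosDef :=
    posDef_of_lowerBound (E.posSemidef_hSX ω).transpose_eq (by positivity) hXhp
  have hdag := E.hSXdag_eq ω hXh.isUnit
  have hXhi := inv_qf_le hXh (by positivity) hXhp
  simp only [inv_inv] at hXhi
  -- the loadings
  set U := E.hSYX ω - β * E.hSX ω with hU
  have hUrow : ∀ i, U i ⬝ᵥ U i ≤ (κ * (ε * lam)) ^ 2 := fun i => by
    refine (dotProduct_self_le_of_abs_le (hcYX' i)).trans ?_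
    rw [Fintype.card_fin, mul_pow κ]
    have hr2 : (r : ℝ) ≤ κ ^ 2 := by
      rw [sq]
      exact hr.trans (le_mul_of_one_le_left hκ0.le hκ)
    exact mul_le_mul_of_nonneg_right hr2 (sq_nonneg _)
  have hκlam : κ * lam ≤ 1 := by
    have := hεk 1 (by norm_num)
    rw [pow_one] at this
    nlinarith [mul_pos hκ0 hε0, mul_le_mul_of_nonneg_left hlamε hκ0.le]
  have hβdiff : ∀ i k, |(E.hβ ω - β) i k| ≤ 2 * κ * ε := by
    intro i k
    have h1 : E.hβ ω - β = U * (E.hSX ω)⁻¹ := by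
      unfold FactorEstimators.hβ
      rw [hdag, hU, Matrix.sub_mul, Matrix.mul_assoc β, hXh.mul_inv_cancel', Matrix.mul_one]
    have h2 : (U * (E.hSX ω)⁻¹) i k = U i ⬝ᵥ (E.hSX ω)⁻¹ *ᵥ Pi.single k 1 := by
      rw [Matrix.mul_apply, Matrix.mulVec_single_one]
      rfl
    rw [h1, h2]
    have h3 := abs_dotProduct_mulVec_le hXh.inv.posSemidef (by positivity) hXhi
      (by positivity) zero_le_one (hUrow i) (y := Pi.single k 1) (by simp)
    refine h3.trans ?_
    calc 2 * κ * (κ * (ε * lam) * 1) = 2 * κ * ε * (κ * lam) := by ring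
      _ ≤ 2 * κ * ε * 1 := by gcongr
      _ = _ := by ring
  have hβh : ∀ i k, |E.hβ ω i k| ≤ 2 * κ := by
    intro i k
    have h1 := hβdiff i k
    rw [Matrix.sub_apply] at h1
    have h2 := hβ i k
    have h3 : 2 * κ * ε ≤ κ := by nlinarith
    rw [abs_le] at *
    constructor <;> linarith
  -- By `‖w + u‖² ≥ ‖w‖² / 2 - ‖u‖²`, half of the lower bound for `β` survives and the estimation
  -- error consumes at most half of that, so `κ` becomes `4 * κ`.
  have hβhl : ∀ v : Fin r → ℝ, (4 * κ)⁻¹ * d * (v ⬝ᵥ v) ≤ (E.hβ ω *ᵥ v) ⬝ᵥ (E.hβ ω *ᵥ v) := by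
    intro v
    set w := β *ᵥ v with hw
    set u := (E.hβ ω - β) *ᵥ v with hu
    have e1 : E.hβ ω *ᵥ v = w + u := by
      rw [hw, hu, Matrix.sub_mulVec, add_sub_cancel]
    have e2 : (1 / 2) * (w ⬝ᵥ w) - u ⬝ᵥ u ≤ (w + u) ⬝ᵥ (w + u) := by
      have := dotProduct_self_nonneg' (w + (2 : ℝ) • u)
      simp only [add_dotProduct, dotProduct_add, smul_dotProduct, dotProduct_smul, smul_eq_mul,
        dotProduct_comm u w] at this ⊢
      linarith
    have e3 : u ⬝ᵥ u ≤ (4 * κ)⁻¹ * d * (v ⬝ᵥ v) := by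
      refine (mulVec_dotProduct_self_le_frobSq _ v).trans ?_
      refine mul_le_mul_of_nonneg_right ?_ (dotProduct_self_nonneg' v)
      refine (frobSq_le_of_entry_le hβdiff).trans ?_
      rw [Fintype.card_fin, Fintype.card_fin]
      have h1 : (r : ℝ) * (2 * κ * ε) ^ 2 ≤ (4 * κ)⁻¹ := by
        rw [← one_div, le_div_iff₀ (by positivity)]
        have h2 := hεk 2 (by norm_num)
        calc (r : ℝ) * (2 * κ * ε) ^ 2 * (4 * κ) ≤ κ * (2 * κ * ε) ^ 2 * (4 * κ) := by gcongr
          _ = 16 * (κ ^ 2 * ε) ^ 2 := by ring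
          _ ≤ 1 := by nlinarith [mul_pos (pow_pos hκ0 2) hε0]
      calc (d : ℝ) * r * (2 * κ * ε) ^ 2 = (r * (2 * κ * ε) ^ 2) * d := by ring
        _ ≤ (4 * κ)⁻¹ * d := by gcongr
    have e4 := hβl v
    have h6 : κ⁻¹ = 4 * (4 * κ)⁻¹ := by field_simp
    rw [h6] at e4
    rw [e1]
    linarith
  -- the residual covariance estimator
  set F := U * (E.hSX ω)⁻¹ * Uᵀ with hF
  have hbreve : E.hSZ ω + F = E.breveSZ β ω := E.hSZ_add_eq_breveSZ β hXh
  have hFb : ∀ i j, |F i j| ≤ 2 * κ ^ 3 * (ε * lam) ^ 2 := by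
    intro i j
    rw [hF, mul_mul_transpose_apply]
    refine (abs_dotProduct_mulVec_le hXh.inv.posSemidef (by positivity) hXhi
      (by positivity) (by positivity) (hUrow i) (hUrow j)).trans (le_of_eq ?_)
    ring
  set δ := 2 * (ε * lam) with hδ
  -- `F` is quadratic in the loading error, so replacing known by estimated loadings at most doubles
  -- the bound.
  have hE : ∀ i j, |(E.hSZ ω - SZ) i j| ≤ δ := by
    intro i j
    have h1 : (E.hSZ ω - SZ) i j = (E.breveSZ β ω - SZ) i j - F i j := by
      rw [← hbreve]
      simp only [Matrix.sub_apply, Matrix.add_apply]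
      ring
    rw [h1]
    refine (abs_sub _ _).trans ((add_le_add (hcZ' i j) (hFb i j)).trans ?_)
    have h2 := hεk 3 (by norm_num)
    have h3 : 2 * κ ^ 3 * (ε * lam) ≤ 1 := by
      calc 2 * κ ^ 3 * (ε * lam) = 2 * κ ^ 3 * ε * lam := by ring
        _ ≤ 1 * 1 := mul_le_mul (by nlinarith [mul_pos (pow_pos hκ0 3) hε0]) (by linarith) hlam0.le
            zero_le_one
        _ = 1 := one_mul 1
    have h4 : 0 < ε * lam := mul_pos hε0 hlam0
    rw [hδ]
    nlinarith
  -- the rates of the graphical Lasso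
  set L := min (Real.sqrt (2 * κ ^ 3 * deg)) (Real.sqrt (2 * κ ^ 3 * s)) with hL
  have hL0 : 0 ≤ L := le_min (Real.sqrt_nonneg _) (Real.sqrt_nonneg _)
  have hLrow : ∀ i, ∑ j, |SZ⁻¹ i j| ≤ L := by
    have h1 : ∀ i, ∑ j, SZ⁻¹ i j ^ 2 ≤ κ ^ 2 := sum_row_sq_le hZp.inv.posSemidef hκ0
      fun v => by simpa using inv_qf_le hZp (inv_pos.2 hκ0) hZl v
    have h2 : ∀ t : ℝ, 1 ≤ t → (maxDegree SZ⁻¹ : ℝ) ≤ κ * t → ∀ i,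
        ∑ j, |SZ⁻¹ i j| ≤ Real.sqrt (2 * κ ^ 3 * t) := fun t ht hm i => by
      apply Real.le_sqrt_of_sq_le
      refine (sum_row_abs_sq_le_maxDegree hZp.inv.transpose_eq h1 i).trans ?_
      calc ((maxDegree SZ⁻¹ : ℝ) + 1) * κ ^ 2 ≤ (κ * t + κ * t) * κ ^ 2 := by
            gcongr; nlinarith
        _ = _ := by ring
    exact fun i => le_min (h2 deg hdeg hD i)
      (h2 s hs (le_trans (by exact_mod_cast maxDegree_le_offDiagCount _) hN) i)
  have hLdeg : L ≤ 2 * κ ^ 2 * Real.sqrt deg := by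
    refine (min_le_left _ _).trans (Real.sqrt_le_iff.2 ⟨by positivity, ?_⟩)
    rw [mul_pow, Real.sq_sqrt (by linarith)]
    calc 2 * κ ^ 3 * deg ≤ 4 * κ ^ 4 * deg := by
          have := pw 3 4 (by norm_num)
          have : 0 ≤ κ ^ 4 := by positivity
          gcongr ?_ * deg
          linarith
      _ = _ := by ring
  have hLs : L ≤ 2 * κ * Real.sqrt (κ * s) := by
    refine (min_le_right _ _).trans (Real.sqrt_le_iff.2 ⟨by positivity, ?_⟩)
    rw [mul_pow, Real.sq_sqrt (by positivity)]
    have : 0 ≤ κ ^ 3 * s := by positivity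
    linarith
  -- One factor is bounded through the degree and the other through the sparsity. This yields `s
  -- √deg` for the term `L φ L`, although `deg` is not assumed to be bounded by `s`.
  have hLL : L * L ≤ 2 * κ ^ 3 * (s * Real.sqrt deg) := by
    have h1 : L * L ≤ Real.sqrt (2 * κ ^ 3 * deg) * Real.sqrt (2 * κ ^ 3 * s) :=
      mul_le_mul (min_le_left _ _) (min_le_right _ _) hL0 (Real.sqrt_nonneg _)
    have h2 : Real.sqrt s ≤ s := Real.sqrt_le_iff.2 ⟨by linarith, by nlinarith⟩
    refine h1.trans ?_
    rw [Real.sqrt_mul (by positivity : 0 ≤ 2 * κ ^ 3) deg,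
      Real.sqrt_mul (by positivity : 0 ≤ 2 * κ ^ 3) s]
    calc _ = (Real.sqrt (2 * κ ^ 3) * Real.sqrt (2 * κ ^ 3)) * (Real.sqrt s * Real.sqrt deg) := by
          ring
      _ = 2 * κ ^ 3 * (Real.sqrt s * Real.sqrt deg) := by
          rw [Real.mul_self_sqrt (by positivity)]
      _ ≤ _ := by gcongr
  have hcond1 : 16 * κ ^ 3 * δ ≤ lam := by
    have h2 := hεk 3 (by norm_num)
    calc 16 * κ ^ 3 * δ = (32 * κ ^ 3 * ε) * lam := by rw [hδ]; ring
      _ ≤ 1 * lam := by gcongr; nlinarith [mul_pos (pow_pos hκ0 3) hε0]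
      _ = lam := one_mul _
  have hcond2 : 2 * κ * δ ≤ 1 := by
    calc 2 * κ * δ = 4 * ε * (κ * lam) := by rw [hδ]; ring
      _ ≤ 1 * 1 := mul_le_mul (by linarith) hκlam (by positivity) zero_le_one
      _ = 1 := one_mul 1
  have hcond3 : 210 * κ ^ 4 * lam * Real.sqrt (κ * s) < 1 := by
    have h1 : Real.sqrt (κ * s) ≤ κ * s :=
      Real.sqrt_le_iff.2 ⟨by positivity, by nlinarith [mul_le_mul hκ hs zero_le_one hκ0.le]⟩
    have h2 := hεk 5 (by norm_num)
    calc 210 * κ ^ 4 * lam * Real.sqrt (κ * s) ≤ 210 * κ ^ 4 * lam * (κ * s) := by gcongr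
      _ = 210 * κ ^ 5 * (s * lam) := by ring
      _ ≤ 210 * κ ^ 5 * ε := by gcongr
      _ < 1 := by nlinarith [mul_pos (pow_pos hκ0 5) hε0]
  obtain ⟨hl, hh⟩ := glasso_rate (S := E.hSZ ω) (Th := E.hΘZ ω) (lam := lam) (N := κ * s) (δ := δ)
    hZp hκ hZl hZu (by nlinarith) hN hlam0 hE
    hcond1 hcond2 hcond3 hLrow hLs
    (fun T hT hT' => E.hΘZ_eq ω T hT hT')
  set l := 2000 * κ ^ 5 * (κ * s) * lam with hldef
  have hTp := E.posDef_hΘZ ω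
  have hl0 : 0 ≤ l := by positivity
  have hl1 : l ≤ (2 * κ)⁻¹ := by
    rw [← one_div, le_div_iff₀ (by positivity)]
    calc l * (2 * κ) = 4000 * κ ^ 7 * (s * lam) := by rw [hldef]; ring
      _ ≤ 4000 * κ ^ 7 * ε := by gcongr
      _ = 1 := hK
  have hl1' : l ≤ 1 := hl1.trans (inv_le_one_of_one_le₀ (by linarith))
  have hsdeg : 1 ≤ Real.sqrt deg := Real.one_le_sqrt.2 hdeg
  have hTrow : ∀ i, ∑ j, |E.hΘZ ω i j| ≤ 3 * κ ^ 2 * Real.sqrt deg := by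
    intro i
    have h1 : ∑ j, |E.hΘZ ω i j| ≤ ∑ j, (|SZ⁻¹ i j| + |(E.hΘZ ω - SZ⁻¹) i j|) :=
      Finset.sum_le_sum fun j _ => by
        refine le_trans (le_of_eq ?_) (abs_add_le _ _)
        rw [Matrix.sub_apply, add_sub_cancel]
    rw [Finset.sum_add_distrib] at h1
    have h2 : 1 ≤ κ ^ 2 * Real.sqrt deg := by nlinarith [pw1 2]
    linarith [hLrow i, hl i]
  -- The Schur test turns the row-sum rate into an operator bound, which costs at most half of the
  -- lower bound `κ⁻¹` of the target.
  have hTl : ∀ v : Fin d → ℝ, (2 * κ)⁻¹ * (v ⬝ᵥ v) ≤ v ⬝ᵥ E.hΘZ ω *ᵥ v := by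
    intro v
    have h1 := le_inv_qf hZp hκ0 hZu v
    have hs' : (E.hΘZ ω - SZ⁻¹)ᵀ = E.hΘZ ω - SZ⁻¹ := by
      rw [Matrix.transpose_sub, hTp.transpose_eq, hZp.inv.transpose_eq]
    have h2 := (abs_le.1 (abs_qf_le_of_row_sum hs' hl v)).1
    rw [Matrix.sub_mulVec, dotProduct_sub] at h2
    have h5 := mul_le_mul_of_nonneg_right hl1 (dotProduct_self_nonneg' v)
    have h6 : κ⁻¹ = (2 * κ)⁻¹ + (2 * κ)⁻¹ := by field_simp; norm_num
    rw [h6] at h1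
    linarith
  -- the factor parts
  have hf1 := factor_effect_le (T := SZ⁻¹) (b := β) (X := SX) hZp.inv hXp hd (inv_pos.2 hκ0)
    (inv_pos.2 hκ0) hL0 hκ0.le hLrow hβ (le_inv_qf hZp hκ0 hZu) hβl i j
  have hf2 := factor_effect_le (T := E.hΘZ ω) (b := E.hβ ω) (X := E.hSX ω) hTp hXh hd
    (c := (2 * κ)⁻¹) (c₀ := (4 * κ)⁻¹) (by positivity) (by positivity)
    (by positivity) (by positivity) hTrow hβh hTl hβhl i j
  rw [hZp.inv_inv'] at hf1
  have hrem := debiased_remainder_le hZp hTp.transpose_eq hκ0 (by positivity : 0 ≤ δ)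
    (by positivity : 0 ≤ 2 * κ ^ 3 * (ε * lam) ^ 2) hL0 hl0
    (by positivity : 0 ≤ 150 * κ ^ 3 * Real.sqrt (κ * s) * lam) hZu hLrow hl hh hE hFb i j
  -- Estimated factor effect, true factor effect, and the de-biased remainder for the residual part.
  -- Since `Γ_Z` contains `-Θ̂`, subtracting it and splitting off a further `Θ̂` produces the two
  -- copies of `Θ̂` in the last group.
  have hsplit : (E.hSYlam ω)⁻¹ - E.ΓZ ω - (β * SX * βᵀ + SZ)⁻¹
        + SZ⁻¹ * (E.breveSZ β ω - SZ) * SZ⁻¹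
      = ((E.hβ ω * E.hSX ω * (E.hβ ω)ᵀ + (E.hΘZ ω)⁻¹)⁻¹ - E.hΘZ ω)
        - ((β * SX * βᵀ + SZ)⁻¹ - SZ⁻¹)
        + (E.hΘZ ω + E.hΘZ ω - E.hΘZ ω * E.hSZ ω * E.hΘZ ω - SZ⁻¹
          + SZ⁻¹ * (E.hSZ ω + F - SZ) * SZ⁻¹) := by
    rw [hbreve]
    unfold FactorEstimators.hSYlam FactorEstimators.ΓZ
    abel
  rw [hsplit]
  have hrem' : 2 * (l * δ * L) + l * δ * l
      + κ * (150 * κ ^ 3 * Real.sqrt (κ * s) * lam * (150 * κ ^ 3 * Real.sqrt (κ * s) * lam))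
      + L * (2 * κ ^ 3 * (ε * lam) ^ 2) * L
      ≤ 40000 * κ ^ 8 * (s * Real.sqrt deg * lam ^ 2) := by
    have hY : 0 ≤ s * Real.sqrt deg * lam ^ 2 := by positivity
    have hδlam : δ ≤ lam := by rw [hδ]; nlinarith
    have h68 := pw 6 8 (by norm_num)
    have t1 : l * δ * L ≤ 4000 * κ ^ 8 * (s * Real.sqrt deg * lam ^ 2) := by
      calc l * δ * L ≤ l * lam * (2 * κ ^ 2 * Real.sqrt deg) := by gcongr
        _ = _ := by rw [hldef]; ring
    have t2 : l * δ * l ≤ 2000 * κ ^ 8 * (s * Real.sqrt deg * lam ^ 2) := by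
      calc l * δ * l ≤ l * lam * 1 := by gcongr
        _ = 2000 * κ ^ 6 * (s * 1 * lam ^ 2) := by rw [hldef]; ring
        _ ≤ _ := by gcongr
    have t3 : κ * (150 * κ ^ 3 * Real.sqrt (κ * s) * lam * (150 * κ ^ 3 * Real.sqrt (κ * s) * lam))
        ≤ 22500 * κ ^ 8 * (s * Real.sqrt deg * lam ^ 2) := by
      calc _ = 22500 * κ ^ 7 * lam ^ 2 * (Real.sqrt (κ * s) * Real.sqrt (κ * s)) := by ring
        _ = 22500 * κ ^ 8 * (s * 1 * lam ^ 2) := by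
            rw [Real.mul_self_sqrt (by positivity)]; ring
        _ ≤ _ := by gcongr
    have t4 : L * (2 * κ ^ 3 * (ε * lam) ^ 2) * L ≤ 4 * κ ^ 8 * (s * Real.sqrt deg * lam ^ 2) := by
      calc L * (2 * κ ^ 3 * (ε * lam) ^ 2) * L = 2 * κ ^ 3 * (ε * lam) ^ 2 * (L * L) := by ring
        _ ≤ 2 * κ ^ 3 * (1 * lam) ^ 2 * (2 * κ ^ 3 * (s * Real.sqrt deg)) := by
            gcongr; linarith
        _ = 4 * κ ^ 6 * (s * Real.sqrt deg * lam ^ 2) := by ring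
        _ ≤ _ := by gcongr
    have hnn : 0 ≤ κ ^ 8 * (s * Real.sqrt deg * lam ^ 2) := by positivity
    linarith
  have hf1' : (κ⁻¹ * κ⁻¹)⁻¹ * (L * κ) ^ 2 * ((r : ℝ) / d) ≤ 4 * κ ^ 8 * (deg * r / d) := by
    calc (κ⁻¹ * κ⁻¹)⁻¹ * (L * κ) ^ 2 * ((r : ℝ) / d)
        ≤ (κ⁻¹ * κ⁻¹)⁻¹ * (2 * κ ^ 2 * Real.sqrt deg * κ) ^ 2 * ((r : ℝ) / d) := by gcongr
      _ = 4 * κ ^ 8 * (Real.sqrt deg ^ 2 * r / d) := by field_simp; ring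
      _ = _ := by rw [Real.sq_sqrt (by linarith)]
  have hf2' : ((2 * κ)⁻¹ * (4 * κ)⁻¹)⁻¹ * (3 * κ ^ 2 * Real.sqrt deg * (2 * κ)) ^ 2 * ((r : ℝ) / d)
      ≤ 290 * κ ^ 8 * (deg * r / d) := by
    calc _ = 288 * κ ^ 8 * (Real.sqrt deg ^ 2 * r / d) := by field_simp; ring
      _ = 288 * κ ^ 8 * (deg * r / d) := by rw [Real.sq_sqrt (by linarith)]
      _ ≤ _ := by gcongr; norm_num
  rw [Matrix.add_apply, Matrix.sub_apply]
  have hnn : 0 ≤ κ ^ 8 * (deg * r / d) := by positivity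
  have t1 := abs_add_le
    (((E.hβ ω * E.hSX ω * (E.hβ ω)ᵀ + (E.hΘZ ω)⁻¹)⁻¹ - E.hΘZ ω) i j
        - ((β * SX * βᵀ + SZ)⁻¹ - SZ⁻¹) i j)
    ((E.hΘZ ω + E.hΘZ ω - E.hΘZ ω * E.hSZ ω * E.hΘZ ω - SZ⁻¹
          + SZ⁻¹ * (E.hSZ ω + F - SZ) * SZ⁻¹) i j)
  have t2 := abs_sub (((E.hβ ω * E.hSX ω * (E.hβ ω)ᵀ + (E.hΘZ ω)⁻¹)⁻¹ - E.hΘZ ω) i j)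
    (((β * SX * βᵀ + SZ)⁻¹ - SZ⁻¹) i j)
  linarith

end FactorExpansion

/-! ### Quadratic covariation matrices and the decomposition of `Σ_Y`. -/

/-- Coordinatewise convergence in measure of finitely many coordinates is joint. -/
theorem tendstoInMeasure_pi {Ω ι κ : Type*} [MeasurableSpace Ω] {μ : Measure Ω} [Fintype ι]
    {l : Filter κ} {f : κ → Ω → ι → ℝ} {g : Ω → ι → ℝ}
    (h : ∀ a, TendstoInMeasure μ (fun n ω => f n ω a) l fun ω => g ω a) :
    TendstoInMeasure μ f l g := by
  intro ε hε
  have hsum : Tendsto (fun n => ∑ a, μ {ω | ε ≤ edist (f n ω a) (g ω a)}) l (𝓝 0) := by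
    simpa using tendsto_finsetSum Finset.univ fun a _ => h a ε hε
  refine tendsto_of_tendsto_of_tendsto_of_le_of_le tendsto_const_nhds hsum (fun _ => zero_le) ?_
  intro n
  refine (measure_mono fun ω hω => ?_).trans (measure_iUnion_fintype_le μ _)
  rw [Set.mem_ofPred_eq, edist_pi_def, Finset.le_sup_iff (by simpa using hε)] at hω
  obtain ⟨a, -, ha⟩ := hω
  exact Set.mem_iUnion.2 ⟨a, ha⟩

/-- The points `k / (N + 1)`, truncated at `1`. -/
def uniformPartition (N k : ℕ) : unitInterval :=
  Set.projIcc 0 1 zero_le_one ((k : ℝ) / (N + 1))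

/-- The sum of products of increments over the uniform partition into `N + 1` intervals. -/
def realizedCov {Ω : Type*} (U V : unitInterval → Ω → ℝ) (N : ℕ) (ω : Ω) : ℝ :=
  ∑ k ∈ Finset.range (N + 1),
    (U (uniformPartition N (k + 1)) ω - U (uniformPartition N k) ω) *
      (V (uniformPartition N (k + 1)) ω - V (uniformPartition N k) ω)

theorem realizedCov_comm {Ω : Type*} (U V : unitInterval → Ω → ℝ) (N : ℕ) (ω : Ω) :
    realizedCov U V N ω = realizedCov V U N ω :=
  Finset.sum_congr rfl fun _ _ => mul_comm _ _

theorem IsQuadCovariation.tendstoInMeasure {Ω : Type*} [MeasurableSpace Ω] {P : Measure Ω}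
    [IsFiniteMeasure P] {U V : unitInterval → Ω → ℝ} {Q : Ω → ℝ} (h : IsQuadCovariation P U V Q) :
    TendstoInMeasure P (realizedCov U V) atTop Q := by
  rw [tendstoInMeasure_iff_measureReal_norm]
  intro ε hε
  rw [Metric.tendsto_atTop]
  intro η hη
  -- The definition uses one number both as threshold and as probability bound; the minimum serves
  -- the two purposes at once.
  obtain ⟨δ, hδ, hh⟩ := h (min ε (η / 2)) (lt_min hε (half_pos hη))
  obtain ⟨N₀, hN₀⟩ := exists_nat_one_div_lt hδ
  refine ⟨N₀, fun N hN => ?_⟩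
  have hN1 : (0 : ℝ) < (N : ℝ) + 1 := by positivity
  have hmesh : (1 : ℝ) / (N + 1) ≤ δ := by
    refine (one_div_le_one_div_of_le (by positivity) ?_).trans hN₀.le
    exact_mod_cast Nat.succ_le_succ hN
  have hle := hh (N + 1) (uniformPartition N) ?_ ?_ ?_ ?_
  · rw [Real.dist_eq, sub_zero, abs_of_nonneg measureReal_nonneg]
    refine lt_of_le_of_lt (measureReal_mono fun ω hω => ?_)
      (hle.trans_lt ((min_le_right _ _).trans_lt (half_lt_self hη)))
    rw [Set.mem_ofPred_eq] at hω ⊢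
    exact (min_le_left _ _).trans hω
  · intro k l hkl
    refine Set.monotone_projIcc zero_le_one ?_
    gcongr
  · refine (Set.projIcc_of_le_left zero_le_one ?_).trans rfl
    simp
  · refine (Set.projIcc_of_right_le zero_le_one ?_).trans rfl
    rw [le_div_iff₀ hN1]
    simp
  · intro k hk
    have hk' : ((k : ℝ) + 1) ≤ N + 1 := by exact_mod_cast hk
    have hval : ∀ j : ℕ, (j : ℝ) ≤ N + 1 → (uniformPartition N j : ℝ) = j / (N + 1) := by
      intro j hj
      have hmem : (j : ℝ) / (N + 1) ∈ Set.Icc (0 : ℝ) 1 :=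
        ⟨by positivity, (div_le_one hN1).2 hj⟩
      simp [uniformPartition, Set.projIcc_of_mem zero_le_one hmem]
    rw [hval (k + 1) (by push_cast; exact hk'), hval k (by linarith)]
    push_cast
    rw [← sub_div, add_sub_cancel_left]
    exact hmesh

/-- The form is the sum of squared increments of the scalar process `∑ v i * U i`. Positivity passes
to the covariation matrices in the limit. -/
theorem realizedCov_qf_nonneg {Ω : Type*} {k : ℕ} (U : Fin k → unitInterval → Ω → ℝ) (N : ℕ)
    (ω : Ω) (v : Fin k → ℝ) :
    0 ≤ ∑ i, ∑ j, v i * realizedCov (U i) (U j) N ω * v j := by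
  have : ∑ i, ∑ j, v i * realizedCov (U i) (U j) N ω * v j =
      ∑ p ∈ Finset.range (N + 1), (∑ i, v i *
        (U i (uniformPartition N (p + 1)) ω - U i (uniformPartition N p) ω)) ^ 2 := by
    simp only [realizedCov, sq, Finset.sum_mul_sum]
    rw [Finset.sum_comm]
    simp only [Finset.mul_sum, Finset.sum_mul]
    rw [Finset.sum_comm]
    refine (Finset.sum_congr rfl fun i _ => Finset.sum_comm).trans ?_
    rw [Finset.sum_comm]
    refine Finset.sum_congr rfl fun p _ => ?_
    rw [Finset.sum_comm]
    exact Finset.sum_congr rfl fun i _ => Finset.sum_congr rfl fun j _ => by ring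
  rw [this]
  exact Finset.sum_nonneg fun _ _ => sq_nonneg _

namespace FactorModel

variable {Ω : Type*} [MeasurableSpace Ω] {P : Measure Ω} [IsFiniteMeasure P] {d r : ℕ}

/-- Along a common subsequence all realized covariations converge almost surely. -/
theorem exists_seq_realizedCov (M : FactorModel P d r) : ∃ ns : ℕ → ℕ, ∀ᵐ ω ∂P,
    (∀ i j, Tendsto (fun n => realizedCov (M.X i) (M.X j) (ns n) ω) atTop (𝓝 (M.SX ω i j))) ∧
    (∀ i j, Tendsto (fun n => realizedCov (M.Y i) (M.Y j) (ns n) ω) atTop (𝓝 (M.SY ω i j))) ∧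
    (∀ i j, Tendsto (fun n => realizedCov (M.Z i) (M.Z j) (ns n) ω) atTop (𝓝 (M.SZ ω i j))) ∧
    (∀ i j, Tendsto (fun n => realizedCov (M.Z i) (M.X j) (ns n) ω) atTop (𝓝 0)) := by
  -- All pairs of processes are gathered in one finite index type, so that a single extraction of a
  -- subsequence is enough.
  let ι := ((Fin r × Fin r) ⊕ (Fin d × Fin d)) ⊕ ((Fin d × Fin d) ⊕ (Fin d × Fin r))
  let f : ℕ → Ω → ι → ℝ := fun n ω => Sum.elim
    (Sum.elim (fun p => realizedCov (M.X p.1) (M.X p.2) n ω)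
      (fun p => realizedCov (M.Y p.1) (M.Y p.2) n ω))
    (Sum.elim (fun p => realizedCov (M.Z p.1) (M.Z p.2) n ω)
      (fun p => realizedCov (M.Z p.1) (M.X p.2) n ω))
  let g : Ω → ι → ℝ := fun ω => Sum.elim
    (Sum.elim (fun p => M.SX ω p.1 p.2) (fun p => M.SY ω p.1 p.2))
    (Sum.elim (fun p => M.SZ ω p.1 p.2) (fun _ => 0))
  have hfg : TendstoInMeasure P f atTop g := by
    refine tendstoInMeasure_pi ?_
    rintro ((p | p) | (p | p))
    · exact (M.covariation_X p.1 p.2).tendstoInMeasure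
    · exact (M.covariation_Y p.1 p.2).tendstoInMeasure
    · exact (M.covariation_Z p.1 p.2).tendstoInMeasure
    · exact (M.covariation_ZX p.1 p.2).tendstoInMeasure
  obtain ⟨ns, -, hns⟩ := hfg.exists_seq_tendsto_ae
  refine ⟨ns, hns.mono fun ω hω => ?_⟩
  rw [tendsto_pi_nhds] at hω
  exact ⟨fun i j => hω (.inl (.inl (i, j))), fun i j => hω (.inl (.inr (i, j))),
    fun i j => hω (.inr (.inl (i, j))), fun i j => hω (.inr (.inr (i, j)))⟩

omit [MeasurableSpace Ω] in
theorem posSemidef_of_tendsto_realizedCov {k : ℕ} {U : Fin k → unitInterval → Ω → ℝ}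
    {S : Matrix (Fin k) (Fin k) ℝ} {ns : ℕ → ℕ} {ω : Ω}
    (h : ∀ i j, Tendsto (fun n => realizedCov (U i) (U j) (ns n) ω) atTop (𝓝 (S i j))) :
    S.PosSemidef := by
  refine Matrix.PosSemidef.of_dotProduct_mulVec_nonneg ?_ fun v => ?_
  · ext i j
    refine tendsto_nhds_unique (h j i) ?_
    simpa only [realizedCov_comm] using h i j
  · have hlim : Tendsto (fun n => ∑ i, ∑ j, v i * realizedCov (U i) (U j) (ns n) ω * v j) atTop
        (𝓝 (∑ i, ∑ j, v i * S i j * v j)) :=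
      tendsto_finsetSum _ fun i _ => tendsto_finsetSum _ fun j _ =>
        ((h i j).const_mul _).mul_const _
    have := ge_of_tendsto' hlim fun n => realizedCov_qf_nonneg U (ns n) ω v
    simpa [dotProduct, Matrix.mulVec, Finset.mul_sum, mul_assoc] using this

/-- Almost sure limits of realized covariations are positive semidefinite, and invertibility
upgrades this to definiteness. -/
theorem ae_posDef_SX (M : FactorModel P d r) : ∀ᵐ ω ∂P, (M.SX ω).PosDef := by
  obtain ⟨ns, hns⟩ := M.exists_seq_realizedCov
  filter_upwards [hns, M.invertible_SX] with ω hω hi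
  exact (posSemidef_of_tendsto_realizedCov hω.1).posDef_iff_isUnit.2 hi

theorem ae_posDef_SZ (M : FactorModel P d r) : ∀ᵐ ω ∂P, (M.SZ ω).PosDef := by
  obtain ⟨ns, hns⟩ := M.exists_seq_realizedCov
  filter_upwards [hns, M.invertible_SZ] with ω hω hi
  exact (posSemidef_of_tendsto_realizedCov hω.2.2.1).posDef_iff_isUnit.2 hi

/-- `Σ_Y = β Σ_X βᵀ + Σ_Z` almost surely. -/
theorem ae_SY_eq (M : FactorModel P d r) :
    ∀ᵐ ω ∂P, M.SY ω = M.β * M.SX ω * M.βᵀ + M.SZ ω := by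
  obtain ⟨ns, hns⟩ := M.exists_seq_realizedCov
  filter_upwards [hns, M.factor_eq] with ω hω hY
  obtain ⟨hX, hYY, hZ, hZX⟩ := hω
  ext i j
  -- Bilinearity is exact on each partition. The cross terms vanish in the limit by `[Z, X]_1 = 0`,
  -- and uniqueness of limits gives the identity.
  have hexp : ∀ N, realizedCov (M.Y i) (M.Y j) N ω =
      ∑ l, (∑ k, M.β i k * realizedCov (M.X k) (M.X l) N ω) * M.β j l +
        ∑ k, M.β i k * realizedCov (M.Z j) (M.X k) N ω +
        ∑ l, M.β j l * realizedCov (M.Z i) (M.X l) N ω + realizedCov (M.Z i) (M.Z j) N ω := by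
    intro N
    have hinc : ∀ i p, M.Y i (uniformPartition N (p + 1)) ω - M.Y i (uniformPartition N p) ω =
        ∑ k, M.β i k * (M.X k (uniformPartition N (p + 1)) ω - M.X k (uniformPartition N p) ω) +
          (M.Z i (uniformPartition N (p + 1)) ω - M.Z i (uniformPartition N p) ω) := by
      intro i p
      rw [hY, hY]
      simp only [mul_sub, Finset.sum_sub_distrib]
      ring
    have swap₁ : ∀ (c : Fin r → ℝ) (F : Fin r → ℕ → ℝ),
        ∑ k, c k * ∑ p ∈ Finset.range (N + 1), F k p =
          ∑ p ∈ Finset.range (N + 1), ∑ k, c k * F k p := by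
      intro c F
      simp only [Finset.mul_sum]
      exact Finset.sum_comm
    have swap₂ : ∀ (c : Fin r → ℝ) (F : Fin r → ℕ → ℝ),
        ∑ k, (∑ p ∈ Finset.range (N + 1), F k p) * c k =
          ∑ p ∈ Finset.range (N + 1), ∑ k, F k p * c k := by
      intro c F
      simp only [Finset.sum_mul]
      exact Finset.sum_comm
    simp only [realizedCov, hinc, swap₁, swap₂, ← Finset.sum_add_distrib]
    refine Finset.sum_congr rfl fun p _ => ?_
    have h₁ : ∀ (x : Fin r → ℝ) (zi zj : ℝ),
        (∑ k, M.β i k * x k + zi) * (∑ k, M.β j k * x k + zj) =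
        ∑ l, (∑ k, M.β i k * (x k * x l)) * M.β j l + ∑ k, M.β i k * (zj * x k) +
          ∑ l, M.β j l * (zi * x l) + zi * zj := by
      intro x zi zj
      have e₁ : ∑ l, (∑ k, M.β i k * (x k * x l)) * M.β j l =
          (∑ k, M.β i k * x k) * ∑ l, M.β j l * x l := by
        rw [Finset.mul_sum]
        refine Finset.sum_congr rfl fun l _ => ?_
        simp only [← mul_assoc]
        rw [← Finset.sum_mul]
        ring
      have e₂ : ∑ k, M.β i k * (zj * x k) = zj * ∑ k, M.β i k * x k := by
        rw [Finset.mul_sum]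
        exact Finset.sum_congr rfl fun _ _ => by ring
      have e₃ : ∑ k, M.β j k * (zi * x k) = zi * ∑ k, M.β j k * x k := by
        rw [Finset.mul_sum]
        exact Finset.sum_congr rfl fun _ _ => by ring
      rw [e₁, e₂, e₃]
      ring
    exact (h₁ (fun k => M.X k (uniformPartition N (p + 1)) ω - M.X k (uniformPartition N p) ω)
      _ _).trans (by simp only [Finset.sum_add_distrib])
  refine tendsto_nhds_unique (hYY i j) ?_
  simp only [hexp, Matrix.add_apply, Matrix.mul_apply, Matrix.transpose_apply]
  have : Tendsto (fun n => ∑ l, (∑ k, M.β i k * realizedCov (M.X k) (M.X l) (ns n) ω) * M.β j l +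
        ∑ k, M.β i k * realizedCov (M.Z j) (M.X k) (ns n) ω +
        ∑ l, M.β j l * realizedCov (M.Z i) (M.X l) (ns n) ω +
        realizedCov (M.Z i) (M.Z j) (ns n) ω) atTop
      (𝓝 (∑ l, (∑ k, M.β i k * M.SX ω k l) * M.β j l + ∑ k, M.β i k * 0 + ∑ l, M.β j l * 0 +
        M.SZ ω i j)) :=
    (((tendsto_finsetSum _ fun l _ => (tendsto_finsetSum _ fun k _ =>
      (hX k l).const_mul _).mul_const _).add (tendsto_finsetSum _ fun k _ =>
        (hZX j k).const_mul _)).add (tendsto_finsetSum _ fun l _ => (hZX i l).const_mul _)).add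
      (hZ i j)
  simpa using this

end FactorModel

/-! ### Norms, extreme eigenvalues and consequences of pervasive loadings. -/

theorem entryMax_nonneg {l k : Type*} (A : Matrix l k ℝ) : 0 ≤ entryMax A :=
  Real.iSup_nonneg fun _ => abs_nonneg _

theorem abs_apply_le_entryMax {l k : Type*} [Finite l] [Finite k] (A : Matrix l k ℝ) (i : l)
    (j : k) : |A i j| ≤ entryMax A :=
  le_ciSup (f := fun p : l × k => |A p.1 p.2|) (Set.finite_range _).bddAbove (i, j)

theorem opNormInf_nonneg {l k : Type*} [Fintype l] [Fintype k] [DecidableEq k]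
    (A : Matrix l k ℝ) : 0 ≤ opNormInf A :=
  norm_nonneg _

theorem abs_mulVec_le_opNormInf {l k : Type*} [Fintype l] [Fintype k] [DecidableEq k]
    (A : Matrix l k ℝ) {x : k → ℝ} {c : ℝ} (hc : 0 ≤ c) (hx : ∀ j, |x j| ≤ c) (i : l) :
    |(A *ᵥ x) i| ≤ opNormInf A * c := by
  have h₁ : ‖A *ᵥ x‖ ≤ opNormInf A * ‖x‖ :=
    (LinearMap.toContinuousLinearMap (Matrix.mulVecLin A)).le_opNorm x
  have h₂ : ‖x‖ ≤ c := (pi_norm_le_iff_of_nonneg hc).2 hx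
  exact ((norm_le_pi_norm (A *ᵥ x) i).trans h₁).trans
    (mul_le_mul_of_nonneg_left h₂ (opNormInf_nonneg A))

theorem abs_qf_le_opNormTwo {k : Type*} [Fintype k] [DecidableEq k] (A : Matrix k k ℝ)
    (v : k → ℝ) : |v ⬝ᵥ A *ᵥ v| ≤ opNormTwo A * (v ⬝ᵥ v) := by
  set w : EuclideanSpace ℝ k := WithLp.toLp 2 v
  have h₁ : v ⬝ᵥ A *ᵥ v = inner ℝ w (Matrix.toEuclideanCLM (𝕜 := ℝ) A w) := by
    simp [w, EuclideanSpace.inner_eq_star_dotProduct, dotProduct_comm]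
  have h₂ : v ⬝ᵥ v = ‖w‖ * ‖w‖ := by
    rw [← real_inner_self_eq_norm_mul_norm, EuclideanSpace.inner_eq_star_dotProduct]
    simp [w]
  rw [h₁, h₂]
  refine (abs_real_inner_le_norm _ _).trans ?_
  calc ‖w‖ * ‖Matrix.toEuclideanCLM (𝕜 := ℝ) A w‖
      ≤ ‖w‖ * (opNormTwo A * ‖w‖) :=
        mul_le_mul_of_nonneg_left (ContinuousLinearMap.le_opNorm _ _) (norm_nonneg _)
    _ = opNormTwo A * (‖w‖ * ‖w‖) := by ring

section Spectrum

variable {k : Type*} [Fintype k] [DecidableEq k] {A : Matrix k k ℝ}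

theorem Matrix.IsHermitian.finite_spectrum (hA : A.IsHermitian) : (spectrum ℝ A).Finite := by
  rw [hA.spectrum_real_eq_range_eigenvalues]
  exact Set.finite_range _

/-- A lower bound of the spectrum is a lower bound in the Loewner order, by functional calculus.
Finiteness of the spectrum makes the infimum a genuine lower bound. -/
theorem eigMin_mul_le_qf (hA : A.IsHermitian) (v : k → ℝ) :
    eigMin A * (v ⬝ᵥ v) ≤ v ⬝ᵥ A *ᵥ v := by
  have h : algebraMap ℝ _ (eigMin A) ≤ A :=
    (algebraMap_le_iff_le_spectrum (a := A) hA).2 fun x hx =>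
      csInf_le hA.finite_spectrum.bddBelow hx
  have := (Matrix.le_iff.1 h).dotProduct_mulVec_nonneg v
  simp [Matrix.sub_mulVec, dotProduct_sub, Algebra.algebraMap_eq_smul_one,
    Matrix.smul_mulVec, dotProduct_smul] at this
  exact this

theorem qf_le_eigMax_mul (hA : A.IsHermitian) (v : k → ℝ) :
    v ⬝ᵥ A *ᵥ v ≤ eigMax A * (v ⬝ᵥ v) := by
  have h : A ≤ algebraMap ℝ _ (eigMax A) :=
    (le_algebraMap_iff_spectrum_le (a := A) hA).2 fun x hx =>
      le_csSup hA.finite_spectrum.bddAbove hx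
  have := (Matrix.le_iff.1 h).dotProduct_mulVec_nonneg v
  simp [Matrix.sub_mulVec, dotProduct_sub, Algebra.algebraMap_eq_smul_one,
    Matrix.smul_mulVec, dotProduct_smul] at this
  exact this

theorem eigMin_pos [Nonempty k] (hA : A.PosDef) : 0 < eigMin A := by
  have hne : (spectrum ℝ A).Nonempty := by
    rw [hA.1.spectrum_real_eq_range_eigenvalues]
    exact Set.range_nonempty _
  have hmem : eigMin A ∈ spectrum ℝ A := hne.csInf_mem hA.1.finite_spectrum
  rw [hA.1.spectrum_real_eq_range_eigenvalues] at hmem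
  obtain ⟨i, hi⟩ := hmem
  rw [← hi]
  exact hA.eigenvalues_pos i

theorem eigMax_pos [Nonempty k] (hA : A.PosDef) : 0 < eigMax A := by
  have hne : (spectrum ℝ A).Nonempty := by
    rw [hA.1.spectrum_real_eq_range_eigenvalues]
    exact Set.range_nonempty _
  exact (eigMin_pos hA).trans_le
    (csInf_le_csSup hne hA.1.finite_spectrum.bddBelow hA.1.finite_spectrum.bddAbove)

theorem inv_mul_le_qf_of_inv_eigMin_le [Nonempty k] (hA : A.PosDef) {K : ℝ}
    (h : 1 / eigMin A ≤ K) (v : k → ℝ) : K⁻¹ * (v ⬝ᵥ v) ≤ v ⬝ᵥ A *ᵥ v := by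
  refine le_trans ?_ (eigMin_mul_le_qf hA.1 v)
  refine mul_le_mul_of_nonneg_right ?_ (dotProduct_self_nonneg' v)
  rw [one_div] at h
  exact inv_le_of_inv_le₀ (eigMin_pos hA) h

end Spectrum

/-- If the loadings have a pervasive Gram matrix, the diagonal of `β S βᵀ + T` controls the
number of factors. -/
theorem card_factors_le {d r : ℕ} (hd : 0 < d) {β : Matrix (Fin d) (Fin r) ℝ}
    {S : Matrix (Fin r) (Fin r) ℝ} {T : Matrix (Fin d) (Fin d) ℝ} (hT : T.PosSemidef)
    {c e K : ℝ} (he : 0 < e) (hc : 0 < c) (hβ : ∀ v, c * d * (v ⬝ᵥ v) ≤ (β *ᵥ v) ⬝ᵥ (β *ᵥ v))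
    (hS : ∀ v, e * (v ⬝ᵥ v) ≤ v ⬝ᵥ S *ᵥ v) (hK : entryMax (β * S * βᵀ + T) ≤ K) :
    (r : ℝ) ≤ K / (c * e) := by
  have hd0 : (0 : ℝ) < d := Nat.cast_pos.2 hd
  have hrow : ∀ i, e * (β i ⬝ᵥ β i) ≤ K := fun i => by
    have h₁ := hS (β i)
    have h₂ : (β * S * βᵀ) i i = β i ⬝ᵥ S *ᵥ β i := by
      rw [Matrix.mul_assoc, Matrix.mul_apply]
      rfl
    have h₃ : 0 ≤ T i i := hT.diag_nonneg
    have h₄ := (le_abs_self _).trans ((abs_apply_le_entryMax (β * S * βᵀ + T) i i).trans hK)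
    rw [Matrix.add_apply, h₂] at h₄
    linarith
  have hcol : ∀ k, c * d ≤ ∑ i, β i k ^ 2 := fun k => by
    have := hβ (Pi.single k 1)
    simpa [dotProduct, sq, Matrix.mulVec_single_one, Matrix.col, Pi.single_apply] using this
  -- The squared Frobenius norm of `β` is counted twice: each of the `r` columns contributes at
  -- least `c d`, and each of the `d` rows at most `K / e`. The dimension cancels.
  have hsum : (r : ℝ) * (c * d) ≤ ∑ i, β i ⬝ᵥ β i := by
    have h₁ : ∑ i, β i ⬝ᵥ β i = ∑ k, ∑ i, β i k ^ 2 := by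
      rw [Finset.sum_comm]
      simp [dotProduct, sq]
    rw [h₁]
    simpa using Finset.sum_le_sum fun k (_ : k ∈ Finset.univ) => hcol k
  have hsum' : e * ∑ i, β i ⬝ᵥ β i ≤ d * K := by
    rw [Finset.mul_sum]
    simpa using Finset.sum_le_sum fun i (_ : i ∈ Finset.univ) => hrow i
  rw [le_div_iff₀ (mul_pos hc he)]
  have := mul_le_mul_of_nonneg_left hsum he.le
  exact le_of_mul_le_mul_left (by linarith) hd0

/-- The form of `B` is at least `K⁻¹`, and the perturbation of the normalized Gram matrix takes away
at most half of it. -/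
theorem gram_lower_bound {d r : ℕ} (hd : 0 < d) (hr : 0 < r) {β : Matrix (Fin d) (Fin r) ℝ}
    {B : Matrix (Fin r) (Fin r) ℝ} (hB : B.PosDef) {K : ℝ} (hK : 0 < K)
    (hmin : (eigMin B)⁻¹ ≤ K)
    (hop : opNormTwo ((d : ℝ)⁻¹ • (βᵀ * β) - B) ≤ (2 * K)⁻¹) (v : Fin r → ℝ) :
    (2 * K)⁻¹ * d * (v ⬝ᵥ v) ≤ (β *ᵥ v) ⬝ᵥ (β *ᵥ v) := by
  have hd0 : (0 : ℝ) < d := Nat.cast_pos.2 hd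
  have : Nonempty (Fin r) := ⟨⟨0, hr⟩⟩
  have h₁ := inv_mul_le_qf_of_inv_eigMin_le hB (by simpa using hmin) v
  have h₂ := (neg_abs_le _).trans' (neg_le_neg (abs_qf_le_opNormTwo
    ((d : ℝ)⁻¹ • (βᵀ * β) - B) v))
  have h₃ : v ⬝ᵥ ((d : ℝ)⁻¹ • (βᵀ * β) - B) *ᵥ v =
      (d : ℝ)⁻¹ * ((β *ᵥ v) ⬝ᵥ (β *ᵥ v)) - v ⬝ᵥ B *ᵥ v := by
    rw [Matrix.sub_mulVec, dotProduct_sub, Matrix.smul_mulVec, dotProduct_smul, smul_eq_mul,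
      ← Matrix.mulVec_mulVec, Matrix.dotProduct_mulVec v βᵀ, Matrix.vecMul_transpose]
  have h₄ := mul_le_mul_of_nonneg_right hop (dotProduct_self_nonneg' v)
  rw [h₃] at h₂
  have h₅ : (2 * K)⁻¹ * (v ⬝ᵥ v) ≤ (d : ℝ)⁻¹ * ((β *ᵥ v) ⬝ᵥ (β *ᵥ v)) := by
    have : K⁻¹ = 2 * (2 * K)⁻¹ := by field_simp
    rw [this] at h₁
    linarith
  have := mul_le_mul_of_nonneg_left h₅ hd0.le
  rw [mul_inv_cancel_left₀ hd0.ne'] at this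
  linarith

/-! ### Calculus of high-probability events. -/

/-- Along the sequence of probability spaces, `p n` eventually holds up to probability `τ`. -/
def EventuallyUpTo {Ω : ℕ → Type*} [∀ n, MeasurableSpace (Ω n)] (P : ∀ n, Measure (Ω n))
    (τ : ℝ) (p : ∀ n, Ω n → Prop) : Prop :=
  ∀ᶠ n in atTop, (P n).real {ω | ¬ p n ω} ≤ τ

section EventuallyUpTo

variable {Ω : ℕ → Type*} [∀ n, MeasurableSpace (Ω n)] {P : ∀ n, Measure (Ω n)}
  [∀ n, IsProbabilityMeasure (P n)] {τ τ' : ℝ} {p q : ∀ n, Ω n → Prop}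

theorem EventuallyUpTo.mono (hp : EventuallyUpTo P τ p)
    (h : ∀ᶠ n in atTop, ∀ᵐ ω ∂P n, p n ω → q n ω) : EventuallyUpTo P τ q := by
  filter_upwards [hp, h] with n hn hh
  refine le_trans ?_ hn
  refine ENNReal.toReal_mono (measure_ne_top _ _) (measure_mono_ae ?_)
  filter_upwards [hh] with ω hω hq hp
  exact hq (hω hp)

omit [∀ n, IsProbabilityMeasure (P n)] in
theorem EventuallyUpTo.mono_const (hp : EventuallyUpTo P τ p) (h : τ ≤ τ') :
    EventuallyUpTo P τ' p :=
  Eventually.mono hp fun _ hn => hn.trans h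

theorem EventuallyUpTo.and (hp : EventuallyUpTo P τ p) (hq : EventuallyUpTo P τ' q) :
    EventuallyUpTo P (τ + τ') fun n ω => p n ω ∧ q n ω := by
  filter_upwards [hp, hq] with n h₁ h₂
  refine (measureReal_mono (s₂ := {ω | ¬ p n ω} ∪ {ω | ¬ q n ω}) fun ω hω => ?_).trans
    ((measureReal_union_le _ _).trans (add_le_add h₁ h₂))
  by_contra hc
  exact hω ⟨not_not.1 fun h => hc (Or.inl h), not_not.1 fun h => hc (Or.inr h)⟩

/-- Transfers deterministic conclusions out of stochastic bounds: an event of positive probability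
contains a point, and one point suffices for a claim not involving `ω`. -/
theorem EventuallyUpTo.eventually_exists (hp : EventuallyUpTo P τ p) (hτ : τ < 1) :
    ∀ᶠ n in atTop, ∃ ω, p n ω := by
  filter_upwards [hp] with n hn
  by_contra! hc
  have : {ω | ¬ p n ω} = Set.univ := Set.eq_univ_of_forall hc
  rw [this, probReal_univ] at hn
  linarith

omit [∀ n, IsProbabilityMeasure (P n)] in
theorem IsBigOProb.eventuallyUpTo {ξ : ∀ n, Ω n → ℝ} {b : ℕ → ℝ} (h : IsBigOProb P ξ b)
    (hτ : 0 < τ) : ∃ K : ℝ, EventuallyUpTo P τ fun n ω => |ξ n ω| ≤ K * b n := by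
  obtain ⟨K, hK⟩ := h τ hτ
  exact ⟨K, by simpa only [EventuallyUpTo, not_le] using hK⟩

omit [∀ n, IsProbabilityMeasure (P n)] in
theorem TendstoZeroInProb.eventuallyUpTo {ξ : ∀ n, Ω n → ℝ} (h : TendstoZeroInProb P ξ)
    (hτ : 0 < τ) {ε : ℝ} (hε : 0 < ε) : EventuallyUpTo P τ fun n ω => |ξ n ω| ≤ ε := by
  filter_upwards [(h ε hε).eventually_lt_const hτ] with n hn
  simpa only [not_le] using hn.le

omit [∀ n, IsProbabilityMeasure (P n)] in
theorem tendsto_measureReal_not_of_eventuallyUpTo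
    (h : ∀ τ : ℝ, 0 < τ → EventuallyUpTo P τ p) :
    Tendsto (fun n => (P n).real {ω | ¬ p n ω}) atTop (𝓝 0) := by
  rw [Metric.tendsto_atTop']
  intro ε hε
  obtain ⟨N, hN⟩ := eventually_atTop.1 (h (ε / 2) (half_pos hε))
  refine ⟨N, fun n hn => ?_⟩
  rw [Real.dist_0_eq_abs, abs_of_nonneg measureReal_nonneg]
  linarith [hN n hn.le]

end EventuallyUpTo

/-! ### Passage from deterministic bounds to the asymptotic statement. -/

/-- `(Θ ⊗ Θ) vec D = vec (Θ D Θ)` for symmetric `Θ`; the difference of the two linearized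
estimators is `J vec (A + Θ D Θ)`. -/
theorem smul_mulVec_vec_sub {m d : ℕ} (a : ℝ) (J : Matrix (Fin m) (Fin d × Fin d) ℝ)
    {T : Matrix (Fin d) (Fin d) ℝ} (hT : Tᵀ = T) (A D : Matrix (Fin d) (Fin d) ℝ) :
    a • (J *ᵥ Matrix.vec A) - a • (-(J * (T ⊗ₖ T)) *ᵥ Matrix.vec D) =
      a • (J *ᵥ Matrix.vec (A + T * D * T)) := by
  rw [Matrix.neg_mulVec, ← Matrix.mulVec_mulVec, Matrix.kronecker_mulVec_vec, hT, ← smul_sub,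
    sub_neg_eq_add, ← Matrix.mulVec_add, ← Matrix.vec_add]

/-- Puts the entrywise expansion into the form required by the comparison of distribution functions,
including the factor `√(log (m + 1))`. Each of the two error rates receives half of `η`. -/
theorem GoodEvent.scaled_expansion_le {Ω : Type*} [MeasurableSpace Ω] {d r m : ℕ}
    {E : FactorEstimators Ω d r} {β : Matrix (Fin d) (Fin r) ℝ}
    {SX : Matrix (Fin r) (Fin r) ℝ} {SZ : Matrix (Fin d) (Fin d) ℝ} {s deg κ : ℝ} {ω : Ω}
    (h : GoodEvent E β SX SZ s deg κ ω) (hκ : 1 ≤ κ) (hs : 1 ≤ s) (hdeg : 1 ≤ deg) (hd : 0 < d)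
    {a η : ℝ} (ha : 0 < a) (J : Matrix (Fin m) (Fin d × Fin d) ℝ)
    (h₁ : a * opNormInf J * E.lam ω ^ 2 * s * Real.sqrt (deg * Real.log ((m : ℝ) + 1)) ≤
      η / 2 / (40000 * κ ^ 8))
    (h₂ : a * opNormInf J * r * deg * Real.sqrt (Real.log ((m : ℝ) + 1)) / d ≤
      η / 2 / (300 * κ ^ 8)) (i : Fin m) :
    |(a • (J *ᵥ Matrix.vec ((E.hSYlam ω)⁻¹ - E.ΓZ ω - (β * SX * βᵀ + SZ)⁻¹))) i -
      (a • (-(J * (SZ⁻¹ ⊗ₖ SZ⁻¹)) *ᵥ Matrix.vec (E.breveSZ β ω - SZ))) i| *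
        Real.sqrt (Real.log ((m : ℝ) + 1)) ≤ η := by
  set L := Real.sqrt (Real.log ((m : ℝ) + 1)) with hL
  have hκ0 : 0 < κ := by linarith
  have hd0 : (0 : ℝ) < d := Nat.cast_pos.2 hd
  have hZ : (SZ⁻¹)ᵀ = SZ⁻¹ := h.posDef_SZ.inv.transpose_eq
  rw [← Pi.sub_apply, smul_mulVec_vec_sub a J hZ, Pi.smul_apply, smul_eq_mul, abs_mul,
    abs_of_pos ha]
  have hJ := abs_mulVec_le_opNormInf J
    (x := Matrix.vec ((E.hSYlam ω)⁻¹ - E.ΓZ ω - (β * SX * βᵀ + SZ)⁻¹ +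
      SZ⁻¹ * (E.breveSZ β ω - SZ) * SZ⁻¹))
    (c := 40000 * κ ^ 8 * (s * √deg * E.lam ω ^ 2) + 300 * κ ^ 8 * (deg * r / d))
    -- The indices are swapped because `Matrix.vec` stacks columns.
    (by positivity) (fun p => h.expansion hκ hs hdeg hd p.2 p.1) i
  rw [Real.sqrt_mul (by linarith), ← hL] at h₁
  rw [le_div_iff₀ (by positivity)] at h₁ h₂
  calc a * |(J *ᵥ Matrix.vec ((E.hSYlam ω)⁻¹ - E.ΓZ ω - (β * SX * βᵀ + SZ)⁻¹ +
        SZ⁻¹ * (E.breveSZ β ω - SZ) * SZ⁻¹)) i| * L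
      ≤ a * (opNormInf J * (40000 * κ ^ 8 * (s * √deg * E.lam ω ^ 2) +
          300 * κ ^ 8 * (deg * r / d))) * L := by gcongr
    _ = a * opNormInf J * E.lam ω ^ 2 * s * (√deg * L) * (40000 * κ ^ 8) +
          a * opNormInf J * r * deg * L / d * (300 * κ ^ 8) := by ring
    _ ≤ η / 2 + η / 2 := add_le_add h₁ h₂
    _ = η := add_halves η

/-- Up to an arbitrarily small probability, the model and the estimators are eventually in the
regular regime described by `GoodEvent`, with a constant independent of `n`. -/
theorem exists_eventuallyUpTo_goodEvent
    {Ω : ℕ → Type*} [∀ n, MeasurableSpace (Ω n)]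
    {P : ∀ n, Measure (Ω n)} [∀ n, IsProbabilityMeasure (P n)]
    {d r : ℕ → ℕ} (hd : ∀ n, 0 < d n) (hr : ∀ n, 0 < r n)
    (M : ∀ n, FactorModel (P n) (d n) (r n)) (E : ∀ n, FactorEstimators (Ω n) (d n) (r n))
    (hSY : IsBigOProb P (fun n ω => entryMax ((M n).SY ω)) fun _ => 1)
    (hβ : (fun n => entryMax (M n).β) =O[atTop] fun _ => (1 : ℝ))
    (hSZ : IsBigOProb P
      (fun n ω => eigMax ((M n).SZ ω) + 1 / eigMin ((M n).SZ ω)) fun _ => 1)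
    (hSX : IsBigOProb P
      (fun n ω => entryMax ((M n).SX ω) + 1 / eigMin ((M n).SX ω)) fun _ => 1)
    {s : ℕ → ℝ} (hs : ∀ n, 1 ≤ s n)
    (hsparse : IsBigOProb P (fun n ω => (offDiagCount ((M n).ΘZ ω) : ℝ)) s)
    {deg : ℕ → ℝ} (hdeg : ∀ n, 1 ≤ deg n)
    (hdegree : IsBigOProb P (fun n ω => (maxDegree ((M n).ΘZ ω) : ℝ)) deg)
    {B : ∀ n, Matrix (Fin (r n)) (Fin (r n)) ℝ} (hB : ∀ n, (B n).PosDef)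
    (hload : Tendsto
      (fun n => opNormTwo ((d n : ℝ)⁻¹ • ((M n).βᵀ * (M n).β) - B n)) atTop (𝓝 0))
    (hBmin : (fun n => (eigMin (B n))⁻¹) =O[atTop] fun _ => (1 : ℝ))
    (hestX : TendstoZeroInProb P fun n ω =>
      ((E n).lam ω)⁻¹ * entryMax ((E n).hSX ω - (M n).SX ω))
    (hestYX : TendstoZeroInProb P fun n ω =>
      ((E n).lam ω)⁻¹ * entryMax ((E n).hSYX ω - (M n).β * (E n).hSX ω))
    (hestZ : TendstoZeroInProb P fun n ω =>
      ((E n).lam ω)⁻¹ * entryMax ((E n).breveSZ (M n).β ω - (M n).SZ ω))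
    (hrate : TendstoZeroInProb P fun n ω => (s n + r n) * (E n).lam ω)
    {τ : ℝ} (hτ : 0 < τ) :
    ∃ κ : ℝ, 1 ≤ κ ∧ EventuallyUpTo P τ fun n ω =>
      (M n).SY ω = (M n).β * (M n).SX ω * (M n).βᵀ + (M n).SZ ω ∧
        GoodEvent (E n) (M n).β ((M n).SX ω) ((M n).SZ ω) (s n) (deg n) κ ω := by
  -- Nine stochastic bounds share the budget `τ`. The cap at `1/2` leaves three of them a joint
  -- event of positive probability.
  set t := min τ (1 / 2) / 9 with ht
  have ht0 : 0 < t := by positivity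
  have htτ : 9 * t ≤ τ := by
    have := min_le_left τ (1 / 2)
    linarith
  have ht1 : 3 * t < 1 := by
    have := min_le_right τ (1 / 2)
    linarith
  have hne : ∀ n, Nonempty (Fin (d n)) := fun n => ⟨⟨0, hd n⟩⟩
  have hne' : ∀ n, Nonempty (Fin (r n)) := fun n => ⟨⟨0, hr n⟩⟩
  obtain ⟨KY, hKY⟩ := hSY.eventuallyUpTo ht0
  obtain ⟨KZ, hKZ⟩ := hSZ.eventuallyUpTo ht0
  obtain ⟨KX, hKX⟩ := hSX.eventuallyUpTo ht0
  obtain ⟨Ks, hKs⟩ := hsparse.eventuallyUpTo ht0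
  obtain ⟨Kd, hKd⟩ := hdegree.eventuallyUpTo ht0
  obtain ⟨Kβ, hKβ⟩ := hβ.bound
  obtain ⟨KB, hKB⟩ := hBmin.bound
  simp only [mul_one] at hKY hKZ hKX
  set K := max 1 (max KX (max KZ KB)) with hK
  have hK1 : 1 ≤ K := le_max_left _ _
  have hK0 : 0 < K := by linarith
  have hKXK : KX ≤ K := (le_max_left _ _).trans (le_max_right _ _)
  have hKZK : KZ ≤ K := (le_max_left _ _).trans ((le_max_right _ _).trans (le_max_right _ _))
  have hKBK : KB ≤ K := (le_max_right _ _).trans ((le_max_right _ _).trans (le_max_right _ _))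
  have hlower : ∀ᶠ n in atTop, ∀ v : Fin (r n) → ℝ,
      (2 * K)⁻¹ * d n * (v ⬝ᵥ v) ≤ ((M n).β *ᵥ v) ⬝ᵥ ((M n).β *ᵥ v) := by
    filter_upwards [hKB, hload.eventually_lt_const (show (0 : ℝ) < (2 * K)⁻¹ by positivity)]
      with n h₁ h₂
    refine gram_lower_bound (hd n) (hr n) (hB n) hK0 ?_ h₂.le
    rw [norm_one, mul_one] at h₁
    exact (le_abs_self _).trans (h₁.trans hKBK)
  have hSXlow : ∀ n ω, ((M n).SX ω).PosDef →
      |entryMax ((M n).SX ω) + 1 / eigMin ((M n).SX ω)| ≤ KX →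
      ∀ v : Fin (r n) → ℝ, K⁻¹ * (v ⬝ᵥ v) ≤ v ⬝ᵥ (M n).SX ω *ᵥ v := by
    intro n ω hp h
    have := hne' n
    refine inv_mul_le_qf_of_inv_eigMin_le hp ?_
    have := entryMax_nonneg ((M n).SX ω)
    linarith [(le_abs_self _).trans h]
  set R := KY / ((2 * K)⁻¹ * K⁻¹) with hR
  -- The number of factors is bounded, since bounded diagonal entries of `Σ_Y` are incompatible with
  -- many pervasive factors. As `r n` is deterministic, a single good `ω` for each `n` proves it.
  have hrR : ∀ᶠ n in atTop, (r n : ℝ) ≤ R := by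
    have hex := (((hKY.and hKZ).and hKX).mono (q := fun n ω =>
      ((M n).SY ω = (M n).β * (M n).SX ω * (M n).βᵀ + (M n).SZ ω ∧ ((M n).SX ω).PosDef ∧
        ((M n).SZ ω).PosDef) ∧ |entryMax ((M n).SY ω)| ≤ KY ∧
        |entryMax ((M n).SX ω) + 1 / eigMin ((M n).SX ω)| ≤ KX)
      (Eventually.of_forall fun n => by
        filter_upwards [(M n).ae_SY_eq, (M n).ae_posDef_SX, (M n).ae_posDef_SZ]
          with ω h₁ h₂ h₃ h
        exact ⟨⟨h₁, h₂, h₃⟩, h.1.1, h.2⟩)).eventually_exists (by linarith)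
    filter_upwards [hex, hlower] with n ⟨ω, ⟨h₁, h₂, h₃⟩, h₄, h₅⟩ h₆
    refine card_factors_le (hd n) h₃.posSemidef (by positivity) (by positivity) h₆
      (hSXlow n ω h₂ h₅) ?_
    rw [← h₁]
    exact (le_abs_self _).trans h₄
  set κ := max (2 * K) (max R (max Ks (max Kd Kβ))) with hκ
  have hκK : 2 * K ≤ κ := le_max_left _ _
  have hκR : R ≤ κ := (le_max_left _ _).trans (le_max_right _ _)
  have hκs : Ks ≤ κ := (le_max_left _ _).trans ((le_max_right _ _).trans (le_max_right _ _))
  have hκd : Kd ≤ κ := (le_max_left _ _).trans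
    ((le_max_right _ _).trans ((le_max_right _ _).trans (le_max_right _ _)))
  have hκβ : Kβ ≤ κ := (le_max_right _ _).trans
    ((le_max_right _ _).trans ((le_max_right _ _).trans (le_max_right _ _)))
  have hκ1 : 1 ≤ κ := by linarith
  have hκ0 : 0 < κ := by linarith
  have hinv : κ⁻¹ ≤ K⁻¹ := inv_anti₀ hK0 (by linarith)
  have hinv' : κ⁻¹ ≤ (2 * K)⁻¹ := inv_anti₀ (by positivity) hκK
  have hε : 0 < (4000 * κ ^ 7)⁻¹ := by positivity
  have hclose : ∀ {l k : ℕ} {x : ℝ} {A : Matrix (Fin l) (Fin k) ℝ}, 0 < x →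
      |x⁻¹ * entryMax A| ≤ (4000 * κ ^ 7)⁻¹ → ∀ i j, 4000 * κ ^ 7 * |A i j| ≤ x := by
    intro l k x A hx h i j
    have h₁ := (le_abs_self _).trans h
    rw [inv_mul_le_iff₀ hx, ← div_eq_mul_inv, le_div_iff₀ (by positivity)] at h₁
    have h₂ := mul_le_mul_of_nonneg_left (abs_apply_le_entryMax A i j)
      (show 0 ≤ 4000 * κ ^ 7 by positivity)
    linarith
  refine ⟨κ, hκ1, ?_⟩
  have hall := (((hKY.and hKZ).and hKX).and (hKs.and hKd)).and
    (((hestX.eventuallyUpTo ht0 hε).and (hestYX.eventuallyUpTo ht0 hε)).and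
      ((hestZ.eventuallyUpTo ht0 hε).and (hrate.eventuallyUpTo ht0 hε)))
  have hsum : t + t + t + (t + t) + (t + t + (t + t)) ≤ τ := by linarith
  refine EventuallyUpTo.mono (hall.mono_const hsum) ?_
  filter_upwards [hlower, hrR, hKβ] with n hlow hrn hβn
  filter_upwards [(M n).ae_SY_eq, (M n).ae_posDef_SX, (M n).ae_posDef_SZ] with ω h₁ h₂ h₃ h
  obtain ⟨⟨⟨⟨-, hZ⟩, hX⟩, hsp, hdg⟩, ⟨hcX, hcYX⟩, hcZ, hlam⟩ := h
  have := hne n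
  have hlp := (E n).lam_pos ω
  have hZ' := (le_abs_self _).trans (hZ.trans hKZK)
  have hmin := eigMin_pos h₃
  have hmax := eigMax_pos h₃
  have hnn : ∀ {k : ℕ} (v : Fin k → ℝ), 0 ≤ v ⬝ᵥ v := fun v => dotProduct_self_nonneg' v
  refine ⟨h₁, h₂, h₃, fun v => ?_, fun v => ?_, fun v => ?_, fun i k => ?_, fun v => ?_,
    hrn.trans hκR, ?_, ?_, hclose hlp hcX, hclose hlp hcYX, hclose hlp hcZ, ?_⟩
  · exact (mul_le_mul_of_nonneg_right hinv (hnn v)).trans (hSXlow n ω h₂ hX v)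
  · refine (mul_le_mul_of_nonneg_right hinv (hnn v)).trans
      (inv_mul_le_qf_of_inv_eigMin_le h₃ ?_ v)
    linarith
  · refine (qf_le_eigMax_mul h₃.1 v).trans (mul_le_mul_of_nonneg_right ?_ (hnn v))
    have : 0 < 1 / eigMin ((M n).SZ ω) := by positivity
    linarith
  · rw [norm_one, mul_one] at hβn
    exact (abs_apply_le_entryMax _ i k).trans ((le_abs_self _).trans (hβn.trans hκβ))
  · refine le_trans ?_ (hlow v)
    have := hnn v
    gcongr
  · refine ((le_abs_self _).trans hsp).trans (mul_le_mul_of_nonneg_right hκs ?_)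
    linarith [hs n]
  · refine ((le_abs_self _).trans hdg).trans (mul_le_mul_of_nonneg_right hκd ?_)
    linarith [hdeg n]
  · have h₄ := mul_le_mul_of_nonneg_left ((le_abs_self _).trans hlam)
      (show 0 ≤ 4000 * κ ^ 7 by positivity)
    rwa [mul_inv_cancel₀ (by positivity)] at h₄

end

theorem proposition3p8
    {Ω : ℕ → Type*} [∀ n, MeasurableSpace (Ω n)]
    (P : ∀ n, Measure (Ω n)) [∀ n, IsProbabilityMeasure (P n)]
    (d r m : ℕ → ℕ) (hd : ∀ n, 2 ≤ d n) (hr : ∀ n, 1 ≤ r n) (hm : ∀ n, 1 ≤ m n)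
    -- the factor model and the estimators (with penalty parameter `lam`) for every `n`
    (M : ∀ n, FactorModel (P n) (d n) (r n))
    (E : ∀ n, FactorEstimators (Ω n) (d n) (r n))
    -- boundedness of the covariation and the loadings
    (hSY : IsBigOProb P (fun n ω => entryMax ((M n).SY ω)) fun _ => 1)
    (hβ : (fun n => entryMax (M n).β) =O[atTop] fun _ => (1 : ℝ))
    -- eigenvalues of the residual covariation and of the factor covariation
    (hSZ : IsBigOProb P
      (fun n ω => eigMax ((M n).SZ ω) + 1 / eigMin ((M n).SZ ω)) fun _ => 1)
    (hSX : IsBigOProb P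
      (fun n ω => entryMax ((M n).SX ω) + 1 / eigMin ((M n).SX ω)) fun _ => 1)
    -- sparsity of the residual precision matrix
    (s : ℕ → ℝ) (hs : ∀ n, 1 ≤ s n)
    (hsparse : IsBigOProb P (fun n ω => (offDiagCount ((M n).ΘZ ω) : ℝ)) s)
    (deg : ℕ → ℝ) (hdeg : ∀ n, 1 ≤ deg n)
    (hdegree : IsBigOProb P (fun n ω => (maxDegree ((M n).ΘZ ω) : ℝ)) deg)
    -- pervasive loadings
    (B : ∀ n, Matrix (Fin (r n)) (Fin (r n)) ℝ) (hB : ∀ n, (B n).PosDef)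
    (hload : Tendsto
      (fun n => opNormTwo ((d n : ℝ)⁻¹ • ((M n).βᵀ * (M n).β) - B n)) atTop (𝓝 0))
    (hBmin : (fun n => (eigMin (B n))⁻¹) =O[atTop] fun _ => (1 : ℝ))
    -- accuracy of the initial estimators relative to the penalty parameter
    (hestX : TendstoZeroInProb P fun n ω =>
      ((E n).lam ω)⁻¹ * entryMax ((E n).hSX ω - (M n).SX ω))
    (hestYX : TendstoZeroInProb P fun n ω =>
      ((E n).lam ω)⁻¹ * entryMax ((E n).hSYX ω - (M n).β * (E n).hSX ω))
    (hestZ : TendstoZeroInProb P fun n ω =>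
      ((E n).lam ω)⁻¹ * entryMax ((E n).breveSZ (M n).β ω - (M n).SZ ω))
    (hrate : TendstoZeroInProb P fun n ω => (s n + r n) * (E n).lam ω)
    (hpsd : Tendsto (fun n => (P n).real {ω | ((E n).barS ω).PosSemidef}) atTop (𝓝 1))
    -- scaling, asymptotic covariance matrix and linear functionals
    (a : ℕ → ℝ) (ha : ∀ n, 0 < a n)
    (C : ∀ n, Ω n → Matrix (Fin (d n) × Fin (d n)) (Fin (d n) × Fin (d n)) ℝ)
    (hCmeas : ∀ n, MeasurableEntries (C n)) (hC : ∀ n ω, (C n ω).PosSemidef)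
    (J : ∀ n, Ω n → Matrix (Fin (m n)) (Fin (d n) × Fin (d n)) ℝ)
    (hJmeas : ∀ n, MeasurableEntries (J n))
    (hJrate : TendstoZeroInProb P fun n ω =>
      a n * opNormInf (J n ω) * (E n).lam ω ^ 2 * s n *
        Real.sqrt (deg n * Real.log ((m n : ℝ) + 1)))
    -- mixed normality of the estimator with known loadings
    (hAMN : Tendsto (fun n => ⨆ y : Fin (m n) → ℝ,
      |vecCDF (P n) (fun ω => a n •
          ((M n).tildeJ (J n) ω *ᵥ Matrix.vec ((E n).breveSZ (M n).β ω - (M n).SZ ω))) y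
        - mixedNormalCDF (P n) ((M n).tildeJ (J n)) (C n) y|) atTop (𝓝 0))
    -- asymptotic non-degeneracy of the limiting variances
    (hdiag : Tendsto (fun b : ℝ => limsup (fun n => (P n).real
        {ω | (⨅ i, ((M n).tildeJ (J n) ω * C n ω * ((M n).tildeJ (J n) ω)ᵀ) i i) < b}) atTop)
      (𝓝[>] 0) (𝓝 0))
    -- negligibility of the factor part
    (hfactor : TendstoZeroInProb P fun n ω =>
      a n * opNormInf (J n ω) * r n * deg n * Real.sqrt (Real.log ((m n : ℝ) + 1)) / d n) :
    Tendsto (fun n => ⨆ y : Fin (m n) → ℝ,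
      |vecCDF (P n) (fun ω => a n •
          (J n ω *ᵥ Matrix.vec (((E n).hSYlam ω)⁻¹ - (E n).ΓZ ω - ((M n).SY ω)⁻¹))) y
        - mixedNormalCDF (P n) ((M n).tildeJ (J n)) (C n) y|) atTop (𝓝 0) := by
  refine tendsto_iSup_vecCDF_sub_mixedNormalCDF_of_close P hm
    (fun n => (M n).measurableEntries_tildeJ (hJmeas n)) hCmeas hC hAMN hdiag fun η hη => ?_
  refine tendsto_measureReal_not_of_eventuallyUpTo fun τ hτ => ?_
  obtain ⟨κ, hκ, hgood⟩ := exists_eventuallyUpTo_goodEvent (fun n => by linarith [hd n])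
    (fun n => hr n) M E hSY hβ hSZ hSX hs hsparse hdeg hdegree hB hload hBmin hestX hestYX hestZ
    hrate (half_pos hτ)
  have hκ0 : 0 < κ := by linarith
  -- Half of the probability budget goes to the regular regime and a quarter to each of the two rate
  -- conditions involving `J`.
  have hsum : τ / 2 + (τ / 4 + τ / 4) ≤ τ := by linarith
  refine ((hgood.and ((hJrate.eventuallyUpTo (τ := τ / 4) (by positivity)
    (show 0 < η / 2 / (40000 * κ ^ 8) by positivity)).and
    (hfactor.eventuallyUpTo (τ := τ / 4) (by positivity)
    (show 0 < η / 2 / (300 * κ ^ 8) by positivity)))).mono_const hsum).mono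
    (Eventually.of_forall fun n => Eventually.of_forall fun ω h i => ?_)
  obtain ⟨⟨hS, hG⟩, h₁, h₂⟩ := h
  rw [hS]
  exact hG.scaled_expansion_le hκ (hs n) (hdeg n) (by linarith [hd n]) (ha n) (J n ω)
    ((le_abs_self _).trans h₁) ((le_abs_self _).trans h₂) i
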